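/- Let $\kappa_1<\dots<\kappa_n$ be generic real parameters: for every $1<p<n$ the sums $\sum_{i\in I}\kappa_i$ over $p$-element sets $I\subset[n]$ are pairwise distinct. **Le-diagrams.** Let $L$ be an irreducible Le-diagram of type $(k,n)$: a Young diagram inside a $k\times(n-k)$ rectangle, each box filled with $0$ or $+$, such that no $0$ has both a $+$ above it in its column and a $+$ to its left in its row, and every row and every column contains a $+$. Number the unit steps of its southeast border $1,\dots,n$ from the northeast corner. Replace each $0$ by a cross and each $+$ by an elbow (joining north to east and west to south), and give the northwest end of each pipe the label of its southeast end. $\pi=\pi(L)$ sends the label of a vertical (horizontal) border step to the label at the opposite end of that row (column). **The positroid cell.** For $\mathcal M\subset\binom{[n]}{k}$ let $S^{tnn}_{\mathcal M}$ be the set of points of $Gr_{k,n}$ represented by full-rank real $k\times n$ matrices $A$ with $\Delta_J(A)>0$ for $J\in\mathcal M$ and $\Delta_J(A)=0$ for $J\notin\mathcal M$. Assume that $S^{tnn}_{\mathcal M}\ne\emptyset$ and that $S^{tnn}_{\mathcal M}=S^{tnn}_{L}=S^{tnn}_{\pi}$, i.e. if $I_r$ is the lexicographically minimal element of $\mathcal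 M$ for the order $r<r+1<\dots<n<1<\dots<r-1$, then for all $i$ (mod $n$) we have $i\in I_i$ and $I_{i+1}=(I_i\setminus\{i\})\cup\{j\}$ with $j\ne i$ and $\pi(j)=i$. **Contour plots.** Let $\phi_i(\bar x,\bar y)=\kappa_i\bar x+\kappa_i^2\bar y+\kappa_i^3$, and let $\mathcal C_{-\infty}(\mathcal M)\subset\mathbb R^2$ be the locus where $\min_{J\in\mathcal M}\sum_{i\in J}\phi_i$ is not linear (not locally affine). For a matrix $A$ as above let $\mathcal C_t(u_A)\subset\mathbb R^2$ be the locus where $(x,y)\mapsto\max_{J\in\mathcal M}\{\ln(\Delta_J(A)K_J)+\sum_{i\in J}(\kappa_ix+\kappa_i^2y+\kappa_i^3t)\}$ is not linear, where $K_J=\prod_{i<j,\ i,j\in J}(\kappa_j-\kappa_i)$. **The graph $G_-(L)$.** In each elbow put a white vertex on the north–east arc and a black vertex on the west–south arc and join them by an edge. Erase the edges that end at the southeast border (the straight initial pieces of the pipes) and forget vertices of degree $2$. The $n$ boundary vertices are the west ends of the rows and the north ends of the columns, labelled by the pipes ending there; edges may cross (at crosses), which creates no vertices. Rules of the road: the trip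 $T_i$ starts at the boundary vertex $i$, turns right at black vertices, left at white vertices, and goes straight through crossings. Label each edge by the $i$ for which $T_i$ uses it; an edge is of type $[i,j]$, $i<j$, if its labels are exactly $i$ and $j$. **Theorem.** 1. $G_-(L)$ is a generalized plabic graph (a finite graph with black and white internal vertices, here all trivalent, in which each of the boundary vertices $1,\dots,n$ is incident to exactly one edge), and its trip permutation is $\pi$: for every $i$ the trip $T_i$ ends at $\pi(i)$. 2. Every edge of $G_-(L)$ has a type $[i,j]$ with $i<j$, and for every internal vertex there are $i<\ell<m$ such that its edges are, in counterclockwise order, of types $[i,\ell],[\ell,m],[i,m]$. Place this vertex at $$v_{i,\ell,m}=\bigl(\kappa_i\kappa_\ell+\kappa_i\kappa_m+\kappa_\ell\kappa_m,\;-(\kappa_i+\kappa_\ell+\kappa_m)\bigr).$$ Place each edge between two internal vertices as the segment joining them; place each edge of type $[i,j]$ with exactly one end on the boundary as the ray of slope $\kappa_i+\kappa_j$ (i.e. parallel to $\bar x+(\kappa_i+\kappa_j)\bar y=0$) from its internal vertex, with $\bar y\to-\infty$ if the boundary vertex is on the west side of the diagram and $\bar y\to+\infty$ if it is on the north side; place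 each edge of type $[i,j]$ with both ends on the boundary as the line $\phi_i=\phi_j$. Then the union of all placed edges is exactly $\mathcal C_{-\infty}(\mathcal M)$. Moreover: * distinct vertices are placed at distinct points, and two distinct placed edges meet in at most one point; * a segment that comes from an edge of type $[i,j]$ automatically has slope $\kappa_i+\kappa_j$; * a placed edge of type $[i,j]$ is a line-soliton of type $[i,j]$: at all but finitely many of its points, the minimum of $\sum_{s\in J}\phi_s$ over $J\in\mathcal M$ is attained at exactly two sets, of the form $S\cup\{i\}$ and $S\cup\{j\}$ with $i,j\notin S$; * from a black vertex exactly one of the three edges goes in the direction of increasing $\bar y$ and two in the direction of decreasing $\bar y$; from a white vertex exactly one goes in the direction of decreasing $\bar y$ and two in the direction of increasing $\bar y$. 3. In the coordinates $\bar x=x/t$, $\bar y=y/t$ (which for $t<0$ involve a rotation by $180^\circ$), $\mathcal C_{-\infty}(\mathcal M)$ is the limit of $\mathcal C_t(u_A)$ as $t\to-\infty$, for every $A\in S^{tnn}_{\mathcal M}$: the Hausdorff distance between $\{(\bar x,\bar y):(t\bar x,t\bar y)\in\mathcal C_t(u_A)\}$ and $\mathcal C_{-\infty}(\mathcal M)$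 tends to $0$. -/

import Mathlib

open Filter Topology Finset

noncomputable section

/-! ### Le-diagrams and their pipe dreams

Labels `1, …, n` are represented by `Fin n`, hence shifted down by one. A Le-diagram of type `(k, n)`
with `n = k + m` lives in a rectangle with `k` rows (numbered from the top) and `m = n - k` columns
(numbered from the left). -/

/-- A Le-diagram: a Young diagram (row `r` consists of the boxes `(r, c)` with `c < rowLen r`) and the
set of its boxes that are filled with a `+`; the other boxes of the Young diagram are filled with `0`. -/
structure LeDiagram (k m : ℕ) where
  rowLen : Fin k → ℕ
  antitone_rowLen : Antitone rowLen
  rowLen_le : ∀ r, rowLen r ≤ m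
  plus : Finset (Fin k × Fin m)
  plus_subset : ∀ b ∈ plus, b.2.1 < rowLen b.1
  /-- No `0` has both a `+` above it in its column and a `+` to its left in its row. -/
  le_property : ∀ (r : Fin k) (c : Fin m), c.1 < rowLen r → (r, c) ∉ plus →
    ¬ ((∃ r' < r, (r', c) ∈ plus) ∧ (∃ c' < c, (r, c') ∈ plus))

namespace LeDiagram

variable {k m : ℕ}

/-- Every row and every column contains a `+`. -/
def Irreducible (L : LeDiagram k m) : Prop :=
  (∀ r, ∃ c, (r, c) ∈ L.plus) ∧ (∀ c, ∃ r, (r, c) ∈ L.plus)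

/-- The label of the vertical step of the southeast border in row `r`, when the border is numbered
from its northeast end: it is preceded by `r` vertical and `m - rowLen r` horizontal steps. -/
def rowLabel (L : LeDiagram k m) (r : Fin k) : Fin (k + m) :=
  ⟨r.1 + (m - L.rowLen r), by have := r.2; omega⟩

/-- The label of the horizontal step of the southeast border in column `c`: it is preceded by one
vertical step for each box of the column and by `m - 1 - c` horizontal steps. -/
def colLabel (L : LeDiagram k m) (c : Fin m) : Fin (k + m) :=
  ⟨(univ.filter fun r : Fin k => c.1 < L.rowLen r).card + (m - 1 - c.1), by
    have h : (univ.filter fun r : Fin k => c.1 < L.rowLen r).card ≤ k := by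
      simpa using card_filter_le (univ : Finset (Fin k)) (fun r => c.1 < L.rowLen r)
    have := c.2
    omega⟩

/-- The labels of the two pipes that leave the box `(r, c)`, through its west side (first component)
and through its north side (second component). Pipes run from the southeast border to the northwest.
At a `0` they cross; at a `+` (an elbow) the pipe from the south turns west and the pipe from the east
turns north. -/
def pipeExit (L : LeDiagram k m) (r : Fin k) (c : Fin m) : Fin (k + m) × Fin (k + m) :=
  let fromEast : Fin (k + m) :=
    if h : c.1 + 1 < L.rowLen r then
      (pipeExit L r ⟨c.1 + 1, lt_of_lt_of_le h (L.rowLen_le r)⟩).1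
    else L.rowLabel r
  let fromSouth : Fin (k + m) :=
    if h : r.1 + 1 < k then
      if c.1 < L.rowLen ⟨r.1 + 1, h⟩ then (pipeExit L ⟨r.1 + 1, h⟩ c).2 else L.colLabel c
    else L.colLabel c
  if (r, c) ∈ L.plus then (fromSouth, fromEast) else (fromEast, fromSouth)
termination_by (k - r.1) + (m - c.1)
decreasing_by
  · have := L.rowLen_le r; omega
  · omega

/-- The label of the pipe that ends at the west side of row `r`. -/
def westLabel (L : LeDiagram k m) (r : Fin k) : Fin (k + m) :=
  if h : 0 < L.rowLen r then (L.pipeExit r ⟨0, lt_of_lt_of_le h (L.rowLen_le r)⟩).1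
  else L.rowLabel r

/-- The label of the pipe that ends at the north side of column `c`. -/
def northLabel (L : LeDiagram k m) (c : Fin m) : Fin (k + m) :=
  if h : 0 < k then
    if c.1 < L.rowLen ⟨0, h⟩ then (L.pipeExit ⟨0, h⟩ c).2 else L.colLabel c
  else L.colLabel c

open Classical in
/-- The permutation `π(L)`: a label of a vertical (horizontal) border step is sent to the label of the
pipe that ends on the opposite side of that row (column). Every label is of exactly one of these two
kinds, so the last `else` is never reached. -/
def perm (L : LeDiagram k m) (i : Fin (k + m)) : Fin (k + m) :=
  if h : ∃ r, L.rowLabel r = i then L.westLabel h.choose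
  else if h : ∃ c, L.colLabel c = i then L.northLabel h.choose
  else i

end LeDiagram

/-! ### Trivalent generalized plabic graphs -/

/-- Data of a graph with trivalent black and white internal vertices, drawn in a disk with boundary
vertices labelled by `Fin n`, in which edges may cross. The three half-edges at an internal vertex are
numbered by `Fin 3` in counterclockwise order. An edge `e` has two ends `(e, false)` and `(e, true)`;
`attach` says to which half-edge of which internal vertex, or to which boundary vertex, an end is
attached. An edge passes straight through its crossings with other edges, so crossings need not be
recorded. `top` marks the boundary vertices that are drawn in the upper part of the disk. -/
structure PlabicData (n : ℕ) where
  V : Type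
  E : Type
  black : V → Prop
  attach : E → Bool → (V × Fin 3) ⊕ Fin n
  top : Fin n → Prop

namespace PlabicData

variable {n : ℕ}

/-- The graph is finite, each half-edge of each internal vertex belongs to exactly one edge end, and
each boundary vertex is incident to exactly one edge end. -/
def IsGeneralizedPlabic (G : PlabicData n) : Prop :=
  Finite G.V ∧ Finite G.E ∧ Function.Bijective fun x : G.E × Bool => G.attach x.1 x.2

open Classical in
/-- `G.OnTrip i e b`: the trip that starts at the boundary vertex `i` traverses the edge `e` from its end
`b` to its end `!b`. Rules of the road: at a black vertex turn right (leave by the half-edge that is next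
counterclockwise to the one of arrival), at a white vertex turn left (next clockwise). -/
inductive OnTrip (G : PlabicData n) (i : Fin n) : G.E → Bool → Prop
  | start (e : G.E) (b : Bool) (h : G.attach e b = Sum.inr i) : OnTrip G i e b
  | turn (e e' : G.E) (b b' : Bool) (v : G.V) (p : Fin 3) (hprev : OnTrip G i e b)
      (h : G.attach e (!b) = Sum.inl (v, p))
      (h' : G.attach e' b' = Sum.inl (v, if G.black v then p + 1 else p - 1)) : OnTrip G i e' b'

/-- The trip from `i` ends at `j` if and only if `j = π i`, and `π` is a permutation. -/
def IsTripPermutation (G : PlabicData n) (π : Fin n → Fin n) : Prop :=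
  Function.Bijective π ∧
    ∀ i j, (∃ e b, G.OnTrip i e b ∧ G.attach e (!b) = Sum.inr j) ↔ π i = j

/-- Labelling by the rules of the road: the edge `e` gets the label `i` if the trip from `i` uses it. -/
def HasLabel (G : PlabicData n) (e : G.E) (i : Fin n) : Prop := ∃ b, G.OnTrip i e b

/-- The edge `e` is of type `[i, j]`: `i < j`, and `i` and `j` are exactly its labels. -/
def HasType (G : PlabicData n) (e : G.E) (i j : Fin n) : Prop :=
  i < j ∧ ∀ x, G.HasLabel e x ↔ x = i ∨ x = j

/-- The half-edge `p` of the vertex `v` belongs to an edge of type `[i, j]`. -/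
def HalfEdgeHasType (G : PlabicData n) (v : G.V) (p : Fin 3) (i j : Fin n) : Prop :=
  ∃ e b, G.attach e b = Sum.inl (v, p) ∧ G.HasType e i j

/-- The edges at `v` have types `[i, l]`, `[l, m]`, `[i, m]`, in counterclockwise order. -/
def VertexHasType (G : PlabicData n) (v : G.V) (i l m : Fin n) : Prop :=
  ∃ p : Fin 3, G.HalfEdgeHasType v p i l ∧ G.HalfEdgeHasType v (p + 1) l m ∧
    G.HalfEdgeHasType v (p + 2) i m

end PlabicData

/-! ### The graph `G₋(L)`

In the pipe dream of `L`, the elbow at a `+` consists of an arc from its north to its east side, which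
receives a white vertex, and an arc from its west to its south side, which receives a black vertex; the two
vertices are joined by a new diagonal edge. A strand that leaves an elbow runs straight until the next elbow
or the border. The strands that end at the southeast border are erased, and vertices of degree two are
forgotten. So the white vertex of a `+` survives if and only if there is another `+` to its right in its row,
and the black vertex survives if and only if there is another `+` below it in its column. The strand leaving a
`+` to the north arrives at the next `+` above it, at its (surviving) black vertex, or else at the north
border; the strand leaving to the west arrives at the next `+` on the left, at its (surviving) white
vertex, or else at the west border. -/

namespace LeDiagram

variable {k m : ℕ}

/-- There is a `+` to the right of the box `b` in its row. -/
def HasRight (L : LeDiagram k m) (b : Fin k × Fin m) : Prop := ∃ c, b.2 < c ∧ (b.1, c) ∈ L.plus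

/-- There is a `+` below the box `b` in its column. -/
def HasBelow (L : LeDiagram k m) (b : Fin k × Fin m) : Prop := ∃ r, b.1 < r ∧ (r, b.2) ∈ L.plus

/-- The white vertices of `G₋(L)`. -/
abbrev White (L : LeDiagram k m) : Type := {b : Fin k × Fin m // b ∈ L.plus ∧ L.HasRight b}

/-- The black vertices of `G₋(L)`. -/
abbrev Black (L : LeDiagram k m) : Type := {b : Fin k × Fin m // b ∈ L.plus ∧ L.HasBelow b}

/-- Places where an edge of `G₋(L)` can end. The half-edges of a white vertex are `0`: east, `1`: north,
`2`: diagonal (southwest). Those of a black vertex are `0`: diagonal (northeast), `1`: west, `2`: south. -/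
abbrev EndPlace (L : LeDiagram k m) : Type := ((L.White ⊕ L.Black) × Fin 3) ⊕ Fin (k + m)

/-- Rows of the `+` boxes above `b`, in the column of `b`. -/
def above (L : LeDiagram k m) (b : Fin k × Fin m) : Finset (Fin k) :=
  univ.filter fun r => r < b.1 ∧ (r, b.2) ∈ L.plus

/-- Columns of the `+` boxes to the left of `b`, in the row of `b`. -/
def before (L : LeDiagram k m) (b : Fin k × Fin m) : Finset (Fin m) :=
  univ.filter fun c => c < b.2 ∧ (b.1, c) ∈ L.plus

/-- The place where the strand that leaves the `+` box `b` to the north arrives. -/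
def northEnd (L : LeDiagram k m) (b : Fin k × Fin m) (hb : b ∈ L.plus) : L.EndPlace :=
  if h : (L.above b).Nonempty then
    Sum.inl (Sum.inr ⟨((L.above b).max' h, b.2), by
      have := (mem_filter.1 ((L.above b).max'_mem h)).2
      exact ⟨this.2, b.1, this.1, hb⟩⟩, 2)
  else Sum.inr (L.northLabel b.2)

/-- The place where the strand that leaves the `+` box `b` to the west arrives. -/
def westEnd (L : LeDiagram k m) (b : Fin k × Fin m) (hb : b ∈ L.plus) : L.EndPlace :=
  if h : (L.before b).Nonempty then
    Sum.inl (Sum.inl ⟨(b.1, (L.before b).max' h), by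
      have := (mem_filter.1 ((L.before b).max'_mem h)).2
      exact ⟨this.2, b.2, this.1, hb⟩⟩, 0)
  else Sum.inr (L.westLabel b.1)

open Classical in
/-- The place reached from the `+` box `b` by entering its black vertex along the diagonal: this vertex,
or the end of the strand to the west if the black vertex has been forgotten. -/
def diagonalEnd (L : LeDiagram k m) (b : Fin k × Fin m) (hb : b ∈ L.plus) : L.EndPlace :=
  if h : L.HasBelow b then Sum.inl (Sum.inr ⟨b, hb, h⟩, 0) else L.westEnd b hb

open Classical in
/-- The graph `G₋(L)`. Its edges are: for each `+` box the edge that contains the strand leaving it to the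
north; for each white vertex the edge that contains its diagonal half-edge; for each black vertex the edge
that contains its west half-edge. The boundary vertex at the west end of a row or the north end of a column
carries the label of the pipe that ends there; the west side of the diagram is drawn as the upper part. -/
def plabicMinus (L : LeDiagram k m) : PlabicData (k + m) where
  V := L.White ⊕ L.Black
  E := {b : Fin k × Fin m // b ∈ L.plus} ⊕ (L.White ⊕ L.Black)
  black v := v.isRight = true
  attach e side :=
    match e, side with
    | Sum.inl b, false => L.northEnd b.1 b.2
    | Sum.inl b, true =>
      if h : L.HasRight b.1 then Sum.inl (Sum.inl ⟨b.1, b.2, h⟩, 1) else L.diagonalEnd b.1 b.2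
    | Sum.inr (Sum.inl w), false => Sum.inl (Sum.inl w, 2)
    | Sum.inr (Sum.inl w), true => L.diagonalEnd w.1 w.2.1
    | Sum.inr (Sum.inr v), false => Sum.inl (Sum.inr v, 1)
    | Sum.inr (Sum.inr v), true => L.westEnd v.1 v.2.1
  top i := ∃ r, L.westLabel r = i

end LeDiagram

/-! ### Positroid cells -/

/-- The maximal minor of `A` in the column set `J`. -/
def pluckerCoord {k n : ℕ} (A : Matrix (Fin k) (Fin n) ℝ) (J : Finset (Fin n)) : ℝ :=
  if h : J.card = k then (A.submatrix id (J.orderEmbOfFin h)).det else 0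

/-- The matrices of full rank that represent the points of the positroid cell of `M`. -/
def positroidCell (k : ℕ) {n : ℕ} (M : Finset (Finset (Fin n))) : Set (Matrix (Fin k) (Fin n) ℝ) :=
  {A | A.rank = k ∧ (∀ J ∈ M, 0 < pluckerCoord A J) ∧ ∀ J ∉ M, pluckerCoord A J = 0}

/-- The position of `a` in the order `r < r + 1 < ⋯ < n < 1 < ⋯ < r - 1`. -/
def cyclicRank {n : ℕ} (r a : Fin n) : ℕ := (a.1 + (n - r.1)) % n

/-- `I` is the lexicographically minimal element of `M` with respect to the order that starts at `r`.
(For sets of equal size, the lexicographically smaller one is the one that contains the least element of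
their symmetric difference.) -/
def IsLexMin {n : ℕ} (M : Finset (Finset (Fin n))) (r : Fin n) (I : Finset (Fin n)) : Prop :=
  I ∈ M ∧ ∀ J ∈ M, J ≠ I →
    ∃ a ∈ I, a ∉ J ∧ ∀ b, cyclicRank r b < cyclicRank r a → (b ∈ I ↔ b ∈ J)

/-- `M` has an irreducible Grassmann necklace `I` and `π` is the permutation of this necklace:
`I_{i+1} = (I_i \ {i}) ∪ {j}` with `i ∈ I_i`, `j ≠ i`, and `π j = i`, indices being taken modulo `n`. -/
def IsNecklacePermutation {n : ℕ} (M : Finset (Finset (Fin n))) (π : Fin n → Fin n) : Prop :=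
  ∃ I : Fin n → Finset (Fin n), (∀ r, IsLexMin M r (I r)) ∧
    ∀ i, i ∈ I i ∧ ∃ j, j ≠ i ∧ I (finRotate n i) = insert j ((I i).erase i) ∧ π j = i

/-! ### Contour plots -/

/-- The standing assumption on the parameters: `κ₁ < ⋯ < κₙ`, and for `1 < p < n` the sums of `p` of the
parameters with distinct indices are all distinct. -/
def GenericParameters {n : ℕ} (κ : Fin n → ℝ) : Prop :=
  StrictMono κ ∧ ∀ I J : Finset (Fin n), 1 < I.card → I.card < n → I.card = J.card →
    ∑ i ∈ I, κ i = ∑ i ∈ J, κ i → I = J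

/-- The locus where a function on the plane is not linear, that is, not affine near the point. -/
def nonlinearLocus (f : ℝ × ℝ → ℝ) : Set (ℝ × ℝ) :=
  {p | ¬ ∃ a b c : ℝ, ∀ᶠ q in 𝓝 p, f q = a * q.1 + b * q.2 + c}

/-- The function `f_A(x, y, t)`, the maximum over `J ∈ M` of
`ln (Δ_J(A) K_J) + ∑_{i ∈ J} (κᵢ x + κᵢ² y + κᵢ³ t)`, where `K_J = ∏_{i < j in J} (κⱼ - κᵢ)`. -/
def tropicalTau {k n : ℕ} (κ : Fin n → ℝ) (M : Finset (Finset (Fin n)))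
    (A : Matrix (Fin k) (Fin n) ℝ) (t : ℝ) (p : ℝ × ℝ) : ℝ :=
  ⨆ J : {J : Finset (Fin n) // J ∈ M},
    (Real.log (pluckerCoord A J.1 * ∏ q ∈ (J.1 ×ˢ J.1).filter (fun q => q.1 < q.2), (κ q.2 - κ q.1))
      + ∑ i ∈ J.1, (κ i * p.1 + κ i ^ 2 * p.2 + κ i ^ 3 * t))

/-- The contour plot `C_t(u_A)` at time `t`, for `A` in the cell of `M`. -/
def contourPlot {k n : ℕ} (κ : Fin n → ℝ) (M : Finset (Finset (Fin n)))
    (A : Matrix (Fin k) (Fin n) ℝ) (t : ℝ) : Set (ℝ × ℝ) :=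
  nonlinearLocus (tropicalTau κ M A t)

/-- `φᵢ(x̄, ȳ) = κᵢ x̄ + κᵢ² ȳ + κᵢ³`. -/
def phase {n : ℕ} (κ : Fin n → ℝ) (i : Fin n) (p : ℝ × ℝ) : ℝ :=
  κ i * p.1 + κ i ^ 2 * p.2 + κ i ^ 3

/-- The contour plot `C_{-∞}(M)`: the locus where `min_{J ∈ M} ∑_{i ∈ J} φᵢ` is not linear. -/
def contourPlotMinusInfty {n : ℕ} (κ : Fin n → ℝ) (M : Finset (Finset (Fin n))) : Set (ℝ × ℝ) :=
  nonlinearLocus fun p => ⨅ J : {J : Finset (Fin n) // J ∈ M}, ∑ i ∈ J.1, phase κ i p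

/-- `J` is a minimizer of `∑_{i ∈ J} φᵢ(p)` over `M`. -/
def IsDominant {n : ℕ} (κ : Fin n → ℝ) (M : Finset (Finset (Fin n))) (p : ℝ × ℝ)
    (J : Finset (Fin n)) : Prop :=
  J ∈ M ∧ ∀ I ∈ M, ∑ i ∈ J, phase κ i p ≤ ∑ i ∈ I, phase κ i p

/-- At the point `p` there is a balance between exactly two dominant exponentials, and their index sets
are `{i, m₂, …, m_k}` and `{j, m₂, …, m_k}`. -/
def IsSolitonPoint {n : ℕ} (κ : Fin n → ℝ) (M : Finset (Finset (Fin n))) (i j : Fin n)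
    (p : ℝ × ℝ) : Prop :=
  ∃ S : Finset (Fin n), i ∉ S ∧ j ∉ S ∧
    ∀ J, IsDominant κ M p J ↔ J = insert i S ∨ J = insert j S

/-! ### Drawing a generalized plabic graph in the `x̄ȳ`-plane -/

/-- `(κᵢκₗ + κᵢκₘ + κₗκₘ, -(κᵢ + κₗ + κₘ))`. -/
def vertexPoint {n : ℕ} (κ : Fin n → ℝ) (i l m : Fin n) : ℝ × ℝ :=
  (κ i * κ l + κ i * κ m + κ l * κ m, -(κ i + κ l + κ m))

open Classical in
/-- The ray of slope `s` (parallel to the lines `x̄ + s ȳ = const`) from `p`, with `ȳ → -∞` if `d` holds and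
`ȳ → +∞` otherwise. -/
def slopeRay (p : ℝ × ℝ) (s : ℝ) (d : Prop) : Set (ℝ × ℝ) :=
  {q | ∃ a : ℝ, 0 ≤ a ∧ q = p + a • (if d then (s, -1) else (-s, 1) : ℝ × ℝ)}

namespace PlabicData

variable {n : ℕ}

/-- The edge `e`, placed in the plane when the vertices are placed by `pos` and `e` is of type `[i, j]`: the
segment between its vertices, or a ray of slope `κᵢ + κⱼ` if one end is on the boundary, or the whole line
`φᵢ = φⱼ` if both are. Since `x̄ = x / t` and `ȳ = y / t` with `t < 0`, the plane is rotated by 180 degrees: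
an edge to an upper boundary vertex goes to `ȳ → -∞`. -/
def placedEdge (G : PlabicData n) (κ : Fin n → ℝ) (pos : G.V → ℝ × ℝ) (e : G.E) : Set (ℝ × ℝ) :=
  {q | ∃ i j, G.HasType e i j ∧
    q ∈ match G.attach e false, G.attach e true with
      | Sum.inl v, Sum.inl w => segment ℝ (pos v.1) (pos w.1)
      | Sum.inl v, Sum.inr b => slopeRay (pos v.1) (κ i + κ j) (G.top b)
      | Sum.inr b, Sum.inl v => slopeRay (pos v.1) (κ i + κ j) (G.top b)
      | Sum.inr _, Sum.inr _ => {p | phase κ i p = phase κ j p}}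

end PlabicData

end

/-!
The contour plot at `t → -∞` is determined by linear dependencies of columns, and these are read off the
pipes of the Le-diagram.

*Dependencies.* Fix `A` in the cell. For a pivot `i`, let the row pipe at `x` be the largest `j < x` such
that column `i` depends on the columns in `[0, i) ∪ [j, x)` (`RowPipe`); for a nonpivot `z`, let the column
pipe at `i` be the largest `j ≤ z` such that column `z` depends on those in `[0, i) ∪ [j, z)` (`ColPipe`).
Total nonnegativity enters once, through the sign of an exchange of columns: it forbids crossing dependencies
(`spanned_of_spanned`). It follows that at the box of a pivot `i` and a nonpivot `z`, the two incoming pipes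
are the minimum and the maximum of the two outgoing ones (`rowPipe_min_and_colPipe_max`).

*Pipes.* In a Le-diagram, the pipe that enters a box from the east has a smaller label than the one that
enters it from the south (`hPipe_lt_vPipe`); this is the Le-property. So the pipes of the diagram obey the same
rule, and since the necklace condition says that both families agree along the north and west borders, they
agree everywhere (`Matches.rowPipe_and_colPipe`).

*The graph.* Each trip in `G₋(L)` follows a pipe backwards while it goes south or east, and a row or column
while it goes west or north. So all labels of edges are explicit (`onTrip_iff`), which gives the trip
permutation and the types of edges and vertices.

*The plane.* On the line `φᵢ = φⱼ`, write the point at which the cubic `s ↦ s³ + ȳ s² + x̄ s - φᵢ` has the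
roots `κᵢ`, `κⱼ`, `τ` as `linePoint κ i j τ`. Then `φₛ - φᵢ = (κₛ - κᵢ)(κₛ - κⱼ)(κₛ - τ)`, so the set of
`s` with `φₛ < φᵢ` is a union of an initial interval and one more interval (`sublevel_eq_initialUnion`). By the
greedy algorithm for the matroid of `A`, two minimizers at this point are exchanged by `i` and `j` if and only if
the columns `i` and `j` are parallel modulo such a set (`IsMinWeight.exists_parallel`,
`exists_isMinWeight_iff`), that is, if `j` is a row pipe of `i`, or `i` a column pipe of `j`, or `(i, j)` is a
box with an elbow and `τ` lies between the labels of its incoming pipes. These three cases are the strands to the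
west, the strands to the north and the diagonals of `G₋(L)` (`WestPiece`, `NorthPiece`, `DiagPiece`), and their
end points in `τ` are the third labels at the vertices. So the placed edges form the contour plot
(`iUnion_placedEdge`).

*The limit.* After rescaling, the contour plot at time `t` is the tropical curve of the same affine functions
with constant terms changed by `O(1 / t)`. As the `x`-slopes of these functions are distinct, a small horizontal
segment around a point of one curve meets the other one (`exists_mem_tropicalCurve_dist_le`).
-/

open Filter Topology Finset

noncomputable section

/-! ### Column spans and the bases of a cell -/

/-- The span of the columns of `A` with index in `S`. -/
def colSpan {k n : ℕ} (A : Matrix (Fin k) (Fin n) ℝ) (S : Set (Fin n)) :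
    Submodule ℝ (Fin k → ℝ) :=
  Submodule.span ℝ ((fun s => A.col s) '' S)

section ColSpan

variable {k n : ℕ} {A : Matrix (Fin k) (Fin n) ℝ} {M : Finset (Finset (Fin n))}

theorem colSpan_mono {S T : Set (Fin n)} (h : S ⊆ T) : colSpan A S ≤ colSpan A T :=
  Submodule.span_mono (Set.image_mono h)

theorem col_mem_colSpan {S : Set (Fin n)} {s : Fin n} (h : s ∈ S) : A.col s ∈ colSpan A S :=
  Submodule.subset_span ⟨s, h, rfl⟩

theorem colSpan_le {S : Set (Fin n)} {W : Submodule ℝ (Fin k → ℝ)} :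
    colSpan A S ≤ W ↔ ∀ s ∈ S, A.col s ∈ W := by
  simp [colSpan, Submodule.span_le, Set.subset_def]

theorem colSpan_insert_eq {S : Set (Fin n)} {s : Fin n} (h : A.col s ∈ colSpan A S) :
    colSpan A (insert s S) = colSpan A S := by
  rw [colSpan, Set.image_insert_eq]
  exact Submodule.span_insert_eq_span h

/-- The exchange property of spans. -/
theorem colSpan_exchange {S : Set (Fin n)} {s t : Fin n}
    (h : A.col s ∈ colSpan A (insert t S)) (hs : A.col s ∉ colSpan A S) :
    A.col t ∈ colSpan A (insert s S) := by
  rw [colSpan, Set.image_insert_eq] at h ⊢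
  exact mem_span_insert_exchange h hs

theorem pluckerCoord_ne_zero_iff {J : Finset (Fin n)} :
    pluckerCoord A J ≠ 0 ↔ J.card = k ∧ colSpan A (J : Set (Fin n)) = ⊤ := by
  unfold pluckerCoord
  split_ifs with h
  · have hr : Set.range (A.submatrix id (J.orderEmbOfFin h)).col
        = (fun s => A.col s) '' (J : Set (Fin n)) := by
      have : (A.submatrix id (J.orderEmbOfFin h)).col
          = (fun s => A.col s) ∘ (J.orderEmbOfFin h) := rfl
      rw [this, Set.range_comp, Finset.range_orderEmbOfFin]
    rw [← isUnit_iff_ne_zero, ← Matrix.isUnit_iff_isUnit_det,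
      ← Matrix.linearIndependent_cols_iff_isUnit]
    simp only [h, true_and]
    rw [colSpan, ← hr]
    constructor
    · intro hl
      exact hl.span_eq_top_of_card_eq_finrank' (by simp)
    · intro hl
      exact linearIndependent_of_top_le_span_of_card_eq_finrank hl.ge (by simp)
  · simp [h]

theorem mem_iff_of_mem_positroidCell (hA : A ∈ positroidCell k M) {J : Finset (Fin n)} :
    J ∈ M ↔ J.card = k ∧ colSpan A (J : Set (Fin n)) = ⊤ := by
  rw [← pluckerCoord_ne_zero_iff]
  by_cases hJ : J ∈ M
  · simp [hJ, (hA.2.1 J hJ).ne']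
  · simp [hJ, hA.2.2 J hJ]

theorem col_notMem_colSpan_erase (hA : A ∈ positroidCell k M) {J : Finset (Fin n)} (hJ : J ∈ M)
    {t : Fin n} (ht : t ∈ J) : A.col t ∉ colSpan A (J.erase t : Finset (Fin n)) := by
  intro h
  obtain ⟨hc, hs⟩ := (mem_iff_of_mem_positroidCell hA).1 hJ
  have h1 : colSpan A ((J.erase t : Finset (Fin n)) : Set (Fin n)) = ⊤ := by
    rw [← hs, ← colSpan_insert_eq h, ← Finset.coe_insert, Finset.insert_erase ht]
  classical
  have h2 := finrank_span_finset_le_card (R := ℝ) ((J.erase t).image fun s => A.col s)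
  rw [Finset.coe_image] at h2
  have h3 : Set.finrank ℝ ((fun s => A.col s) '' ((J.erase t : Finset (Fin n)) : Set (Fin n))) = k := by
    have : Submodule.span ℝ ((fun s => A.col s) '' ((J.erase t : Finset (Fin n)) : Set (Fin n))) = ⊤ := h1
    rw [Set.finrank, this]; simp
  rw [h3] at h2
  have h4 := Finset.card_image_le (s := J.erase t) (f := fun s => A.col s)
  have h5 := Finset.card_erase_of_mem ht
  have h6 : 0 < J.card := Finset.card_pos.2 ⟨t, ht⟩
  omega

theorem insert_erase_mem (hA : A ∈ positroidCell k M) {J : Finset (Fin n)} (hJ : J ∈ M)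
    {s t : Fin n} (ht : t ∈ J) (hs : s ∉ J)
    (h : A.col t ∈ colSpan A (insert s (J.erase t : Finset (Fin n)) : Set (Fin n))) :
    insert s (J.erase t) ∈ M := by
  obtain ⟨hc, hsp⟩ := (mem_iff_of_mem_positroidCell hA).1 hJ
  refine (mem_iff_of_mem_positroidCell hA).2 ⟨?_, ?_⟩
  · rw [Finset.card_insert_of_notMem (fun h => hs (Finset.mem_of_mem_erase h)),
      Finset.card_erase_add_one ht, hc]
  · rw [eq_top_iff, ← hsp, colSpan_le, Finset.coe_insert]
    intro x hx
    by_cases hxt : x = t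
    · rwa [hxt]
    · exact col_mem_colSpan (Set.mem_insert_of_mem _ (by simpa [hxt] using hx))

theorem insert_erase_mem' (hA : A ∈ positroidCell k M) {J : Finset (Fin n)} (hJ : J ∈ M)
    {s t : Fin n} (ht : t ∈ J) (h : A.col s ∉ colSpan A (J.erase t : Finset (Fin n))) (hst : s ≠ t) :
    insert s (J.erase t) ∈ M := by
  have hs : s ∉ J := fun hs => h (col_mem_colSpan (by simp [hs, hst]))
  refine insert_erase_mem hA hJ ht hs (colSpan_exchange ?_ h)
  rw [← Finset.coe_insert, Finset.insert_erase ht, ((mem_iff_of_mem_positroidCell hA).1 hJ).2]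
  trivial

/-- If `s` is not spanned by the part of a basis `J` that lies in `Q`, then `s` can replace an element of
`J` outside `Q`. -/
theorem exists_insert_erase_mem (hA : A ∈ positroidCell k M) {J : Finset (Fin n)} (hJ : J ∈ M)
    {Q : Set (Fin n)} {s : Fin n} (hs : s ∉ J) (h : A.col s ∉ colSpan A (↑J ∩ Q)) :
    ∃ t ∈ J, t ∉ Q ∧ insert s (J.erase t) ∈ M := by
  classical
  -- take a minimal `Y` with `J ∩ Q ⊆ Y ⊆ J` whose span contains `s`; it is not contained in `Q`
  have hex : (J.powerset.filter fun Y =>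
      (J.filter fun x => x ∈ Q) ⊆ Y ∧ A.col s ∈ colSpan A (Y : Set (Fin n))).Nonempty :=
    ⟨J, by simp [((mem_iff_of_mem_positroidCell hA).1 hJ).2, Finset.filter_subset]⟩
  obtain ⟨Y, hY⟩ := Finset.exists_minimal hex
  have hYm := hY.prop
  simp only [Finset.mem_filter, Finset.mem_powerset] at hYm
  obtain ⟨hYJ, hQY, hsY⟩ := hYm
  have : ∃ t ∈ Y, t ∉ Q := by
    by_contra! hcon
    have hsub : (Y : Set (Fin n)) ⊆ ↑J ∩ Q := fun x hx =>
      ⟨Finset.mem_coe.2 (hYJ (Finset.mem_coe.1 hx)), hcon x (Finset.mem_coe.1 hx)⟩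
    exact h (colSpan_mono hsub hsY)
  obtain ⟨t, htY, htQ⟩ := this
  refine ⟨t, hYJ htY, htQ, insert_erase_mem hA hJ (hYJ htY) hs ?_⟩
  have hmin : A.col s ∉ colSpan A ((Y.erase t : Finset (Fin n)) : Set (Fin n)) := by
    intro hcon
    have := hY.le_of_le (y := Y.erase t) (by
      simp only [Finset.mem_filter, Finset.mem_powerset]
      refine ⟨(Finset.erase_subset _ _).trans hYJ, fun x hx => ?_, hcon⟩
      have hx' := Finset.mem_filter.1 hx
      exact Finset.mem_erase.2 ⟨fun hh => htQ (hh ▸ hx'.2), hQY hx⟩) (Finset.erase_subset _ _)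
    exact absurd (this htY) (by simp)
  have h1 : A.col t ∈ colSpan A (insert s ((Y.erase t : Finset (Fin n)) : Set (Fin n))) := by
    refine colSpan_exchange ?_ hmin
    rwa [← Finset.coe_insert, Finset.insert_erase htY]
  refine colSpan_mono (Set.insert_subset_insert ?_) h1
  exact_mod_cast Finset.erase_subset_erase t hYJ

/-- The basis exchange property. -/
theorem exists_basis_exchange (hA : A ∈ positroidCell k M) {J J' : Finset (Fin n)} (hJ : J ∈ M)
    (hJ' : J' ∈ M) {i : Fin n} (hi : i ∈ J) (hi' : i ∉ J') :
    ∃ j ∈ J', j ∉ J ∧ insert j (J.erase i) ∈ M := by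
  have : ∃ j ∈ J', A.col j ∉ colSpan A (J.erase i : Finset (Fin n)) := by
    by_contra! hcon
    apply col_notMem_colSpan_erase hA hJ hi
    have h1 := colSpan_le.2 hcon
    rw [((mem_iff_of_mem_positroidCell hA).1 hJ').2] at h1
    exact h1 trivial
  obtain ⟨j, hj, hjs⟩ := this
  have hji : j ≠ i := fun h => hi' (h ▸ hj)
  refine ⟨j, hj, fun hjJ => hjs (col_mem_colSpan (by simp [hji, hjJ])), insert_erase_mem' hA hJ hi hjs hji⟩

/-! ### Bases of minimal weight -/

/-- `J` has minimal total weight among the members of `M`. For the weight `s ↦ φ_s(p)` this is `IsDominant`. -/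
def IsMinWeight (M : Finset (Finset (Fin n))) (w : Fin n → ℝ) (J : Finset (Fin n)) : Prop :=
  J ∈ M ∧ ∀ I ∈ M, ∑ i ∈ J, w i ≤ ∑ i ∈ I, w i

theorem exists_isMinWeight (hM : M.Nonempty) (w : Fin n → ℝ) : ∃ J, IsMinWeight M w J := by
  obtain ⟨J, hJ, h⟩ := Finset.exists_min_image M (fun J => ∑ i ∈ J, w i) hM
  exact ⟨J, hJ, h⟩

theorem sum_insert_erase {w : Fin n → ℝ} {J : Finset (Fin n)} {s t : Fin n} (ht : t ∈ J) (hs : s ∉ J) :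
    ∑ i ∈ insert s (J.erase t), w i = ∑ i ∈ J, w i - w t + w s := by
  rw [Finset.sum_insert (fun h => hs (Finset.mem_of_mem_erase h)), ← Finset.add_sum_erase J w ht]
  ring

variable {w : Fin n → ℝ}

/-- The greedy property: if `Q` consists of elements that are lighter than all others, a basis of minimal
weight contains a basis of `Q`. -/
theorem IsMinWeight.colSpan_inter (hA : A ∈ positroidCell k M) {J : Finset (Fin n)}
    (hJ : IsMinWeight M w J) {Q : Set (Fin n)} (hQ : ∀ s ∈ Q, ∀ t ∉ Q, w s < w t) :
    colSpan A (↑J ∩ Q) = colSpan A Q := by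
  refine le_antisymm (colSpan_mono Set.inter_subset_right) (colSpan_le.2 fun s hs => ?_)
  by_contra hcon
  have hsJ : s ∉ J := fun h => hcon (col_mem_colSpan ⟨h, hs⟩)
  obtain ⟨t, htJ, htQ, hM'⟩ := exists_insert_erase_mem hA hJ.1 hsJ hcon
  have := hJ.2 _ hM'
  rw [sum_insert_erase htJ hsJ] at this
  linarith [hQ s hs t htQ]

/-- Two distinct bases of minimal weight give rise to two that differ by one exchange. -/
theorem IsMinWeight.exists_swap (hA : A ∈ positroidCell k M) {J J' : Finset (Fin n)}
    (hJ : IsMinWeight M w J) (hJ' : IsMinWeight M w J') (hne : J ≠ J') :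
    ∃ i j, w i = w j ∧
      ((i ∈ J ∧ i ∉ J' ∧ j ∈ J' ∧ j ∉ J ∧ IsMinWeight M w (insert j (J.erase i))) ∨
        (i ∈ J' ∧ i ∉ J ∧ j ∈ J ∧ j ∉ J' ∧ IsMinWeight M w (insert j (J'.erase i)))) := by
  classical
  have hD : (symmDiff J J').Nonempty := by
    rw [Finset.nonempty_iff_ne_empty]
    exact fun h => hne (symmDiff_eq_bot.1 h)
  -- an element of maximal weight in the symmetric difference can only be exchanged for one of equal weight
  obtain ⟨i, hi, hmax⟩ := Finset.exists_max_image _ w hD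
  have key : ∀ J J' : Finset (Fin n), IsMinWeight M w J → IsMinWeight M w J' → i ∈ J → i ∉ J' →
      (∀ x ∈ J', x ∉ J → w x ≤ w i) →
      ∃ j, w i = w j ∧ j ∈ J' ∧ j ∉ J ∧ IsMinWeight M w (insert j (J.erase i)) := by
    intro J J' hJ hJ' hi hi' hm
    obtain ⟨j, hj, hjJ, hM'⟩ := exists_basis_exchange hA hJ.1 hJ'.1 hi hi'
    have h1 := hJ.2 _ hM'
    have h2 := hm j hj hjJ
    rw [sum_insert_erase hi hjJ] at h1
    have h3 : w i = w j := by linarith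
    refine ⟨j, h3, hj, hjJ, hM', fun I hI => ?_⟩
    rw [sum_insert_erase hi hjJ]
    linarith [hJ.2 I hI]
  rcases Finset.mem_symmDiff.1 hi with ⟨h1, h2⟩ | ⟨h1, h2⟩
  · obtain ⟨j, hj⟩ := key J J' hJ hJ' h1 h2 fun x hx hx' =>
      hmax x (Finset.mem_symmDiff.2 (Or.inr ⟨hx, hx'⟩))
    exact ⟨i, j, hj.1, Or.inl ⟨h1, h2, hj.2⟩⟩
  · obtain ⟨j, hj⟩ := key J' J hJ' hJ h1 h2 fun x hx hx' =>
      hmax x (Finset.mem_symmDiff.2 (Or.inl ⟨hx, hx'⟩))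
    exact ⟨i, j, hj.1, Or.inr ⟨h1, h2, hj.2⟩⟩

/-- Two bases of minimal weight that differ by the exchange of `i` and `j` exhibit `i` and `j` as parallel
elements modulo a set `S` that lies between the strict and the weak sublevel set of their weight. -/
theorem IsMinWeight.exists_parallel (hA : A ∈ positroidCell k M) {J : Finset (Fin n)} {i j : Fin n}
    (hJ : IsMinWeight M w J) (hi : i ∈ J) (hj : j ∉ J) (hw : w i = w j)
    (hJ' : insert j (J.erase i) ∈ M) :
    ∃ S : Set (Fin n), (∀ s, w s < w i → s ∈ S) ∧ (∀ s ∈ S, w s ≤ w i) ∧ i ∉ S ∧ j ∉ S ∧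
      A.col i ∈ colSpan A (insert j S) ∧ A.col i ∉ colSpan A S ∧ A.col j ∉ colSpan A S := by
  have hij : i ≠ j := fun h => hj (h ▸ hi)
  have hlt := hJ.colSpan_inter hA (Q := {s | w s < w i}) (fun s hs t ht => by
    simp only [Set.mem_ofPred_eq, not_lt] at hs ht; linarith)
  have hle := hJ.colSpan_inter hA (Q := {s | w s ≤ w i}) (fun s hs t ht => by
    simp only [Set.mem_ofPred_eq, not_le] at hs ht; linarith)
  -- the members of `J \ {i}` of weight at most `w i` span all elements lighter than `i`
  set T : Set (Fin n) := (↑(J.erase i) : Set (Fin n)) ∩ {s | w s ≤ w i} with hT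
  set S : Set (Fin n) := {s | w s < w i} ∪ T with hS
  have hST : colSpan A S = colSpan A T := by
    refine le_antisymm (colSpan_le.2 fun s hs => ?_) (colSpan_mono Set.subset_union_right)
    rcases hs with hs | hs
    · have h1 : A.col s ∈ colSpan A (↑J ∩ {s | w s < w i}) := by
        rw [hlt]; exact col_mem_colSpan hs
      refine colSpan_mono (fun x hx => ?_) h1
      refine ⟨?_, (Set.mem_ofPred.1 hx.2).le⟩
      have : x ≠ i := fun h => by
        have := hx.2
        simp [h] at this
      simpa [this] using hx.1
    · exact col_mem_colSpan hs
  have hiS : A.col i ∉ colSpan A S := by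
    rw [hST]
    exact fun h => col_notMem_colSpan_erase hA hJ.1 hi (colSpan_mono Set.inter_subset_left h)
  have hjS : A.col j ∉ colSpan A S := by
    rw [hST]
    intro h
    have hjm := col_notMem_colSpan_erase hA hJ' (Finset.mem_insert_self j _)
    rw [Finset.erase_insert (fun h => hj (Finset.mem_of_mem_erase h))] at hjm
    exact hjm (colSpan_mono Set.inter_subset_left h)
  have hji : A.col j ∈ colSpan A (insert i S) := by
    have h1 : A.col j ∈ colSpan A (↑J ∩ {s | w s ≤ w i}) := by
      rw [hle]; exact col_mem_colSpan (by simp [hw])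
    refine colSpan_mono (fun x hx => ?_) h1
    by_cases hx' : x = i
    · exact Or.inl hx'
    · exact Or.inr (Or.inr ⟨by simpa [hx'] using hx.1, hx.2⟩)
  refine ⟨S, fun s hs => Or.inl hs, ?_, fun h => hiS (col_mem_colSpan h),
    fun h => hjS (col_mem_colSpan h), colSpan_exchange hji hjS, hiS, hjS⟩
  rintro s (hs | hs)
  · exact le_of_lt hs
  · exact hs.2

/-- If `i` and `j` are the only elements of equal weight and they are parallel nonloops modulo the lighter
elements, then there are exactly two bases of minimal weight, which differ by the exchange of `i` and `j`. -/
theorem exists_isMinWeight_iff (hA : A ∈ positroidCell k M) (hM : M.Nonempty) {i j : Fin n}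
    (hij : i ≠ j) (hw : w i = w j)
    (huniq : ∀ s t, s ≠ t → w s = w t → (s = i ∧ t = j) ∨ (s = j ∧ t = i))
    (h1 : A.col i ∈ colSpan A (insert j {s | w s < w i}))
    (h2 : A.col i ∉ colSpan A {s | w s < w i}) :
    ∃ S : Finset (Fin n), i ∉ S ∧ j ∉ S ∧
      ∀ J, IsMinWeight M w J ↔ J = insert i S ∨ J = insert j S := by
  classical
  -- the hypotheses are symmetric in `i` and `j`
  have h3 : A.col j ∉ colSpan A {s | w s < w i} := fun h => h2 (by rwa [colSpan_insert_eq h] at h1)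
  have h4 := colSpan_exchange h1 h2
  -- by the greedy property, a minimal basis contains exactly one of `i` and `j`
  have one : ∀ J, IsMinWeight M w J → (i ∈ J ∧ j ∉ J) ∨ (j ∈ J ∧ i ∉ J) := by
    intro J hJ
    have hlt := hJ.colSpan_inter hA (Q := {s | w s < w i}) (fun s hs t ht => by
      simp only [Set.mem_ofPred_eq, not_lt] at hs ht; linarith)
    have hle := hJ.colSpan_inter hA (Q := {s | w s ≤ w i}) (fun s hs t ht => by
      simp only [Set.mem_ofPred_eq, not_le] at hs ht; linarith)
    by_cases hi : i ∈ J <;> by_cases hj : j ∈ J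
    · exfalso
      apply col_notMem_colSpan_erase hA hJ.1 hi
      have : colSpan A (insert j {s | w s < w i}) ≤ colSpan A (J.erase i : Finset (Fin n)) := by
        refine colSpan_le.2 fun s hs => ?_
        rcases hs with rfl | hs
        · exact col_mem_colSpan (by simp [hj, hij.symm])
        · have h5 : A.col s ∈ colSpan A (↑J ∩ {s | w s < w i}) := by
            rw [hlt]; exact col_mem_colSpan hs
          refine colSpan_mono (fun x hx => ?_) h5
          have : x ≠ i := fun h => by
            have := hx.2
            simp [h] at this
          simpa [this] using hx.1
      exact this h1
    · exact Or.inl ⟨hi, hj⟩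
    · exact Or.inr ⟨hj, hi⟩
    · exfalso
      apply h2
      have h5 : A.col i ∈ colSpan A (↑J ∩ {s | w s ≤ w i}) := by
        rw [hle]; exact col_mem_colSpan (by simp)
      refine colSpan_mono (fun x hx => ?_) h5
      refine lt_of_le_of_ne (Set.mem_ofPred.1 hx.2) fun hxe => ?_
      rcases huniq x i (fun h => hi (h ▸ hx.1)) hxe with ⟨h, -⟩ | ⟨h, -⟩
      · exact hi (h ▸ hx.1)
      · exact hj (h ▸ hx.1)
  -- and one of them can be exchanged for the other
  have swap : ∀ (i j : Fin n), w i = w j → A.col i ∈ colSpan A (insert j {s | w s < w i}) →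
      ∀ J, IsMinWeight M w J → i ∈ J → j ∉ J → IsMinWeight M w (insert j (J.erase i)) := by
    intro i j hw h1 J hJ hi hj
    have hlt := hJ.colSpan_inter hA (Q := {s | w s < w i}) (fun s hs t ht => by
      simp only [Set.mem_ofPred_eq, not_lt] at hs ht; linarith)
    have hmem : insert j (J.erase i) ∈ M := by
      refine insert_erase_mem hA hJ.1 hi hj ?_
      have : colSpan A (insert j {s | w s < w i}) ≤
          colSpan A (insert j ((J.erase i : Finset (Fin n)) : Set (Fin n))) := by
        refine colSpan_le.2 fun s hs => ?_
        rcases hs with rfl | hs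
        · exact col_mem_colSpan (by simp)
        · have h5 : A.col s ∈ colSpan A (↑J ∩ {s | w s < w i}) := by
            rw [hlt]; exact col_mem_colSpan hs
          refine colSpan_mono (fun x hx => Set.mem_insert_of_mem _ ?_) h5
          have : x ≠ i := fun h => by
            have := hx.2
            simp [h] at this
          simpa [this] using hx.1
      exact this h1
    refine ⟨hmem, fun I hI => ?_⟩
    rw [sum_insert_erase hi hj, hw]
    linarith [hJ.2 I hI]
  -- two minimal bases differ by a chain of exchanges of elements of equal weight
  have uniq : ∀ J J', IsMinWeight M w J → IsMinWeight M w J' → i ∈ J → i ∈ J' → J = J' := by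
    intro J J' hJ hJ' hi hi'
    by_contra hne
    obtain ⟨s, t, hst, h⟩ := hJ.exists_swap hA hJ' hne
    have hne' : s ≠ t := by
      rintro rfl
      rcases h with h | h
      · exact h.2.1 h.2.2.1
      · exact h.2.1 h.2.2.1
    rcases huniq s t hne' hst with ⟨rfl, rfl⟩ | ⟨rfl, rfl⟩ <;> rcases h with h | h
    · exact h.2.1 hi'
    · exact h.2.1 hi
    · exact h.2.2.2.1 hi
    · exact h.2.2.2.1 hi'
  obtain ⟨J₀, hJ₀, hi₀⟩ : ∃ J, IsMinWeight M w J ∧ i ∈ J := by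
    obtain ⟨J, hJ⟩ := exists_isMinWeight hM w
    rcases one J hJ with h | h
    · exact ⟨J, hJ, h.1⟩
    · refine ⟨_, swap j i hw.symm (by rw [← hw]; exact h4) J hJ h.1 h.2, by simp⟩
  have hj₀ : j ∉ J₀ := by
    rcases one J₀ hJ₀ with h | h
    · exact h.2
    · exact absurd hi₀ h.2
  refine ⟨J₀.erase i, by simp, by simp [hj₀], fun J => ?_⟩
  rw [Finset.insert_erase hi₀]
  constructor
  · intro hJ
    rcases one J hJ with h | h
    · exact Or.inl (uniq J J₀ hJ hJ₀ h.1 hi₀)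
    · right
      have h5 := uniq _ J₀ (swap j i hw.symm (by rw [← hw]; exact h4) J hJ h.1 h.2) hJ₀ (by simp) hi₀
      rw [← h5, Finset.erase_insert (by simp [h.2]), Finset.insert_erase h.1]
  · rintro (rfl | rfl)
    · exact hJ₀
    · exact swap i j hw h1 J₀ hJ₀ hi₀ hj₀

end ColSpan

/-! ### The sign of an exchange in a totally nonnegative matrix -/

/-- The determinant of the matrix whose first column is the argument and whose other columns are the columns
of `A` with index in `U`, as a linear functional of its first column. -/
def minorFunctional {k n : ℕ} (A : Matrix (Fin (k + 1)) (Fin n) ℝ) (U : Finset (Fin n))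
    (hU : U.card = k) : (Fin (k + 1) → ℝ) →ₗ[ℝ] ℝ :=
  ∑ i : Fin (k + 1), ((-1) ^ (i : ℕ) * (A.submatrix i.succAbove (U.orderEmbOfFin hU)).det) •
    LinearMap.proj i

section Sign

variable {k n : ℕ} {A : Matrix (Fin (k + 1)) (Fin n) ℝ} {U : Finset (Fin n)}

theorem minorFunctional_apply (hU : U.card = k) (x : Fin (k + 1) → ℝ) :
    minorFunctional A U hU x =
      (Matrix.of fun i (t : Fin (k + 1)) =>
        (Fin.cons (x i) (fun t => A i (U.orderEmbOfFin hU t)) : Fin (k + 1) → ℝ) t).det := by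
  rw [Matrix.det_succ_column_zero]
  simp only [minorFunctional, LinearMap.sum_apply, LinearMap.smul_apply, LinearMap.proj_apply,
    smul_eq_mul]
  refine Finset.sum_congr rfl fun i _ => ?_
  have : (Matrix.of fun i (t : Fin (k + 1)) =>
        (Fin.cons (x i) (fun t => A i (U.orderEmbOfFin hU t)) : Fin (k + 1) → ℝ) t).submatrix
        i.succAbove Fin.succ = A.submatrix i.succAbove (U.orderEmbOfFin hU) := by
    ext a b; simp
  rw [this]
  simp
  ring

theorem minorFunctional_eq_zero (hU : U.card = k) {x : Fin (k + 1) → ℝ}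
    (hx : x ∈ colSpan A (U : Set (Fin n))) : minorFunctional A U hU x = 0 := by
  have : colSpan A (U : Set (Fin n)) ≤ LinearMap.ker (minorFunctional A U hU) := by
    refine colSpan_le.2 fun s hs => ?_
    rw [LinearMap.mem_ker, minorFunctional_apply]
    obtain ⟨t, ht⟩ : ∃ t, U.orderEmbOfFin hU t = s := by
      have : s ∈ Set.range (U.orderEmbOfFin hU) := by
        rw [Finset.range_orderEmbOfFin]; exact hs
      exact this
    refine Matrix.det_zero_of_column_eq (i := 0) (j := t.succ) (Fin.succ_ne_zero t).symm ?_
    intro i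
    simp [ht]
  exact this hx

/-- Expansion of a maximal minor along the column `a`. -/
theorem pluckerCoord_insert (hU : U.card = k) {a : Fin n} (ha : a ∉ U) :
    pluckerCoord A (insert a U) =
      (-1) ^ (U.filter (· < a)).card * minorFunctional A U hU (A.col a) := by
  have hc : (insert a U).card = k + 1 := by rw [Finset.card_insert_of_notMem ha, hU]
  obtain ⟨p, hp⟩ : ∃ p, (insert a U).orderEmbOfFin hc p = a := by
    have : a ∈ Set.range ((insert a U).orderEmbOfFin hc) := by
      rw [Finset.range_orderEmbOfFin]; simp
    exact this
  have hU' : ∀ t, (insert a U).orderEmbOfFin hc (p.succAbove t) = U.orderEmbOfFin hU t := by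
    have h1 : (fun t => (insert a U).orderEmbOfFin hc (p.succAbove t)) = U.orderEmbOfFin hU := by
      refine Finset.orderEmbOfFin_unique hU (fun t => ?_) ?_
      · have h1 := Finset.orderEmbOfFin_mem (insert a U) hc (p.succAbove t)
        refine (Finset.mem_insert.1 h1).resolve_left fun h => ?_
        exact Fin.succAbove_ne p t (((insert a U).orderEmbOfFin hc).injective (h.trans hp.symm))
      · exact ((insert a U).orderEmbOfFin hc).strictMono.comp (Fin.strictMono_succAbove p)
    exact fun t => congrFun h1 t
  have hpv : (U.filter (· < a)).card = (p : ℕ) := by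
    have h1 : U.filter (· < a) = (Finset.univ.filter (· < p)).map
        ((insert a U).orderEmbOfFin hc).toEmbedding := by
      ext x
      simp only [Finset.mem_filter, Finset.mem_map, Finset.mem_univ, true_and,
        RelEmbedding.coe_toEmbedding]
      constructor
      · rintro ⟨h1, h2⟩
        obtain ⟨q, hq⟩ : ∃ q, (insert a U).orderEmbOfFin hc q = x := by
          have : x ∈ Set.range ((insert a U).orderEmbOfFin hc) := by
            rw [Finset.range_orderEmbOfFin]; simp [h1]
          exact this
        refine ⟨q, ?_, hq⟩
        exact ((insert a U).orderEmbOfFin hc).lt_iff_lt.1 (by rw [hq, hp]; exact h2)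
      · rintro ⟨q, h1, rfl⟩
        have h2 : (insert a U).orderEmbOfFin hc q < a := by
          conv_rhs => rw [← hp]
          simpa using h1
        exact ⟨(Finset.mem_insert.1 (Finset.orderEmbOfFin_mem _ hc q)).resolve_left h2.ne, h2⟩
    have h2 : (Finset.univ.filter (· < p)) = Finset.Iio p := by ext q; simp
    rw [h1, Finset.card_map, h2, Fin.card_Iio]
  rw [pluckerCoord, dif_pos hc, Matrix.det_succ_column _ p, hpv]
  simp only [minorFunctional, LinearMap.sum_apply, LinearMap.smul_apply, LinearMap.proj_apply,
    smul_eq_mul]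
  rw [Finset.mul_sum]
  refine Finset.sum_congr rfl fun i _ => ?_
  have : (A.submatrix id ((insert a U).orderEmbOfFin hc)).submatrix i.succAbove p.succAbove
      = A.submatrix i.succAbove (U.orderEmbOfFin hU) := by
    ext x y; simp [hU']
  rw [this]
  simp only [Matrix.submatrix_apply, id, hp, Matrix.col_apply, pow_add]
  ring

end Sign

section Positroid

variable {k n : ℕ} {A : Matrix (Fin k) (Fin n) ℝ} {M : Finset (Finset (Fin n))}

/-- If `vᵢ ∈ μ v_b + span S`, the signs of `Δ_{S g i} Δ_{S g b}` and `Δ_{S z i} Δ_{S z b}` are opposite when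
exactly one of `g` and `z` lies between `i` and `b`. So these minors cannot all be positive. -/
theorem not_crossing_exchange (hA : A ∈ positroidCell k M) {S : Finset (Fin n)} {i g b z : Fin n}
    (hig : i < g) (hgb : g < b) (hbz : b < z) (hi : i ∉ S) (hg : g ∉ S) (hb : b ∉ S) (hz : z ∉ S)
    (hsp : A.col i ∈ colSpan A (insert b (S : Set (Fin n))))
    (h1 : insert i (insert g S) ∈ M) (h2 : insert b (insert g S) ∈ M)
    (h3 : insert i (insert z S) ∈ M) (h4 : insert b (insert z S) ∈ M) : False := by
  have hcard := ((mem_iff_of_mem_positroidCell hA).1 h1).1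
  rw [Finset.card_insert_of_notMem (by simp [hi, hig.ne]), Finset.card_insert_of_notMem hg] at hcard
  obtain ⟨k', rfl⟩ : ∃ k', k = k' + 1 := ⟨_, hcard.symm⟩
  rw [colSpan, Set.image_insert_eq, Submodule.mem_span_insert] at hsp
  obtain ⟨μ, y, hy, hiy⟩ := hsp
  -- the sign of `μ` is determined by the parity of the number of elements between `i` and `b`
  have key : ∀ x, x ∉ S → x ≠ i → x ≠ b → insert i (insert x S) ∈ M → insert b (insert x S) ∈ M →
      0 < (-1 : ℝ) ^ ((insert x S).filter (· < i)).card *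
        (-1) ^ ((insert x S).filter (· < b)).card * μ := by
    intro x hx hxi hxb hm1 hm2
    have hU : (insert x S).card = k' := by
      rw [Finset.card_insert_of_notMem hx]; omega
    have p1 := hA.2.1 _ hm1
    have p2 := hA.2.1 _ hm2
    rw [pluckerCoord_insert hU (by simp [hi, hxi.symm])] at p1
    rw [pluckerCoord_insert hU (by simp [hb, hxb.symm])] at p2
    have h5 : minorFunctional A (insert x S) hU (A.col i)
        = μ * minorFunctional A (insert x S) hU (A.col b) := by
      rw [hiy, map_add, map_smul, minorFunctional_eq_zero hU (x := y), smul_eq_mul, add_zero]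
      refine colSpan_mono ?_ hy
      simp
    rw [h5] at p1
    have h6 := mul_pos p1 p2
    have h7 : 0 < minorFunctional A (insert x S) hU (A.col b) ^ 2 := by
      refine lt_of_le_of_ne (sq_nonneg _) fun h => ?_
      rw [eq_comm, pow_eq_zero_iff two_ne_zero] at h
      simp [h] at p2
    refine pos_of_mul_pos_left (b := minorFunctional A (insert x S) hU (A.col b) ^ 2) ?_ h7.le
    linarith
  have k1 := key g hg hig.ne' hgb.ne h1 h2
  have k2 := key z hz (hig.trans (hgb.trans hbz)).ne' hbz.ne' h3 h4
  rw [Finset.filter_insert, if_neg hig.not_gt, Finset.filter_insert, if_pos hgb,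
    Finset.card_insert_of_notMem (by simp [hg]), pow_succ] at k1
  rw [Finset.filter_insert, if_neg (hig.trans (hgb.trans hbz)).not_gt, Finset.filter_insert,
    if_neg hbz.not_gt] at k2
  linarith

/-- The union of the intervals `[0, a)` and `[b, c)`. -/
def initialUnion (n a b c : ℕ) : Set (Fin n) := {s | s.1 < a ∨ (b ≤ s.1 ∧ s.1 < c)}

theorem mem_initialUnion {a b c : ℕ} {s : Fin n} :
    s ∈ initialUnion n a b c ↔ s.1 < a ∨ (b ≤ s.1 ∧ s.1 < c) := Iff.rfl

/-- The element `y` is spanned by `[0, a) ∪ [b, c)`. -/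
def Spanned (A : Matrix (Fin k) (Fin n) ℝ) (y : Fin n) (a b c : ℕ) : Prop :=
  A.col y ∈ colSpan A (initialUnion n a b c)

theorem Spanned.mono {y : Fin n} {a b c a' b' c' : ℕ} (h : Spanned A y a b c)
    (hs : ∀ s : Fin n, s.1 < a ∨ (b ≤ s.1 ∧ s.1 < c) → s.1 < a' ∨ (b' ≤ s.1 ∧ s.1 < c')) :
    Spanned A y a' b' c' :=
  colSpan_mono (fun s hs' => hs s hs') h

theorem insert_initialUnion_left {i : Fin n} {b c : ℕ} :
    insert i (initialUnion n i b c) = initialUnion n (i + 1) b c := by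
  ext s
  simp only [Set.mem_insert_iff, mem_initialUnion, Fin.ext_iff]
  omega

theorem insert_initialUnion_right {i : Fin n} {a b : ℕ} (h : b ≤ i) :
    insert i (initialUnion n a b i) = initialUnion n a b (i + 1) := by
  ext s
  simp only [Set.mem_insert_iff, mem_initialUnion, Fin.ext_iff]
  omega

theorem insert_initialUnion_mid {i : Fin n} {a c : ℕ} (h : (i : ℕ) < c) :
    insert i (initialUnion n a (i + 1) c) = initialUnion n a i c := by
  ext s
  simp only [Set.mem_insert_iff, mem_initialUnion, Fin.ext_iff]
  omega

/-- A decreasing property of naturals that holds at `a` and fails at `b` has a last place. -/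
theorem exists_last {p : ℕ → Prop} {a b : ℕ} (ha : p a) (hb : ¬ p b) (hab : a ≤ b) :
    ∃ t, a ≤ t ∧ t < b ∧ p t ∧ ¬ p (t + 1) := by
  by_contra! hcon
  apply hb
  have : ∀ t, a ≤ t → t ≤ b → p t := by
    intro t ht
    induction t, ht using Nat.le_induction with
    | base => exact fun _ => ha
    | succ t ht ih => exact fun h => hcon t ht (by omega) (ih (by omega))
  exact this b hab le_rfl

/-- Total nonnegativity forbids crossing dependencies: if `i` depends on `[t, z)` modulo the elements below
`i`, then so does `z`. -/
theorem spanned_of_spanned (hA : A ∈ positroidCell k M) (hM : M.Nonempty) {i z : Fin n} {t : ℕ}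
    (hit : (i : ℕ) < t) (htz : t ≤ z) (hi : ¬ Spanned A i i i i) (hz : Spanned A z z z z)
    (h : Spanned A i i t z) : Spanned A z i t z := by
  classical
  by_contra hcon
  -- `i` is parallel to `b` modulo `X`, and `z` is parallel to `g` modulo `Y`, for some `i < g < b < z`
  obtain ⟨b, htb, hbz, hb1, hb2⟩ := exists_last (p := fun b => Spanned A i i b z) h
    (b := (z : ℕ)) (fun h => hi (h.mono (by omega))) htz
  obtain ⟨g, hig, hgt, hg1, hg2⟩ := exists_last (p := fun b => Spanned A z i b z) (a := i)
    (hz.mono (by omega)) hcon hit.le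
  -- `g ≠ i`: as `i` depends on `[0, i) ∪ [i + 1, z)`, adding it to this set does not change the span
  have hig : (i : ℕ) < g := by
    refine lt_of_le_of_ne hig fun hgi => hg2 ?_
    have h1 : Spanned A i i (g + 1) z := hb1.mono (by omega)
    have h2 : colSpan A (initialUnion n i i z) = colSpan A (initialUnion n i (g + 1) z) := by
      rw [← colSpan_insert_eq h1]
      congr 1
      ext s
      simp only [Set.mem_insert_iff, mem_initialUnion, Fin.ext_iff]
      omega
    rw [Spanned, ← h2]
    exact hz.mono (by omega)
  have hzn := z.2
  obtain ⟨b, rfl⟩ : ∃ b' : Fin n, (b' : ℕ) = b := ⟨⟨b, by omega⟩, rfl⟩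
  obtain ⟨g, rfl⟩ : ∃ g' : Fin n, (g' : ℕ) = g := ⟨⟨g, by omega⟩, rfl⟩
  set X := initialUnion n i (b + 1) z with hX
  set Y := initialUnion n i (g + 1) z with hY
  have hXi : A.col i ∈ colSpan A (insert b X) := by
    rw [hX, insert_initialUnion_mid hbz]; exact hb1
  have hXb : A.col b ∉ colSpan A X := fun h => hb2 (by
    rw [colSpan_insert_eq h] at hXi; exact hXi)
  have hYz : A.col z ∈ colSpan A (insert g Y) := by
    rw [hY, insert_initialUnion_mid (by omega)]; exact hg1
  have hYg : A.col g ∉ colSpan A Y := fun h => hg2 (by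
    rw [colSpan_insert_eq h] at hYz; exact hYz)
  have hbX : b ∉ X := fun h => hXb (col_mem_colSpan h)
  have hgY : g ∉ Y := fun h => hYg (col_mem_colSpan h)
  have hXY : insert b X ⊆ Y := by
    intro s hs
    simp only [hX, hY, Set.mem_insert_iff, mem_initialUnion, Fin.ext_iff] at hs ⊢
    omega
  -- a greedy basis for the flag `X ⊂ X ∪ {b} ⊂ Y ⊂ Y ∪ {g}`
  obtain ⟨J, hJ⟩ := exists_isMinWeight hM
    (fun s => if s ∈ X then 0 else if s = b then 1 else if s ∈ Y then 2 else if s = g then 3 else 4)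
  have gX := hJ.colSpan_inter hA (Q := X) (fun s hs t ht => by
    simp only [hs, ht, if_true, if_false]; split_ifs <;> norm_num)
  have gXb := hJ.colSpan_inter hA (Q := insert b X) (fun s hs t ht => by
    simp only [Set.mem_insert_iff, not_or] at hs ht
    simp only [ht.1, ht.2, if_false]
    rcases hs with rfl | hs
    · simp only [hbX, if_true, if_false]; split_ifs <;> norm_num
    · simp only [hs, if_true]; split_ifs <;> norm_num)
  have gY := hJ.colSpan_inter hA (Q := Y) (fun s hs t ht => by
    have t1 : t ∉ X := fun h => ht (hXY (Or.inr h))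
    have t2 : t ≠ b := fun h => ht (hXY (Or.inl h))
    simp only [t1, t2, ht, hs, if_true, if_false]
    split_ifs <;> norm_num)
  have gYg := hJ.colSpan_inter hA (Q := insert g Y) (fun s hs t ht => by
    simp only [Set.mem_insert_iff, not_or] at hs ht
    have t1 : t ∉ X := fun h => ht.2 (hXY (Or.inr h))
    have t2 : t ≠ b := fun h => ht.2 (hXY (Or.inl h))
    simp only [t1, t2, ht.1, ht.2, if_false]
    split_ifs with h1 h2 h3 h4 <;> first | (norm_num; done) | tauto)
  have hbJ : b ∈ J := by
    by_contra hbJ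
    apply hXb
    rw [← gX]
    have : A.col b ∈ colSpan A (↑J ∩ insert b X) := by
      rw [gXb]; exact col_mem_colSpan (Set.mem_insert _ _)
    refine colSpan_mono (T := (J : Set (Fin n)) ∩ X) (fun s hs => ?_) this
    exact ⟨hs.1, hs.2.resolve_left fun h => hbJ (h ▸ hs.1)⟩
  have hgJ : g ∈ J := by
    by_contra hgJ
    apply hYg
    rw [← gY]
    have : A.col g ∈ colSpan A (↑J ∩ insert g Y) := by
      rw [gYg]; exact col_mem_colSpan (Set.mem_insert _ _)
    refine colSpan_mono (T := (J : Set (Fin n)) ∩ Y) (fun s hs => ?_) this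
    exact ⟨hs.1, hs.2.resolve_left fun h => hgJ (h ▸ hs.1)⟩
  have hgb : g ≠ b := fun h => hgY (h ▸ hXY (Set.mem_insert _ _))
  have hgX : g ∉ X := fun h => hgY (hXY (Or.inr h))
  -- `J ∩ X` and `J ∩ Y` in terms of `S = J \ {b, g}`
  set S := (J.erase b).erase g with hS
  have hXS : colSpan A X ≤ colSpan A (S : Set (Fin n)) := by
    rw [← gX]
    refine colSpan_mono fun s hs => ?_
    have h1 : s ≠ g := fun h => hgX (h ▸ hs.2)
    have h2 : s ≠ b := fun h => hbX (h ▸ hs.2)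
    simpa [hS, h1, h2] using hs.1
  have hYS : colSpan A Y ≤ colSpan A (insert b (S : Set (Fin n))) := by
    rw [← gY]
    refine colSpan_mono fun s hs => ?_
    have h1 : s ≠ g := fun h => hgY (h ▸ hs.2)
    by_cases h2 : s = b
    · exact Or.inl h2
    · exact Or.inr (by simpa [hS, h1, h2] using hs.1)
  have hspan : ∀ {s : Fin n} {T T' : Set (Fin n)}, colSpan A T ≤ colSpan A T' →
      colSpan A (insert s T) ≤ colSpan A (insert s T') := by
    intro s T T' hTT'
    refine colSpan_le.2 fun x hx => ?_
    rcases hx with rfl | hx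
    · exact col_mem_colSpan (Set.mem_insert _ _)
    · exact colSpan_mono (Set.subset_insert _ _) (hTT' (col_mem_colSpan hx))
  have hiS : A.col i ∈ colSpan A (insert b (S : Set (Fin n))) := hspan hXS hXi
  have hbi : A.col b ∈ colSpan A (insert i (S : Set (Fin n))) :=
    hspan hXS (colSpan_exchange hXi hb2)
  have hgz : A.col g ∈ colSpan A (insert z (insert b (S : Set (Fin n)))) :=
    hspan hYS (colSpan_exchange hYz hg2)
  have hbS : b ∉ S := by simp [hS]
  have hgS : g ∉ S := by simp [hS]
  have hJb : J = insert b (insert g S) := by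
    rw [hS, Finset.insert_erase (by simp [hgb, hgJ]), Finset.insert_erase hbJ]
  have hJg : J.erase g = insert b S := by
    rw [hS, Finset.erase_right_comm, Finset.insert_erase (by simp [hgb.symm, hbJ])]
  have hJb' : J.erase b = insert g S := by
    rw [hS, Finset.insert_erase (by simp [hgb, hgJ])]
  have hib : i ≠ b := by intro h; omega
  have higne : i ≠ g := by intro h; omega
  have hiJ : i ∉ J := by
    intro hiJ
    have hm := col_notMem_colSpan_erase hA hJ.1 hiJ
    refine hm (colSpan_mono ?_ ((hspan (by rw [gX])) hXi : A.col i ∈ colSpan A (insert b (↑J ∩ X))))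
    intro s hs
    have hsX : s ∈ insert b X := hs.imp id fun h => h.2
    have : s ≠ i := by
      rintro rfl
      rcases hsX with h | h
      · exact hib h
      · rw [hX, mem_initialUnion] at h; omega
    have hsJ : s ∈ J := hs.elim (fun h => h ▸ hbJ) fun h => h.1
    simp [this, hsJ]
  have hzne : z ≠ b := by intro h; omega
  have hzg : z ≠ g := by intro h; omega
  have hzJ : z ∉ J := by
    intro hzJ
    have hm := col_notMem_colSpan_erase hA hJ.1 hzJ
    refine hm (colSpan_mono ?_ ((hspan (by rw [gY])) hYz : A.col z ∈ colSpan A (insert g (↑J ∩ Y))))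
    intro s hs
    have hsX : s ∈ insert g Y := hs.imp id fun h => h.2
    have : s ≠ z := by
      rintro rfl
      rcases hsX with h | h
      · exact hzg h
      · rw [hY, mem_initialUnion] at h; omega
    have hsJ : s ∈ J := hs.elim (fun h => h ▸ hgJ) fun h => h.1
    simp [this, hsJ]
  have hiS' : i ∉ S := fun h => hiJ (by simp only [hS, Finset.mem_erase] at h; exact h.2.2)
  have hzS' : z ∉ S := fun h => hzJ (by simp only [hS, Finset.mem_erase] at h; exact h.2.2)
  have m2 : insert b (insert g S) ∈ M := hJb ▸ hJ.1
  have m1 : insert i (insert g S) ∈ M := by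
    rw [← hJb']
    refine insert_erase_mem hA hJ.1 hbJ hiJ (colSpan_mono (Set.insert_subset_insert ?_) hbi)
    rw [hJb']; simp
  have m4 : insert b (insert z S) ∈ M := by
    rw [Finset.insert_comm, ← hJg]
    refine insert_erase_mem hA hJ.1 hgJ hzJ ?_
    rw [hJg, Finset.coe_insert]; exact hgz
  have m3 : insert i (insert z S) ∈ M := by
    have e1 : (insert b (insert z S)).erase b = insert z S :=
      Finset.erase_insert (by simp [hbS, hzne.symm])
    have := insert_erase_mem hA m4 (s := i) (t := b) (by simp)
      (by simp only [Finset.mem_insert, not_or]; exact ⟨hib, by intro h; omega, hiS'⟩)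
      (by rw [e1]; exact colSpan_mono (Set.insert_subset_insert (by simp)) hbi)
    rwa [e1] at this
  exact not_crossing_exchange hA (by omega) (by omega) hbz hiS' hgS hbS hzS' hiS m1 m2 m3 m4

end Positroid

/-! ### The pipes of a matrix -/

section Pipes

variable {k n : ℕ} {A : Matrix (Fin k) (Fin n) ℝ} {M : Finset (Finset (Fin n))}

/-- The column `i` is not spanned by the columns before it. -/
def IsPivot (A : Matrix (Fin k) (Fin n) ℝ) (i : Fin n) : Prop := ¬ Spanned A i i i i

/-- For a pivot `i`: `j` is the largest index for which `i` depends on `[j, x)` modulo the elements before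
`i`, with `j = i` if there is none. For a matrix in the cell of a Le-diagram, `j` is the label of the pipe
that runs through the row of `i`, between the columns with labels below `x` and those with labels at
least `x`. -/
def RowPipe (A : Matrix (Fin k) (Fin n) ℝ) (i : Fin n) (x : ℕ) (j : Fin n) : Prop :=
  i ≤ j ∧ (j : ℕ) < x ∧ ∀ t : ℕ, (i : ℕ) < t → t ≤ x → (Spanned A i i t x ↔ t ≤ j)

/-- For a nonpivot `z`: `j` is the largest index for which `z` depends on `[j, z)` modulo `[0, i)`, with
`j = z` if `z` depends on `[0, i)`. For a matrix in the cell of a Le-diagram, `j` is the label of the pipe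
that runs through the column of `z`, between the rows with labels below `i` and those with labels at
least `i`. -/
def ColPipe (A : Matrix (Fin k) (Fin n) ℝ) (i : ℕ) (z : Fin n) (j : Fin n) : Prop :=
  i ≤ (j : ℕ) ∧ j ≤ z ∧ ∀ t : ℕ, i ≤ t → t ≤ z → (Spanned A z i t z ↔ t ≤ j)

theorem RowPipe.unique {i : Fin n} {x : ℕ} {j j' : Fin n} (h : RowPipe A i x j)
    (h' : RowPipe A i x j') : j = j' := by
  have key : ∀ {j j' : Fin n}, RowPipe A i x j → RowPipe A i x j' → j' ≤ j := by
    intro j j' h h'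
    by_contra! hlt
    have h1 := h.1
    have h2 := h'.2.1
    exact absurd ((h.2.2 j' (by omega) (by omega)).1 ((h'.2.2 j' (by omega) (by omega)).2 le_rfl))
      (by omega)
  exact le_antisymm (key h' h) (key h h')

theorem ColPipe.unique {i : ℕ} {z j j' : Fin n} (h : ColPipe A i z j) (h' : ColPipe A i z j') :
    j = j' := by
  have key : ∀ {j j' : Fin n}, ColPipe A i z j → ColPipe A i z j' → j' ≤ j := by
    intro j j' h h'
    by_contra! hlt
    have h1 := h.1
    have h2 := h'.2.1
    exact absurd ((h.2.2 j' (by omega) (by omega)).1 ((h'.2.2 j' (by omega) (by omega)).2 le_rfl))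
      (by omega)
  exact le_antisymm (key h' h) (key h h')

theorem rowPipe_of_spanned {i j : Fin n} {x : ℕ} (hij : i < j) (hjx : (j : ℕ) < x)
    (h1 : Spanned A i i j x) (h2 : ¬ Spanned A i i (j + 1) x) : RowPipe A i x j := by
  refine ⟨hij.le, hjx, fun t _ _ => ⟨fun h => ?_, fun h => h1.mono (by omega)⟩⟩
  by_contra hlt
  exact h2 (h.mono (by omega))

theorem colPipe_of_spanned {z j : Fin n} {i : ℕ} (hij : i ≤ (j : ℕ)) (hjz : j < z)
    (h1 : Spanned A z i j z) (h2 : ¬ Spanned A z i (j + 1) z) : ColPipe A i z j := by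
  refine ⟨hij, hjz.le, fun t _ _ => ⟨fun h => ?_, fun h => h1.mono (by omega)⟩⟩
  by_contra hlt
  exact h2 (h.mono (by omega))

theorem IsPivot.rowPipe_self {i : Fin n} (h : IsPivot A i) : RowPipe A i (i + 1) i := by
  refine ⟨le_rfl, by omega, fun t h1 h2 => ⟨fun h3 => absurd (h3.mono (by omega)) h, by omega⟩⟩

theorem colPipe_self {z : Fin n} (h : ¬ IsPivot A z) : ColPipe A z z z := by
  refine ⟨le_rfl, le_rfl, fun t h1 h2 => ⟨fun _ => h2, fun h3 => (not_not.1 h).mono (by omega)⟩⟩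

theorem RowPipe.isPivot {i j : Fin n} {x : ℕ} (h : RowPipe A i x j) : IsPivot A i := fun hp => by
  have h1 := h.1
  have h2 := h.2.1
  exact absurd ((h.2.2 (j + 1) (by omega) (by omega)).1 (hp.mono (by omega))) (by omega)

theorem ColPipe.not_isPivot {i : ℕ} {z j : Fin n} (h : ColPipe A i z j) : ¬ IsPivot A z := by
  have h1 := h.1
  have h2 := h.2.1
  exact not_not.2 (((h.2.2 i le_rfl (by omega)).2 h.1).mono (by omega))

/-- Deleting a pivot that is the last element does not change dependencies. -/
theorem IsPivot.spanned_succ_iff {i x : Fin n} (hx : IsPivot A x) (hix : i < x) {t : ℕ}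
    (ht : t ≤ x) : Spanned A i i t (x + 1) ↔ Spanned A i i t x := by
  refine ⟨fun h => ?_, fun h => h.mono (by omega)⟩
  by_contra hcon
  rw [Spanned, ← insert_initialUnion_right ht] at h
  have h1 := colSpan_exchange h hcon
  rw [insert_initialUnion_left] at h1
  exact hx (colSpan_mono (fun s hs => by rw [mem_initialUnion] at hs ⊢; omega) h1)

theorem rowPipe_succ_iff {i x j : Fin n} (hi : IsPivot A i) (hx : IsPivot A x) (hix : i < x) :
    RowPipe A i (x + 1) j ↔ RowPipe A i x j := by
  have hlast : ∀ c, (x : ℕ) ≤ c → ¬ Spanned A i i c c := fun c _ h => hi (h.mono (by omega))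
  constructor
  · rintro ⟨h1, h2, h3⟩
    have h4 : (j : ℕ) < x := by
      by_contra hlt
      refine hi (((hx.spanned_succ_iff hix le_rfl).1
        ((h3 x (by omega) (by omega)).2 (by omega))).mono (by omega))
    exact ⟨h1, h4, fun t ht1 ht2 => by rw [← h3 t ht1 (by omega), hx.spanned_succ_iff hix ht2]⟩
  · rintro ⟨h1, h2, h3⟩
    refine ⟨h1, by omega, fun t ht1 ht2 => ?_⟩
    rcases Nat.lt_or_ge x t with h | h
    · obtain rfl : t = x + 1 := by omega
      exact ⟨fun h => absurd h (hlast _ (by omega)), by omega⟩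
    · rw [← h3 t ht1 h, hx.spanned_succ_iff hix h]

/-- Contracting a loop does not change dependencies. -/
theorem spanned_succ_iff_of_not_isPivot {i z : Fin n} (hi : ¬ IsPivot A i) {t : ℕ} :
    Spanned A z (i + 1) t z ↔ Spanned A z i t z := by
  rw [Spanned, ← insert_initialUnion_left, colSpan_insert_eq]
  · rfl
  · exact (not_not.1 hi).mono (by omega)

theorem colPipe_succ_iff {i z j : Fin n} (hi : ¬ IsPivot A i) (hz : ¬ IsPivot A z) (hiz : i < z) :
    ColPipe A (i + 1) z j ↔ ColPipe A i z j := by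
  have hz' : Spanned A z z z z := not_not.1 hz
  constructor
  · rintro ⟨h1, h2, h3⟩
    refine ⟨by omega, h2, fun t ht1 ht2 => ?_⟩
    rcases Nat.lt_or_ge i t with h | h
    · rw [← h3 t h ht2, spanned_succ_iff_of_not_isPivot hi]
    · exact ⟨fun _ => by omega, fun _ => hz'.mono (by omega)⟩
  · rintro ⟨h1, h2, h3⟩
    have h4 : (i : ℕ) + 1 ≤ j := (h3 _ (by omega) (by omega)).1
      ((spanned_succ_iff_of_not_isPivot hi).1 (hz'.mono (by omega)))
    exact ⟨h4, h2, fun t ht1 ht2 => by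
      rw [← h3 t (by omega) ht2, spanned_succ_iff_of_not_isPivot hi]⟩

/-- The labels of the two pipes that enter a box are the minimum (from the east) and the maximum (from the
south) of the labels of the two pipes that leave it. -/
theorem rowPipe_min_and_colPipe_max (hA : A ∈ positroidCell k M) (hM : M.Nonempty) {i z w u : Fin n}
    (hiz : i < z) (hw : RowPipe A i (z + 1) w) (hu : ColPipe A i z u) :
    RowPipe A i z (min w u) ∧ ColPipe A (i + 1) z (max w u) := by
  have hi := hw.isPivot
  have hz : Spanned A z z z z := not_not.1 hu.not_isPivot
  obtain ⟨w1, w2, w3⟩ := hw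
  obtain ⟨u1, u2, u3⟩ := hu
  have hNC : ∀ t, (i : ℕ) < t → t ≤ z → Spanned A i i t z → Spanned A z i t z :=
    fun t h1 h2 h3 => spanned_of_spanned hA hM h1 h2 hi hz h3
  -- `z` can be dropped from `[t, z]` if it depends on the rest
  have hins : ∀ t, t ≤ (z : ℕ) → Spanned A z i t z → Spanned A i i t (z + 1) → Spanned A i i t z := by
    intro t ht h1 h2
    rwa [Spanned, ← insert_initialUnion_right ht, colSpan_insert_eq h1] at h2
  have hrow : ∀ t, (i : ℕ) < t → t ≤ z → (Spanned A i i t z ↔ t ≤ w ∧ t ≤ u) := by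
    intro t h1 h2
    rw [← w3 t h1 (by omega), ← u3 t h1.le h2]
    exact ⟨fun h => ⟨h.mono (by omega), hNC t h1 h2 h⟩, fun h => hins t h2 h.2 h.1⟩
  have hcol : ∀ t, (i : ℕ) < t → t ≤ z → (Spanned A z (i + 1) t z ↔ t ≤ w ∨ t ≤ u) := by
    intro t h1 h2
    rw [← w3 t h1 (by omega), ← u3 t h1.le h2]
    constructor
    · intro h
      by_cases hcon : Spanned A z i t z
      · exact Or.inr hcon
      · -- otherwise `i` and `z` are parallel modulo `[0, i) ∪ [t, z)`
        left
        rw [Spanned, ← insert_initialUnion_left] at h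
        have := colSpan_exchange h hcon
        rwa [insert_initialUnion_right h2] at this
    · rintro (h | h)
      · by_cases hcon : Spanned A z i t z
        · exact hcon.mono (by omega)
        · have h5 : ¬ Spanned A i i t z := fun h => hcon (hNC t h1 h2 h)
          rw [Spanned, ← insert_initialUnion_right h2] at h
          have := colSpan_exchange h h5
          rwa [insert_initialUnion_left] at this
      · exact h.mono (by omega)
  have hlt : (w : ℕ) < z ∨ (u : ℕ) < z := by
    by_contra hcon
    exact hi (((hrow z (by omega) le_rfl).2 (by omega)).mono (by omega))
  have hgt : (i : ℕ) < w ∨ (i : ℕ) < u := by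
    have := (hcol (i + 1) (by omega) (by omega)).1 (hz.mono (by omega))
    omega
  have hmin : ((min w u : Fin n) : ℕ) = min (w : ℕ) u := by
    rcases le_total w u with h | h
    · rw [min_eq_left h, min_eq_left (by exact_mod_cast h)]
    · rw [min_eq_right h, min_eq_right (by exact_mod_cast h)]
  have hmax : ((max w u : Fin n) : ℕ) = max (w : ℕ) u := by
    rcases le_total w u with h | h
    · rw [max_eq_right h, max_eq_right (by exact_mod_cast h)]
    · rw [max_eq_left h, max_eq_left (by exact_mod_cast h)]
  refine ⟨⟨?_, ?_, fun t h1 h2 => ?_⟩, ?_, ?_, fun t h1 h2 => ?_⟩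
  · exact le_min w1 (by omega)
  · rw [hmin]; omega
  · rw [hrow t h1 h2, hmin]; omega
  · rw [hmax]; omega
  · exact max_le (by omega) u2
  · rw [hcol t h1 h2, hmax]; omega

/-! ### The necklace permutation -/

theorem cyclicRank_eq (r a : Fin n) :
    cyclicRank r a = if r ≤ a then (a : ℕ) - r else a + n - r := by
  have hr := r.2
  have ha := a.2
  unfold cyclicRank
  split_ifs with h
  · have h' : (r : ℕ) ≤ a := h
    rw [show (a : ℕ) + (n - r) = (a - r) + n by omega, Nat.add_mod_right, Nat.mod_eq_of_lt (by omega)]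
  · have h' : (a : ℕ) < r := not_le.1 h
    rw [show (a : ℕ) + (n - r) = a + n - r by omega, Nat.mod_eq_of_lt (by omega)]

theorem finRotate_val (i : Fin n) :
    ((finRotate n i : Fin n) : ℕ) = if (i : ℕ) + 1 = n then (0 : ℕ) else (i : ℕ) + 1 := by
  obtain ⟨n', rfl⟩ : ∃ n', n = n' + 1 := ⟨n - 1, by have := i.2; omega⟩
  rw [coe_finRotate]
  simp [Fin.ext_iff]

/-- The lexicographically minimal basis contains a basis of each initial segment of the order. -/
theorem IsLexMin.colSpan_inter (hA : A ∈ positroidCell k M) {r : Fin n} {I : Finset (Fin n)}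
    (hI : IsLexMin M r I) (ρ : ℕ) :
    colSpan A (↑I ∩ {s | cyclicRank r s ≤ ρ}) = colSpan A {s | cyclicRank r s ≤ ρ} := by
  refine le_antisymm (colSpan_mono Set.inter_subset_right) (colSpan_le.2 fun s hs => ?_)
  by_contra hcon
  have hsI : s ∉ I := fun h => hcon (col_mem_colSpan ⟨h, hs⟩)
  obtain ⟨t, htI, htQ, hM'⟩ := exists_insert_erase_mem hA hI.1 hsI hcon
  obtain ⟨a, haI, haJ, hab⟩ := hI.2 _ hM' (fun h => hsI (h ▸ Finset.mem_insert_self _ _))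
  have hat : a = t := by
    by_contra hne
    exact haJ (Finset.mem_insert_of_mem (Finset.mem_erase.2 ⟨hne, haI⟩))
  rw [Set.mem_ofPred] at hs htQ
  exact hsI ((hab s (by rw [hat]; omega)).2 (Finset.mem_insert_self _ _))

/-- If `π j = i`, then `j` is the first element after `i`, in cyclic order, such that `i` depends on the
elements from `i + 1` to `j`. -/
theorem IsNecklacePermutation.spanned (hA : A ∈ positroidCell k M) {π : Fin n → Fin n}
    (hπ : IsNecklacePermutation M π) (j : Fin n) :
    π j ≠ j ∧
    A.col (π j) ∈ colSpan A {s | s ≠ π j ∧ cyclicRank (π j) s ≤ cyclicRank (π j) j} ∧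
    A.col (π j) ∉ colSpan A {s | s ≠ π j ∧ cyclicRank (π j) s < cyclicRank (π j) j} := by
  classical
  obtain ⟨I, hI, hstep⟩ := hπ
  have hbij : Function.Bijective π := Finite.surjective_iff_bijective.1 fun i => by
    obtain ⟨-, j, -, -, h⟩ := hstep i
    exact ⟨j, h⟩
  obtain ⟨i, hi⟩ : ∃ i, i = π j := ⟨_, rfl⟩
  rw [← hi]
  obtain ⟨hiI, j', hj', hins, hπj'⟩ := hstep i
  obtain rfl : j' = j := hbij.1 (by rw [hπj', hi])
  clear hi hπj'
  have hrank : ∀ s, s ≠ i → cyclicRank i s = cyclicRank (finRotate n i) s + 1 := by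
    intro s hs
    have hs' : (s : ℕ) ≠ i := fun h => hs (Fin.ext h)
    have h1 := s.2
    have h2 := i.2
    have h3 := finRotate_val i
    rw [cyclicRank_eq, cyclicRank_eq]
    simp only [Fin.le_def]
    split_ifs at h3 ⊢ <;> omega
  have hrank_i : cyclicRank (finRotate n i) i = n - 1 := by
    have h2 := i.2
    have h3 := finRotate_val i
    rw [cyclicRank_eq]
    simp only [Fin.le_def]
    split_ifs at h3 ⊢ <;> omega
  have hlt : ∀ s, cyclicRank i s < n := fun s => Nat.mod_lt _ (by have := i.2; omega)
  have hIi := hI i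
  have hIi' := hI (finRotate n i)
  rw [hins] at hIi'
  have hjI : j' ∉ I i := by
    intro hcon
    have c1 := ((mem_iff_of_mem_positroidCell hA).1 hIi.1).1
    have c2 := ((mem_iff_of_mem_positroidCell hA).1 hIi'.1).1
    rw [Finset.insert_eq_of_mem (by simp [hcon, hj']), Finset.card_erase_of_mem hiI] at c2
    have := Finset.card_pos.2 ⟨i, hiI⟩
    omega
  refine ⟨fun h => hj' h.symm, ?_, ?_⟩
  · -- the element `j` enters the basis of `(i, j]`, so it can be exchanged with `i`
    set Q : Set (Fin n) := {s | cyclicRank i s ≤ cyclicRank i j'} with hQ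
    have h1 : A.col j' ∈ colSpan A (insert i (((I i).erase i : Finset (Fin n)) ∩ Q : Set (Fin n))) := by
      have h2 : A.col j' ∈ colSpan A (↑(I i) ∩ Q) := by
        rw [hQ, hIi.colSpan_inter hA]; exact col_mem_colSpan (by simp)
      refine colSpan_mono (fun s hs => ?_) h2
      by_cases h : s = i
      · exact Or.inl h
      · exact Or.inr ⟨by simpa [h] using hs.1, hs.2⟩
    have h2 : A.col j' ∉ colSpan A (((I i).erase i : Finset (Fin n)) ∩ Q : Set (Fin n)) := by
      intro h
      have h3 := col_notMem_colSpan_erase hA hIi'.1 (Finset.mem_insert_self j' _)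
      rw [Finset.erase_insert (by simp [hjI])] at h3
      exact h3 (colSpan_mono Set.inter_subset_left h)
    have h3 := colSpan_exchange h1 h2
    refine colSpan_mono (fun s hs => ?_) h3
    rcases hs with rfl | hs
    · exact ⟨hj', le_rfl⟩
    · refine ⟨?_, hs.2⟩
      have := hs.1
      simp only [Finset.coe_erase, Set.mem_sdiff, Set.mem_singleton_iff] at this
      exact this.2
  · -- otherwise `i` depends on the part of the next basis in `(i, j)`, hence on `I i \ {i}`
    intro hcon
    apply col_notMem_colSpan_erase hA hIi.1 hiI
    have hpos : 0 < cyclicRank i j' := by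
      have := hrank j' hj'
      omega
    have h1 : {s | s ≠ i ∧ cyclicRank i s < cyclicRank i j'}
        = {s | cyclicRank (finRotate n i) s + 2 ≤ cyclicRank i j'} := by
      ext s
      simp only [Set.mem_ofPred]
      by_cases h : s = i
      · subst h
        have := hlt j'
        simp only [ne_eq, not_true_eq_false, false_and, false_iff]
        omega
      · simp only [ne_eq, h, not_false_eq_true, true_and]
        have := hrank s h
        omega
    rw [h1] at hcon
    rcases Nat.lt_or_ge (cyclicRank i j') 2 with h2 | h2
    · refine colSpan_mono (fun s hs => ?_) hcon
      rw [Set.mem_ofPred] at hs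
      omega
    · have h3 : {s | cyclicRank (finRotate n i) s + 2 ≤ cyclicRank i j'}
          = {s | cyclicRank (finRotate n i) s ≤ cyclicRank i j' - 2} := by
        ext s
        simp only [Set.mem_ofPred]
        omega
      rw [h3, ← hIi'.colSpan_inter hA] at hcon
      refine colSpan_mono (fun s hs => ?_) hcon
      have hs1 := Finset.mem_coe.1 hs.1
      have hs2 := Set.mem_ofPred.1 hs.2
      refine Finset.mem_coe.2 ((Finset.mem_insert.1 hs1).resolve_left ?_)
      rintro rfl
      have := hrank s hj'
      omega

theorem IsNecklacePermutation.bijective {π : Fin n → Fin n} (hπ : IsNecklacePermutation M π) :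
    Function.Bijective π := by
  obtain ⟨I, hI, hstep⟩ := hπ
  refine Finite.surjective_iff_bijective.1 fun i => ?_
  obtain ⟨-, j, -, -, h⟩ := hstep i
  exact ⟨j, h⟩

theorem IsNecklacePermutation.rowPipe (hA : A ∈ positroidCell k M) {π : Fin n → Fin n}
    (hπ : IsNecklacePermutation M π) {i : Fin n} (hi : i ≤ π i) : RowPipe A i n (π i) := by
  obtain ⟨hne, h1, h2⟩ := hπ.spanned hA i
  have hip := (π i).2
  have hlt : i < π i := lt_of_le_of_ne hi hne.symm
  have hset : {s | s ≠ π i ∧ cyclicRank (π i) s < cyclicRank (π i) i}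
      = initialUnion n i (π i + 1) n := by
    ext s
    have := s.2
    have := i.2
    simp only [Set.mem_ofPred, mem_initialUnion, cyclicRank_eq, ne_eq, Fin.ext_iff, Fin.le_def]
    split_ifs <;> omega
  have hset' : {s | s ≠ π i ∧ cyclicRank (π i) s ≤ cyclicRank (π i) i}
      = insert i (initialUnion n i (π i + 1) n) := by
    ext s
    have := s.2
    have := i.2
    simp only [Set.mem_ofPred, Set.mem_insert_iff, mem_initialUnion, cyclicRank_eq, ne_eq,
      Fin.ext_iff, Fin.le_def]
    split_ifs <;> omega
  rw [hset'] at h1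
  rw [hset] at h2
  refine rowPipe_of_spanned hlt hip ?_ fun h => h2 ?_
  · have := colSpan_exchange h1 h2
    rwa [insert_initialUnion_mid hip] at this
  · rwa [colSpan_insert_eq h] at h1

theorem IsNecklacePermutation.colPipe (hA : A ∈ positroidCell k M) {π : Fin n → Fin n}
    (hπ : IsNecklacePermutation M π) {z : Fin n} (hz : π z ≤ z) : ColPipe A 0 z (π z) := by
  obtain ⟨hne, h1, h2⟩ := hπ.spanned hA z
  have hlt : π z < z := lt_of_le_of_ne hz hne
  have hset : {s | s ≠ π z ∧ cyclicRank (π z) s < cyclicRank (π z) z}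
      = initialUnion n 0 (π z + 1) z := by
    ext s
    have := s.2
    have := z.2
    simp only [Set.mem_ofPred, mem_initialUnion, cyclicRank_eq, ne_eq, Fin.ext_iff, Fin.le_def]
    split_ifs <;> omega
  have hset' : {s | s ≠ π z ∧ cyclicRank (π z) s ≤ cyclicRank (π z) z}
      = insert z (initialUnion n 0 (π z + 1) z) := by
    ext s
    have := s.2
    have := z.2
    simp only [Set.mem_ofPred, Set.mem_insert_iff, mem_initialUnion, cyclicRank_eq, ne_eq,
      Fin.ext_iff, Fin.le_def]
    split_ifs <;> omega
  rw [hset'] at h1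
  rw [hset] at h2
  refine colPipe_of_spanned (Nat.zero_le _) hlt ?_ fun h => h2 ?_
  · have := colSpan_exchange h1 h2
    rwa [insert_initialUnion_mid (by omega)] at this
  · rwa [colSpan_insert_eq h] at h1

end Pipes

/-! ### Labels and pipes of a Le-diagram -/

/-- A downward closed set of indices is an initial segment. -/
theorem exists_initial_segment {m : ℕ} {p : Fin m → Prop} (hp : ∀ c c', c ≤ c' → p c' → p c) :
    ∃ q ≤ m, ∀ c : Fin m, (c : ℕ) < q ↔ p c := by
  classical
  have hex : ∃ q, ∀ c : Fin m, p c → (c : ℕ) < q := ⟨m, fun c _ => c.2⟩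
  refine ⟨Nat.find hex, Nat.find_le fun c _ => c.2, fun c => ⟨fun h => ?_, Nat.find_spec hex c⟩⟩
  have := Nat.find_min hex h
  push Not at this
  obtain ⟨c', h1, h2⟩ := this
  exact hp c c' h2 h1

namespace LeDiagram

variable {k m : ℕ} (L : LeDiagram k m)

theorem rowLabel_val (r : Fin k) : (L.rowLabel r : ℕ) = r + (m - L.rowLen r) := rfl

theorem rowLabel_strictMono : StrictMono L.rowLabel := by
  intro r r' h
  have h1 := L.antitone_rowLen h.le
  have h2 := L.rowLen_le r
  have h3 : (r : ℕ) < r' := h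
  rw [Fin.lt_def, rowLabel_val, rowLabel_val]
  omega

theorem colLabel_strictAnti : StrictAnti L.colLabel := by
  intro c c' h
  have h1 : (univ.filter fun r : Fin k => c'.1 < L.rowLen r).card ≤
      (univ.filter fun r : Fin k => c.1 < L.rowLen r).card :=
    card_le_card fun r hr => by
      simp only [mem_filter, mem_univ, true_and] at hr ⊢
      exact lt_trans h hr
  have h2 : (c : ℕ) < c' := h
  have h3 := c'.2
  rw [Fin.lt_def]
  simp only [colLabel]
  omega

theorem rowLabel_lt_colLabel {r : Fin k} {c : Fin m} (h : (c : ℕ) < L.rowLen r) :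
    L.rowLabel r < L.colLabel c := by
  have h1 : (Finset.Iic r).card ≤ (univ.filter fun r : Fin k => c.1 < L.rowLen r).card :=
    card_le_card fun r' hr => by
      simp only [mem_filter, mem_univ, true_and]
      exact lt_of_lt_of_le h (L.antitone_rowLen (Finset.mem_Iic.1 hr))
  rw [Fin.card_Iic] at h1
  have h2 := L.rowLen_le r
  rw [Fin.lt_def, rowLabel_val]
  simp only [colLabel]
  omega

theorem colLabel_lt_rowLabel {r : Fin k} {c : Fin m} (h : L.rowLen r ≤ (c : ℕ)) :
    L.colLabel c < L.rowLabel r := by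
  have h1 : (univ.filter fun r : Fin k => c.1 < L.rowLen r).card ≤ (Finset.Iio r).card :=
    card_le_card fun r' hr => by
      simp only [mem_filter, mem_univ, true_and] at hr
      by_contra hcon
      have := L.antitone_rowLen (not_lt.1 (fun h => hcon (Finset.mem_Iio.2 h)))
      omega
  rw [Fin.card_Iio] at h1
  have h2 := L.rowLen_le r
  have h3 := c.2
  rw [Fin.lt_def, rowLabel_val]
  simp only [colLabel]
  omega

theorem rowLabel_lt_colLabel_iff {r : Fin k} {c : Fin m} :
    L.rowLabel r < L.colLabel c ↔ (c : ℕ) < L.rowLen r := by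
  refine ⟨fun h => ?_, L.rowLabel_lt_colLabel⟩
  by_contra hcon
  exact absurd (L.colLabel_lt_rowLabel (not_lt.1 hcon)) h.not_gt

theorem rowLabel_ne_colLabel (r : Fin k) (c : Fin m) : L.rowLabel r ≠ L.colLabel c := by
  rcases Nat.lt_or_ge c (L.rowLen r) with h | h
  · exact (L.rowLabel_lt_colLabel h).ne
  · exact (L.colLabel_lt_rowLabel h).ne'

theorem exists_label (i : Fin (k + m)) : (∃ r, L.rowLabel r = i) ∨ ∃ c, L.colLabel c = i := by
  have hinj : Function.Injective (Sum.elim L.rowLabel L.colLabel) :=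
    L.rowLabel_strictMono.injective.sumElim L.colLabel_strictAnti.injective L.rowLabel_ne_colLabel
  have hbij := (Fintype.bijective_iff_injective_and_card _).2 ⟨hinj, by simp⟩
  obtain ⟨x | x, hx⟩ := hbij.2 i
  · exact Or.inl ⟨x, hx⟩
  · exact Or.inr ⟨x, hx⟩

/-- The label of the pipe that runs through row `r` and leaves column `x` to the west; if column `x` does not
meet row `r`, the label of the pipe that begins in row `r`. -/
def hPipe (r : Fin k) (x : ℕ) : Fin (k + m) :=
  if h : x < L.rowLen r then (L.pipeExit r ⟨x, lt_of_lt_of_le h (L.rowLen_le r)⟩).1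
  else L.rowLabel r

/-- The label of the pipe that runs through column `c` and leaves row `y` to the north; if row `y` does not
meet column `c`, the label of the pipe that begins in column `c`. -/
def vPipe (y : ℕ) (c : Fin m) : Fin (k + m) :=
  if h : y < k then
    if c.1 < L.rowLen ⟨y, h⟩ then (L.pipeExit ⟨y, h⟩ c).2 else L.colLabel c
  else L.colLabel c

theorem westLabel_eq (r : Fin k) : L.westLabel r = L.hPipe r 0 := rfl

theorem northLabel_eq (c : Fin m) : L.northLabel c = L.vPipe 0 c := rfl

theorem pipeExit_eq (r : Fin k) (c : Fin m) : L.pipeExit r c =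
    if (r, c) ∈ L.plus then (L.vPipe (r + 1) c, L.hPipe r (c + 1))
    else (L.hPipe r (c + 1), L.vPipe (r + 1) c) := by
  rw [pipeExit]
  rfl

variable {L} {r : Fin k} {c : Fin m}

theorem hPipe_of_lt (h : (c : ℕ) < L.rowLen r) : L.hPipe r c = (L.pipeExit r c).1 := by
  rw [hPipe, dif_pos h]

theorem hPipe_of_le {x : ℕ} (h : L.rowLen r ≤ x) : L.hPipe r x = L.rowLabel r := by
  rw [hPipe, dif_neg (by omega)]

theorem vPipe_of_lt (h : (c : ℕ) < L.rowLen r) : L.vPipe r c = (L.pipeExit r c).2 := by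
  rw [vPipe, dif_pos r.2, if_pos h]

theorem vPipe_of_le (h : L.rowLen r ≤ (c : ℕ)) : L.vPipe r c = L.colLabel c := by
  rw [vPipe, dif_pos r.2, if_neg (by simp; omega)]

theorem vPipe_last {y : ℕ} (h : k ≤ y) : L.vPipe y c = L.colLabel c := by
  rw [vPipe, dif_neg (by omega)]

theorem lt_rowLen_of_mem (h : (r, c) ∈ L.plus) : (c : ℕ) < L.rowLen r := L.plus_subset _ h

theorem hPipe_of_mem (h : (r, c) ∈ L.plus) : L.hPipe r c = L.vPipe (r + 1) c := by
  rw [hPipe_of_lt (lt_rowLen_of_mem h), pipeExit_eq, if_pos h]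

theorem vPipe_of_mem (h : (r, c) ∈ L.plus) : L.vPipe r c = L.hPipe r (c + 1) := by
  rw [vPipe_of_lt (lt_rowLen_of_mem h), pipeExit_eq, if_pos h]

theorem hPipe_of_notMem (h : (r, c) ∉ L.plus) : L.hPipe r c = L.hPipe r (c + 1) := by
  rcases Nat.lt_or_ge c (L.rowLen r) with hc | hc
  · rw [hPipe_of_lt hc, pipeExit_eq, if_neg h]
  · rw [hPipe_of_le hc, hPipe_of_le (by omega)]

theorem vPipe_of_notMem (h : (r, c) ∉ L.plus) : L.vPipe r c = L.vPipe (r + 1) c := by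
  rcases Nat.lt_or_ge c (L.rowLen r) with hc | hc
  · rw [vPipe_of_lt hc, pipeExit_eq, if_neg h]
  · rw [vPipe_of_le hc]
    rcases Nat.lt_or_ge (r + 1) k with hr | hr
    · have h1 := L.antitone_rowLen (show r ≤ ⟨r + 1, hr⟩ by simp [Fin.le_def])
      exact (vPipe_of_le (r := ⟨r + 1, hr⟩) (by omega)).symm
    · rw [vPipe_last hr]

/-- The pipes at the box in row `r` and column `c` have labels between those of the row and the column. -/
theorem pipe_mem_Icc (N : ℕ) : ∀ (r : Fin k) (c : Fin m), k + m < r + c + N → (c : ℕ) < L.rowLen r →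
    (L.rowLabel r ≤ L.hPipe r c ∧ L.hPipe r c ≤ L.colLabel c) ∧
      (L.rowLabel r ≤ L.vPipe r c ∧ L.vPipe r c ≤ L.colLabel c) ∧
      (L.rowLabel r ≤ L.hPipe r (c + 1) ∧ L.hPipe r (c + 1) < L.colLabel c) ∧
      (L.rowLabel r < L.vPipe (r + 1) c ∧ L.vPipe (r + 1) c ≤ L.colLabel c) := by
  induction N with
  | zero => intro r c h; omega
  | succ N ih =>
    intro r c hN hc
    have e : L.rowLabel r ≤ L.hPipe r (c + 1) ∧ L.hPipe r (c + 1) < L.colLabel c := by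
      rcases Nat.lt_or_ge (c + 1) (L.rowLen r) with h | h
      · have hm := L.rowLen_le r
        obtain ⟨⟨h1, h2⟩, -⟩ := ih r ⟨c + 1, by omega⟩ (by simp only; omega) h
        exact ⟨h1, lt_of_le_of_lt h2 (L.colLabel_strictAnti (by simp [Fin.lt_def]))⟩
      · rw [hPipe_of_le h]
        exact ⟨le_rfl, L.rowLabel_lt_colLabel hc⟩
    have s : L.rowLabel r < L.vPipe (r + 1) c ∧ L.vPipe (r + 1) c ≤ L.colLabel c := by
      rcases Nat.lt_or_ge (r + 1) k with hr | hr
      · rcases Nat.lt_or_ge c (L.rowLen ⟨r + 1, hr⟩) with h | h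
        · obtain ⟨-, ⟨h1, h2⟩, -⟩ := ih ⟨r + 1, hr⟩ c (by simp only; omega) h
          exact ⟨lt_of_lt_of_le (L.rowLabel_strictMono (by simp [Fin.lt_def])) h1, h2⟩
        · have := vPipe_of_le (r := ⟨r + 1, hr⟩) h
          simp only at this
          rw [this]
          exact ⟨L.rowLabel_lt_colLabel hc, le_rfl⟩
      · rw [vPipe_last hr]
        exact ⟨L.rowLabel_lt_colLabel hc, le_rfl⟩
    refine ⟨?_, ?_, e, s⟩
    · by_cases h : (r, c) ∈ L.plus
      · rw [hPipe_of_mem h]; exact ⟨s.1.le, s.2⟩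
      · rw [hPipe_of_notMem h]; exact ⟨e.1, e.2.le⟩
    · by_cases h : (r, c) ∈ L.plus
      · rw [vPipe_of_mem h]; exact ⟨e.1, e.2.le⟩
      · rw [vPipe_of_notMem h]; exact ⟨s.1.le, s.2⟩

theorem rowLabel_le_hPipe_succ (h : (c : ℕ) < L.rowLen r) : L.rowLabel r ≤ L.hPipe r (c + 1) :=
  (pipe_mem_Icc (k + m + 1) r c (by omega) h).2.2.1.1

theorem hPipe_succ_lt_colLabel (h : (c : ℕ) < L.rowLen r) : L.hPipe r (c + 1) < L.colLabel c :=
  (pipe_mem_Icc (k + m + 1) r c (by omega) h).2.2.1.2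

theorem rowLabel_lt_vPipe_succ (h : (c : ℕ) < L.rowLen r) : L.rowLabel r < L.vPipe (r + 1) c :=
  (pipe_mem_Icc (k + m + 1) r c (by omega) h).2.2.2.1

theorem vPipe_succ_le_colLabel (h : (c : ℕ) < L.rowLen r) : L.vPipe (r + 1) c ≤ L.colLabel c :=
  (pipe_mem_Icc (k + m + 1) r c (by omega) h).2.2.2.2

theorem rowLabel_le_hPipe_zero (r : Fin k) : L.rowLabel r ≤ L.hPipe r 0 := by
  rcases Nat.eq_zero_or_pos (L.rowLen r) with h | h
  · rw [hPipe_of_le h.le]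
  · exact (pipe_mem_Icc (k + m + 1) r ⟨0, by have := L.rowLen_le r; omega⟩ (by omega) h).1.1

theorem vPipe_zero_le_colLabel (c : Fin m) : L.vPipe 0 c ≤ L.colLabel c := by
  rcases Nat.eq_zero_or_pos k with h | h
  · rw [vPipe_last h.le]
  · rcases Nat.lt_or_ge c (L.rowLen ⟨0, h⟩) with hc | hc
    · exact (pipe_mem_Icc (k + m + 1) ⟨0, h⟩ c (by omega) hc).2.1.2
    · exact (vPipe_of_le (r := ⟨0, h⟩) hc).le

/-! ### Pipes between consecutive elbows -/

theorem hPipe_eq_of_forall_notMem {x y : ℕ} (hxy : x ≤ y)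
    (h : ∀ c : Fin m, x ≤ (c : ℕ) → (c : ℕ) < y → (r, c) ∉ L.plus) : L.hPipe r x = L.hPipe r y := by
  induction y, hxy using Nat.le_induction with
  | base => rfl
  | succ y hy ih =>
    rw [ih fun c h1 h2 => h c h1 (by omega)]
    rcases Nat.lt_or_ge y m with hm | hm
    · exact hPipe_of_notMem (c := ⟨y, hm⟩) (h ⟨y, hm⟩ hy (by simp))
    · have := L.rowLen_le r
      rw [hPipe_of_le (by omega), hPipe_of_le (by omega)]

theorem hPipe_eq_rowLabel {x : ℕ} (h : ∀ c : Fin m, x ≤ (c : ℕ) → (r, c) ∉ L.plus) :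
    L.hPipe r x = L.rowLabel r := by
  rw [hPipe_eq_of_forall_notMem (y := max x m) (le_max_left _ _) fun c h1 _ => h c h1,
    hPipe_of_le ((L.rowLen_le r).trans (le_max_right _ _))]

theorem vPipe_eq_of_forall_notMem {x y : ℕ} (hxy : x ≤ y)
    (h : ∀ r : Fin k, x ≤ (r : ℕ) → (r : ℕ) < y → (r, c) ∉ L.plus) : L.vPipe x c = L.vPipe y c := by
  induction y, hxy using Nat.le_induction with
  | base => rfl
  | succ y hy ih =>
    rw [ih fun c h1 h2 => h c h1 (by omega)]
    rcases Nat.lt_or_ge y k with hm | hm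
    · exact vPipe_of_notMem (r := ⟨y, hm⟩) (h ⟨y, hm⟩ hy (by simp))
    · rw [vPipe_last hm, vPipe_last (by omega)]

theorem vPipe_eq_colLabel {x : ℕ} (h : ∀ r : Fin k, x ≤ (r : ℕ) → (r, c) ∉ L.plus) :
    L.vPipe x c = L.colLabel c := by
  rw [vPipe_eq_of_forall_notMem (y := max x k) (le_max_left _ _) fun c h1 _ => h c h1,
    vPipe_last (le_max_right _ _)]

/-- A pipe in a row has just turned west at an elbow, unless it begins in that row. -/
theorem hPipe_eq_or (r : Fin k) (x : ℕ) : L.hPipe r x = L.rowLabel r ∨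
    ∃ c : Fin m, x ≤ c ∧ (r, c) ∈ L.plus ∧ (∀ c' : Fin m, x ≤ (c' : ℕ) → c' < c → (r, c') ∉ L.plus) ∧
      L.hPipe r x = L.vPipe (r + 1) c := by
  classical
  by_cases h : ∃ c : Fin m, x ≤ (c : ℕ) ∧ (r, c) ∈ L.plus
  · right
    have hne : (univ.filter fun c : Fin m => x ≤ (c : ℕ) ∧ (r, c) ∈ L.plus).Nonempty := by
      obtain ⟨c, hc⟩ := h
      exact ⟨c, by simpa using hc⟩
    have hmem := Finset.min'_mem _ hne
    have hmin := fun c => Finset.min'_le (univ.filter fun c : Fin m => x ≤ (c : ℕ) ∧ (r, c) ∈ L.plus) c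
    set c := Finset.min' _ hne
    simp only [mem_filter, mem_univ, true_and] at hmem hmin
    have hno : ∀ c' : Fin m, x ≤ (c' : ℕ) → c' < c → (r, c') ∉ L.plus := fun c' h1 h2 h3 =>
      absurd (hmin c' ⟨h1, h3⟩) h2.not_ge
    refine ⟨c, hmem.1, hmem.2, hno, ?_⟩
    rw [hPipe_eq_of_forall_notMem hmem.1 (fun c' h1 h2 => hno c' h1 h2), hPipe_of_mem hmem.2]
  · left
    push Not at h
    exact hPipe_eq_rowLabel h

/-- Consequence of the Le-property: pipes in the columns come in increasing order from the right to the left,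
except for those that meet no further elbow on their way to the north. -/
theorem vPipe_lt_vPipe (N : ℕ) : ∀ y : ℕ, k ≤ y + N → ∀ c c' : Fin m, c < c' →
    (∃ r : Fin k, (r : ℕ) < y ∧ (r, c') ∈ L.plus) → L.vPipe y c' < L.vPipe y c := by
  induction N with
  | zero =>
    intro y hy c c' hcc' _
    rw [vPipe_last (by omega), vPipe_last (by omega)]
    exact L.colLabel_strictAnti hcc'
  | succ N ih =>
    intro y hy c c' hcc' hex
    rcases Nat.lt_or_ge y k with hyk | hyk
    swap
    · rw [vPipe_last (by omega), vPipe_last (by omega)]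
      exact L.colLabel_strictAnti hcc'
    have ih := ih (y + 1) (by omega)
    obtain ⟨r, rfl⟩ : ∃ r : Fin k, (r : ℕ) = y := ⟨⟨y, hyk⟩, rfl⟩
    have hcc : (c : ℕ) < c' := hcc'
    rcases Nat.lt_or_ge c' (L.rowLen r) with hc' | hc'
    swap
    · rw [vPipe_of_le hc']
      rcases Nat.lt_or_ge c (L.rowLen r) with hc | hc
      · exact lt_of_lt_of_le (L.colLabel_lt_rowLabel hc')
          (pipe_mem_Icc (k + m + 1) r c (by omega) hc).2.1.1
      · rw [vPipe_of_le hc]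
        exact L.colLabel_strictAnti hcc'
    obtain ⟨r', hr', hplus⟩ := hex
    by_cases h : (r, c') ∈ L.plus
    · have hlow : ∀ c'' : Fin m, c'' ≤ c' → L.hPipe r (c' + 1) < L.vPipe (r + 1) c'' := by
        intro c'' hc''
        have hcc'' : (c'' : ℕ) ≤ c' := hc''
        rcases hPipe_eq_or (L := L) r (c' + 1) with h1 | ⟨d, hd, hdp, -, h1⟩
        · rw [h1]
          exact rowLabel_lt_vPipe_succ (by omega)
        · rw [h1]
          exact ih c'' d (by rw [Fin.lt_def]; omega) ⟨r, by omega, hdp⟩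
      rw [vPipe_of_mem h]
      by_cases hp : (r, c) ∈ L.plus
      · rw [vPipe_of_mem hp]
        rcases hPipe_eq_or (L := L) r (c + 1) with h1 | ⟨d, hd, hdp, hdm, h1⟩
        · -- the elbow in column `c'` would have turned the pipe that begins in row `r`
          exfalso
          have hne : (univ.filter fun d : Fin m => (c : ℕ) + 1 ≤ d ∧ (r, d) ∈ L.plus).Nonempty :=
            ⟨c', by simp [h]; omega⟩
          have hmem := Finset.min'_mem _ hne
          have hmin := fun d => Finset.min'_le
            (univ.filter fun d : Fin m => (c : ℕ) + 1 ≤ d ∧ (r, d) ∈ L.plus) d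
          set d := Finset.min' _ hne
          simp only [mem_filter, mem_univ, true_and] at hmem hmin
          rw [hPipe_eq_of_forall_notMem hmem.1 (fun d' h3 h4 h5 =>
            absurd (hmin d' ⟨h3, h5⟩) (by rw [Fin.le_def]; omega)), hPipe_of_mem hmem.2] at h1
          exact (rowLabel_lt_vPipe_succ (lt_rowLen_of_mem hmem.2)).ne' h1
        · rw [h1]
          refine hlow d ?_
          by_contra hcon
          exact hdm c' (by omega) (not_le.1 hcon) h
      · rw [vPipe_of_notMem hp]
        exact hlow c hcc'.le
    · have hp : (r, c) ∉ L.plus := fun hp =>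
        L.le_property r c' hc' h ⟨⟨r', by exact_mod_cast hr', hplus⟩, ⟨c, hcc', hp⟩⟩
      rw [vPipe_of_notMem h, vPipe_of_notMem hp]
      exact ih c c' hcc' ⟨r', by omega, hplus⟩

/-- Of the two pipes that enter a box, the one from the east has the smaller label. -/
theorem hPipe_lt_vPipe (h : (c : ℕ) < L.rowLen r) : L.hPipe r (c + 1) < L.vPipe (r + 1) c := by
  rcases hPipe_eq_or (L := L) r (c + 1) with h1 | ⟨d, hd, hdp, -, h1⟩
  · rw [h1]
    exact rowLabel_lt_vPipe_succ h
  · rw [h1]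
    exact vPipe_lt_vPipe k _ (by omega) c d (by rw [Fin.lt_def]; omega) ⟨r, by omega, hdp⟩

/-! ### The pipes of a Le-diagram are the pipes of the matrix -/

theorem perm_rowLabel (r : Fin k) : L.perm (L.rowLabel r) = L.westLabel r := by
  have h : ∃ r', L.rowLabel r' = L.rowLabel r := ⟨r, rfl⟩
  rw [perm, dif_pos h]
  congr 1
  exact L.rowLabel_strictMono.injective h.choose_spec

theorem perm_colLabel (c : Fin m) : L.perm (L.colLabel c) = L.northLabel c := by
  have h : ∃ c', L.colLabel c' = L.colLabel c := ⟨c, rfl⟩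
  have h' : ¬ ∃ r, L.rowLabel r = L.colLabel c := fun ⟨r, hr⟩ => L.rowLabel_ne_colLabel r c hr
  rw [perm, dif_neg h', dif_pos h]
  congr 1
  exact L.colLabel_strictAnti.injective h.choose_spec

/-- The matrix `A` has the pipes of `L` at the northwest border. -/
structure Matches (L : LeDiagram k m) (A : Matrix (Fin k) (Fin (k + m)) ℝ) : Prop where
  west : ∀ r, RowPipe A (L.rowLabel r) (k + m) (L.hPipe r 0)
  north : ∀ c, ColPipe A 0 (L.colLabel c) (L.vPipe 0 c)
  box : ∀ {i z w u : Fin (k + m)}, i < z → RowPipe A i (z + 1) w → ColPipe A i z u →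
    RowPipe A i z (min w u) ∧ ColPipe A (i + 1) z (max w u)

theorem matches_of_isNecklacePermutation {A : Matrix (Fin k) (Fin (k + m)) ℝ}
    {M : Finset (Finset (Fin (k + m)))} (hA : A ∈ positroidCell k M) (hM : M.Nonempty)
    (hL : IsNecklacePermutation M L.perm) : L.Matches A where
  west r := by
    have h := L.rowLabel_le_hPipe_zero r
    rw [← westLabel_eq, ← perm_rowLabel] at h ⊢
    exact hL.rowPipe hA h
  north c := by
    have h := L.vPipe_zero_le_colLabel c
    rw [← northLabel_eq, ← perm_colLabel] at h ⊢
    exact hL.colPipe hA h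
  box h hw hu := rowPipe_min_and_colPipe_max hA hM h hw hu

namespace Matches

variable {A : Matrix (Fin k) (Fin (k + m)) ℝ}

theorem isPivot_rowLabel (h : L.Matches A) (r : Fin k) : IsPivot A (L.rowLabel r) := (h.west r).isPivot

theorem not_isPivot_colLabel (h : L.Matches A) (c : Fin m) : ¬ IsPivot A (L.colLabel c) :=
  (h.north c).not_isPivot

theorem rowPipe_iff_of_le (h : L.Matches A) {r : Fin k} {x y : ℕ} (hx : (L.rowLabel r : ℕ) < x)
    (hxy : x ≤ y) (hy : y ≤ k + m) (hno : ∀ c, x ≤ (L.colLabel c : ℕ) → y ≤ (L.colLabel c : ℕ))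
    {j : Fin (k + m)} : RowPipe A (L.rowLabel r) x j ↔ RowPipe A (L.rowLabel r) y j := by
  induction y, hxy using Nat.le_induction with
  | base => rfl
  | succ y hxy ih =>
    rw [ih (by omega) fun c hc => by have := hno c hc; omega]
    have hp : IsPivot A ⟨y, by omega⟩ := by
      rcases L.exists_label ⟨y, by omega⟩ with ⟨r, hr⟩ | ⟨c, hc⟩
      · rw [← hr]; exact h.isPivot_rowLabel r
      · have := hno c (by rw [hc]; exact hxy)
        rw [hc] at this
        simp at this
    exact (rowPipe_succ_iff (h.isPivot_rowLabel r) hp (by rw [Fin.lt_def]; simp only; omega)).symm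

theorem colPipe_iff_of_le (h : L.Matches A) {c : Fin m} {x y : ℕ} (hxy : x ≤ y)
    (hy : y ≤ (L.colLabel c : ℕ)) (hno : ∀ r, x ≤ (L.rowLabel r : ℕ) → y ≤ (L.rowLabel r : ℕ))
    {j : Fin (k + m)} : ColPipe A x (L.colLabel c) j ↔ ColPipe A y (L.colLabel c) j := by
  induction y, hxy using Nat.le_induction with
  | base => rfl
  | succ y hxy ih =>
    rw [ih (by omega) fun c hc => by have := hno c hc; omega]
    have hyn : y < k + m := by have := (L.colLabel c).2; omega
    have hp : ¬ IsPivot A ⟨y, hyn⟩ := by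
      rcases L.exists_label ⟨y, hyn⟩ with ⟨r, hr⟩ | ⟨c, hc⟩
      · have := hno r (by rw [hr]; exact hxy)
        rw [hr] at this
        simp at this
      · rw [← hc]; exact h.not_isPivot_colLabel c
    exact (colPipe_succ_iff hp (h.not_isPivot_colLabel c) (by rw [Fin.lt_def]; simp only; omega)).symm

/-- The pipes at a box are determined from the northwest to the southeast. -/
theorem rowPipe_and_colPipe (h : L.Matches A) (N : ℕ) : ∀ (r : Fin k) (c : Fin m), (r : ℕ) + c < N →
    (c : ℕ) < L.rowLen r →
    (RowPipe A (L.rowLabel r) (L.colLabel c + 1) (L.hPipe r c) ∧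
      ColPipe A (L.rowLabel r) (L.colLabel c) (L.vPipe r c)) ∧
    RowPipe A (L.rowLabel r) (L.colLabel c) (L.hPipe r (c + 1)) ∧
      ColPipe A (L.rowLabel r + 1) (L.colLabel c) (L.vPipe (r + 1) c) := by
  induction N with
  | zero => intro r c h; omega
  | succ N ih =>
    intro r c hN hc
    have hlt := L.rowLabel_lt_colLabel hc
    have hw : RowPipe A (L.rowLabel r) (L.colLabel c + 1) (L.hPipe r c) := by
      rcases Nat.eq_zero_or_pos c with hc0 | hc0
      · rw [hc0, h.rowPipe_iff_of_le (y := k + m) (by omega) (by omega) le_rfl]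
        · exact h.west r
        · intro c' hc'
          have h1 : c ≤ c' := by rw [Fin.le_def]; omega
          have h2 : L.colLabel c' ≤ L.colLabel c := L.colLabel_strictAnti.antitone h1
          omega
      · have hc1 : (c : ℕ) - 1 < m := by omega
        obtain ⟨-, h1, -⟩ := ih r ⟨c - 1, hc1⟩ (by simp only; omega) (by simp only; omega)
        have h2 : L.colLabel c < L.colLabel ⟨c - 1, hc1⟩ :=
          L.colLabel_strictAnti (by rw [Fin.lt_def]; simp only; omega)
        rw [h.rowPipe_iff_of_le (y := L.colLabel ⟨c - 1, hc1⟩) (by omega) (by omega) (by omega)]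
        · simpa [Nat.sub_add_cancel hc0] using h1
        · intro c' hc'
          rcases le_or_gt c c' with h3 | h3
          · have h4 : L.colLabel c' ≤ L.colLabel c := L.colLabel_strictAnti.antitone h3
            omega
          · have h4 := L.colLabel_strictAnti.antitone
              (show c' ≤ ⟨c - 1, hc1⟩ by rw [Fin.le_def]; simp only; omega)
            exact h4
    have hu : ColPipe A (L.rowLabel r) (L.colLabel c) (L.vPipe r c) := by
      rcases Nat.eq_zero_or_pos r with hr0 | hr0
      · rw [hr0, ← h.colPipe_iff_of_le (x := 0) (by omega) (by omega)]
        · exact h.north c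
        · intro r' _
          exact L.rowLabel_strictMono.monotone (by rw [Fin.le_def]; omega)
      · have hr1 : (r : ℕ) - 1 < k := by omega
        obtain ⟨-, -, h1⟩ := ih ⟨r - 1, hr1⟩ c (by simp only; omega)
          (lt_of_lt_of_le hc (L.antitone_rowLen (by rw [Fin.le_def]; simp)))
        have h2 : L.rowLabel ⟨r - 1, hr1⟩ < L.rowLabel r :=
          L.rowLabel_strictMono (by rw [Fin.lt_def]; simp only; omega)
        rw [← h.colPipe_iff_of_le (x := L.rowLabel ⟨r - 1, hr1⟩ + 1) (by omega) (by omega)]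
        · simpa [Nat.sub_add_cancel hr0] using h1
        · intro r' hr'
          rcases le_or_gt r r' with h3 | h3
          · exact L.rowLabel_strictMono.monotone h3
          · have h4 := L.rowLabel_strictMono.monotone
              (show r' ≤ ⟨r - 1, hr1⟩ by rw [Fin.le_def]; simp only; omega)
            omega
    refine ⟨⟨hw, hu⟩, ?_⟩
    have hlt' := hPipe_lt_vPipe hc
    have hbox := h.box hlt hw hu
    by_cases hp : (r, c) ∈ L.plus
    · rwa [hPipe_of_mem hp, vPipe_of_mem hp, min_eq_right hlt'.le, max_eq_left hlt'.le] at hbox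
    · rwa [hPipe_of_notMem hp, vPipe_of_notMem hp, min_eq_left hlt'.le, max_eq_right hlt'.le] at hbox

theorem rowPipe (h : L.Matches A) {r : Fin k} {x q : ℕ} (hx : (L.rowLabel r : ℕ) < x)
    (hxn : x ≤ k + m) (hq : ∀ c : Fin m, (c : ℕ) < q ↔ x ≤ L.colLabel c) :
    RowPipe A (L.rowLabel r) x (L.hPipe r q) := by
  rcases Nat.lt_or_ge q (L.rowLen r) with hlt | hge
  · have hqm := hlt.trans_le (L.rowLen_le r)
    have h1 := (h.rowPipe_and_colPipe (r + q + 1) r ⟨q, hqm⟩ (by simp) hlt).1.1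
    have h2 := L.rowLabel_lt_colLabel (c := ⟨q, hqm⟩) hlt
    have h3 : ¬ x ≤ L.colLabel ⟨q, hqm⟩ := fun h => by
      have := (hq _).2 h
      simp at this
    rwa [h.rowPipe_iff_of_le (y := x) (by omega) (by omega) hxn] at h1
    intro c hc
    rw [← hq]
    by_contra hcon
    have : L.colLabel c ≤ L.colLabel ⟨q, hqm⟩ :=
      L.colLabel_strictAnti.antitone (by rw [Fin.le_def]; exact not_lt.1 hcon)
    omega
  · rw [hPipe_of_le hge, ← h.rowPipe_iff_of_le (x := L.rowLabel r + 1) (by omega) hx hxn]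
    · exact (h.isPivot_rowLabel r).rowPipe_self
    · intro c hc
      rw [← hq]
      exact lt_of_lt_of_le (L.rowLabel_lt_colLabel_iff.1 (by omega)) hge

theorem colPipe (h : L.Matches A) {c : Fin m} {x q : ℕ} (hx : x ≤ L.colLabel c)
    (hq : ∀ r : Fin k, (r : ℕ) < q ↔ (L.rowLabel r : ℕ) < x) :
    ColPipe A x (L.colLabel c) (L.vPipe q c) := by
  by_cases hbox : ∃ hqk : q < k, (c : ℕ) < L.rowLen ⟨q, hqk⟩
  · obtain ⟨hqk, hlt⟩ := hbox
    have h1 := (h.rowPipe_and_colPipe (q + c + 1) ⟨q, hqk⟩ c (by simp) hlt).1.2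
    have h2 := L.rowLabel_lt_colLabel (c := c) hlt
    have h3 : ¬ (L.rowLabel ⟨q, hqk⟩ : ℕ) < x := fun h => by
      have := (hq _).2 h
      simp at this
    rwa [← h.colPipe_iff_of_le (x := x) (by omega) (by omega)] at h1
    intro r hr
    refine L.rowLabel_strictMono.monotone ?_
    rw [Fin.le_def]
    by_contra hcon
    have := (hq r).1 (not_le.1 hcon)
    omega
  · have hv : L.vPipe q c = L.colLabel c := by
      rcases Nat.lt_or_ge q k with hqk | hqk
      · exact vPipe_of_le (r := ⟨q, hqk⟩) (not_lt.1 fun hh => hbox ⟨hqk, hh⟩)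
      · exact vPipe_last hqk
    rw [hv, h.colPipe_iff_of_le (y := L.colLabel c) hx le_rfl]
    · exact colPipe_self (h.not_isPivot_colLabel c)
    · intro r hr
      by_contra hcon
      have h1 := L.rowLabel_lt_colLabel_iff.1 (show L.rowLabel r < L.colLabel c by omega)
      have h2 : q ≤ r := by
        by_contra h3
        have := (hq r).1 (not_le.1 h3)
        omega
      exact hbox ⟨by omega, lt_of_lt_of_le h1 (L.antitone_rowLen (by rw [Fin.le_def]; exact h2))⟩

end Matches

end LeDiagram

namespace LeDiagram

variable {k m : ℕ} {L : LeDiagram k m}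

/-! ### Strands of the graph -/

/-- The label of the pipe that enters the box `b` from the east. -/
def east (L : LeDiagram k m) (b : Fin k × Fin m) : Fin (k + m) := L.hPipe b.1 (b.2 + 1)

/-- The label of the pipe that enters the box `b` from the south. -/
def south (L : LeDiagram k m) (b : Fin k × Fin m) : Fin (k + m) := L.vPipe (b.1 + 1) b.2

theorem rowLabel_lt_south {b : Fin k × Fin m} (hb : b ∈ L.plus) : L.rowLabel b.1 < L.south b :=
  rowLabel_lt_vPipe_succ (L.plus_subset b hb)

theorem south_le_colLabel {b : Fin k × Fin m} (hb : b ∈ L.plus) : L.south b ≤ L.colLabel b.2 :=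
  vPipe_succ_le_colLabel (L.plus_subset b hb)

theorem rowLabel_le_east {b : Fin k × Fin m} (hb : b ∈ L.plus) : L.rowLabel b.1 ≤ L.east b :=
  rowLabel_le_hPipe_succ (L.plus_subset b hb)

theorem east_lt_colLabel {b : Fin k × Fin m} (hb : b ∈ L.plus) : L.east b < L.colLabel b.2 :=
  hPipe_succ_lt_colLabel (L.plus_subset b hb)

theorem east_lt_south {b : Fin k × Fin m} (hb : b ∈ L.plus) : L.east b < L.south b :=
  hPipe_lt_vPipe (L.plus_subset b hb)

theorem east_of_not_hasRight {b : Fin k × Fin m} (h : ¬ L.HasRight b) : L.east b = L.rowLabel b.1 :=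
  hPipe_eq_rowLabel fun c hc hp => h ⟨c, by rw [Fin.lt_def]; omega, hp⟩

theorem south_of_not_hasBelow {b : Fin k × Fin m} (h : ¬ L.HasBelow b) :
    L.south b = L.colLabel b.2 :=
  vPipe_eq_colLabel fun r hr hp => h ⟨r, by rw [Fin.lt_def]; omega, hp⟩

/-- The strand that leaves a `+` to the west arrives at the next `+` or at the border. -/
theorem westEnd_cases {b : Fin k × Fin m} (hb : b ∈ L.plus) :
    (∃ w : L.White, w.1.1 = b.1 ∧ w.1.2 < b.2 ∧
      (∀ c, w.1.2 < c → c < b.2 → (b.1, c) ∉ L.plus) ∧ L.westEnd b hb = Sum.inl (Sum.inl w, 0)) ∨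
    ((∀ c < b.2, (b.1, c) ∉ L.plus) ∧ L.westEnd b hb = Sum.inr (L.westLabel b.1)) := by
  unfold westEnd
  split_ifs with h
  · left
    have h1 := (mem_filter.1 ((L.before b).max'_mem h)).2
    refine ⟨⟨(b.1, (L.before b).max' h), h1.2, b.2, h1.1, hb⟩, rfl, h1.1, fun c hc hcb hp => ?_, rfl⟩
    exact absurd ((L.before b).le_max' c (mem_filter.2 ⟨mem_univ _, hcb, hp⟩)) hc.not_ge
  · right
    refine ⟨fun c hc hp => h ⟨c, mem_filter.2 ⟨mem_univ _, hc, hp⟩⟩, rfl⟩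

/-- The strand that leaves a `+` to the north arrives at the next `+` or at the border. -/
theorem northEnd_cases {b : Fin k × Fin m} (hb : b ∈ L.plus) :
    (∃ v : L.Black, v.1.2 = b.2 ∧ v.1.1 < b.1 ∧
      (∀ r, v.1.1 < r → r < b.1 → (r, b.2) ∉ L.plus) ∧ L.northEnd b hb = Sum.inl (Sum.inr v, 2)) ∨
    ((∀ r < b.1, (r, b.2) ∉ L.plus) ∧ L.northEnd b hb = Sum.inr (L.northLabel b.2)) := by
  unfold northEnd
  split_ifs with h
  · left
    have h1 := (mem_filter.1 ((L.above b).max'_mem h)).2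
    refine ⟨⟨((L.above b).max' h, b.2), h1.2, b.1, h1.1, hb⟩, rfl, h1.1, fun c hc hcb hp => ?_, rfl⟩
    exact absurd ((L.above b).le_max' c (mem_filter.2 ⟨mem_univ _, hcb, hp⟩)) hc.not_ge
  · right
    refine ⟨fun c hc hp => h ⟨c, mem_filter.2 ⟨mem_univ _, hc, hp⟩⟩, rfl⟩

theorem east_eq_south {b b' : Fin k × Fin m} (hb : b ∈ L.plus) (h1 : b'.1 = b.1) (h2 : b'.2 < b.2)
    (h : ∀ c, b'.2 < c → c < b.2 → (b.1, c) ∉ L.plus) : L.east b' = L.south b := by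
  have h3 : (b'.2 : ℕ) < b.2 := h2
  have := hPipe_of_mem hb
  rw [east, south, h1, ← this]
  exact hPipe_eq_of_forall_notMem (by omega) fun c hc hc' =>
    h c (by rw [Fin.lt_def]; omega) hc'

theorem south_eq_east {b b' : Fin k × Fin m} (hb : b ∈ L.plus) (h1 : b'.2 = b.2) (h2 : b'.1 < b.1)
    (h : ∀ r, b'.1 < r → r < b.1 → (r, b.2) ∉ L.plus) : L.south b' = L.east b := by
  have h3 : (b'.1 : ℕ) < b.1 := h2
  have := vPipe_of_mem hb
  rw [east, south, h1, ← this]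
  exact vPipe_eq_of_forall_notMem (by omega) fun c hc hc' =>
    h c (by rw [Fin.lt_def]; omega) hc'

theorem westLabel_eq_south {b : Fin k × Fin m} (hb : b ∈ L.plus)
    (h : ∀ c < b.2, (b.1, c) ∉ L.plus) : L.westLabel b.1 = L.south b := by
  rw [westLabel_eq, hPipe_eq_of_forall_notMem (Nat.zero_le (b.2 : ℕ)) fun c _ hc => h c hc,
    hPipe_of_mem hb, south]

theorem northLabel_eq_east {b : Fin k × Fin m} (hb : b ∈ L.plus)
    (h : ∀ r < b.1, (r, b.2) ∉ L.plus) : L.northLabel b.2 = L.east b := by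
  rw [northLabel_eq, vPipe_eq_of_forall_notMem (Nat.zero_le (b.1 : ℕ)) fun c _ hc => h c hc,
    vPipe_of_mem hb, east]

/-- Every white vertex is the west end of the strand that leaves the next `+` on its right. -/
theorem exists_westEnd_eq (w : L.White) :
    ∃ b, ∃ hb : b ∈ L.plus, w.1.1 = b.1 ∧ w.1.2 < b.2 ∧ L.westEnd b hb = Sum.inl (Sum.inl w, 0) := by
  obtain ⟨⟨r, c⟩, hw, hr⟩ := w
  obtain ⟨c₀, hc₀, hp₀⟩ := hr
  have hne : (univ.filter fun c' : Fin m => c < c' ∧ (r, c') ∈ L.plus).Nonempty :=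
    ⟨c₀, mem_filter.2 ⟨mem_univ _, hc₀, hp₀⟩⟩
  have hmem := (mem_filter.1 (Finset.min'_mem _ hne)).2
  have hmin := fun d => Finset.min'_le (univ.filter fun c' : Fin m => c < c' ∧ (r, c') ∈ L.plus) d
  set c₁ := Finset.min' _ hne
  refine ⟨(r, c₁), hmem.2, rfl, hmem.1, ?_⟩
  rcases westEnd_cases hmem.2 with ⟨w', h1, h2, h3, h4⟩ | ⟨h1, -⟩
  · rw [h4]
    obtain ⟨⟨r', c'⟩, hw', hr'⟩ := w'
    simp only at h1 h2 h3
    subst h1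
    have : c' = c := by
      rcases lt_trichotomy c' c with h | h | h
      · exact absurd hw (h3 c h hmem.1)
      · exact h
      · exact absurd (hmin c' (mem_filter.2 ⟨mem_univ _, h, hw'⟩)) h2.not_ge
    subst this
    rfl
  · exact absurd hw (h1 c hmem.1)

/-- Every black vertex is the north end of the strand that leaves the next `+` below it. -/
theorem exists_northEnd_eq (v : L.Black) :
    ∃ b, ∃ hb : b ∈ L.plus, v.1.2 = b.2 ∧ v.1.1 < b.1 ∧ L.northEnd b hb = Sum.inl (Sum.inr v, 2) := by
  obtain ⟨⟨r, c⟩, hw, hr⟩ := v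
  obtain ⟨c₀, hc₀, hp₀⟩ := hr
  have hne : (univ.filter fun r' : Fin k => r < r' ∧ (r', c) ∈ L.plus).Nonempty :=
    ⟨c₀, mem_filter.2 ⟨mem_univ _, hc₀, hp₀⟩⟩
  have hmem := (mem_filter.1 (Finset.min'_mem _ hne)).2
  have hmin := fun d => Finset.min'_le (univ.filter fun r' : Fin k => r < r' ∧ (r', c) ∈ L.plus) d
  set c₁ := Finset.min' _ hne
  refine ⟨(c₁, c), hmem.2, rfl, hmem.1, ?_⟩
  rcases northEnd_cases hmem.2 with ⟨w', h1, h2, h3, h4⟩ | ⟨h1, -⟩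
  · rw [h4]
    obtain ⟨⟨r', c'⟩, hw', hr'⟩ := w'
    simp only at h1 h2 h3
    subst h1
    have : r' = r := by
      rcases lt_trichotomy r' r with h | h | h
      · exact absurd hw (h3 r h hmem.1)
      · exact h
      · exact absurd (hmin r' (mem_filter.2 ⟨mem_univ _, h, hw'⟩)) h2.not_ge
    subst this
    rfl
  · exact absurd hw (h1 r hmem.1)

theorem rowLabel_lt_east (w : L.White) : L.rowLabel w.1.1 < L.east w.1 := by
  obtain ⟨b, hb, h1, h2, h3⟩ := exists_westEnd_eq w
  rcases westEnd_cases hb with ⟨w', h4, h5, h6, h7⟩ | ⟨h4, -⟩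
  · obtain rfl : w = w' := by simpa [h3] using h7
    rw [east_eq_south hb h4 h5 h6, h1]
    exact rowLabel_lt_south hb
  · exact absurd (show (b.1, w.1.2) ∈ L.plus by rw [← h1]; exact w.2.1) (h4 _ h2)

theorem south_lt_colLabel (v : L.Black) : L.south v.1 < L.colLabel v.1.2 := by
  obtain ⟨b, hb, h1, h2, h3⟩ := exists_northEnd_eq v
  rcases northEnd_cases hb with ⟨w', h4, h5, h6, h7⟩ | ⟨h4, -⟩
  · obtain rfl : v = w' := by simpa [h3] using h7
    rw [south_eq_east hb h4 h5 h6, h1]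
    exact east_lt_colLabel hb
  · exact absurd (show (v.1.1, b.2) ∈ L.plus by rw [← h1]; exact v.2.1) (h4 _ h2)

/-! ### Labels of trips -/

/-- The label of the trip that traverses the edge `e` from its end `b` to its end `!b`. Trips follow pipes
backwards while they go south or east, and rows and columns while they go west or north. -/
def tripLabel (L : LeDiagram k m) (e : L.plabicMinus.E) (b : Bool) : Fin (k + m) :=
  match e, b with
  | Sum.inl x, false => L.east x.1
  | Sum.inl x, true => L.colLabel x.1.2
  | Sum.inr (Sum.inl w), false => L.rowLabel w.1.1
  | Sum.inr (Sum.inl w), true => L.colLabel w.1.2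
  | Sum.inr (Sum.inr v), false => L.rowLabel v.1.1
  | Sum.inr (Sum.inr v), true => L.south v.1

/-- The label of the trip that leaves a vertex by one of its half-edges. -/
def outLabel (L : LeDiagram k m) (v : L.White ⊕ L.Black) (p : Fin 3) : Fin (k + m) :=
  match v, p with
  | Sum.inl w, 0 => L.east w.1
  | Sum.inl w, 1 => L.colLabel w.1.2
  | Sum.inl w, 2 => L.rowLabel w.1.1
  | Sum.inr v, 0 => L.colLabel v.1.2
  | Sum.inr v, 1 => L.rowLabel v.1.1
  | Sum.inr v, 2 => L.south v.1

/-- The label of the trip that arrives at a vertex by one of its half-edges. -/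
def inLabel (L : LeDiagram k m) (v : L.White ⊕ L.Black) (p : Fin 3) : Fin (k + m) :=
  match v, p with
  | Sum.inl w, 0 => L.rowLabel w.1.1
  | Sum.inl w, 1 => L.east w.1
  | Sum.inl w, 2 => L.colLabel w.1.2
  | Sum.inr v, 0 => L.rowLabel v.1.1
  | Sum.inr v, 1 => L.south v.1
  | Sum.inr v, 2 => L.colLabel v.1.2

open Classical in
theorem outLabel_turn (v : L.White ⊕ L.Black) (p : Fin 3) :
    L.outLabel v (if L.plabicMinus.black v then p + 1 else p - 1) = L.inLabel v p := by
  rcases v with w | v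
  · have : ¬ L.plabicMinus.black (Sum.inl w) := by simp [plabicMinus]
    rw [if_neg this]
    fin_cases p <;> rfl
  · have : L.plabicMinus.black (Sum.inr v) := by simp [plabicMinus]
    rw [if_pos this]
    fin_cases p <;> rfl

/-- At the place `P`, the trip with label `x` leaves and the trip with label `y` arrives. -/
def PlaceLabels (L : LeDiagram k m) (P : L.EndPlace) (x y : Fin (k + m)) : Prop :=
  match P with
  | Sum.inl (v, p) => x = L.outLabel v p ∧ y = L.inLabel v p
  | Sum.inr i => x = i ∧ L.perm y = i

theorem placeLabels_westEnd {b : Fin k × Fin m} (hb : b ∈ L.plus) :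
    L.PlaceLabels (L.westEnd b hb) (L.south b) (L.rowLabel b.1) := by
  rcases westEnd_cases hb with ⟨w, h1, h2, h3, h4⟩ | ⟨h1, h2⟩
  · rw [h4]
    exact ⟨(east_eq_south hb h1 h2 h3).symm, by rw [← h1]; rfl⟩
  · rw [h2]
    exact ⟨(westLabel_eq_south hb h1).symm, L.perm_rowLabel _⟩

theorem placeLabels_northEnd {b : Fin k × Fin m} (hb : b ∈ L.plus) :
    L.PlaceLabels (L.northEnd b hb) (L.east b) (L.colLabel b.2) := by
  rcases northEnd_cases hb with ⟨w, h1, h2, h3, h4⟩ | ⟨h1, h2⟩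
  · rw [h4]
    exact ⟨(south_eq_east hb h1 h2 h3).symm, by rw [← h1]; rfl⟩
  · rw [h2]
    exact ⟨(northLabel_eq_east hb h1).symm, L.perm_colLabel _⟩

theorem placeLabels_diagonalEnd {b : Fin k × Fin m} (hb : b ∈ L.plus) :
    L.PlaceLabels (L.diagonalEnd b hb) (L.colLabel b.2) (L.rowLabel b.1) := by
  unfold diagonalEnd
  split_ifs with h
  · exact ⟨rfl, rfl⟩
  · have := placeLabels_westEnd hb
    rwa [south_of_not_hasBelow h] at this

theorem placeLabels_attach (e : L.plabicMinus.E) (b : Bool) :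
    L.PlaceLabels (L.plabicMinus.attach e b) (L.tripLabel e b) (L.tripLabel e (!b)) := by
  rcases e with x | w | v <;> cases b
  · exact placeLabels_northEnd x.2
  · simp only [plabicMinus]
    split_ifs with h
    · exact ⟨rfl, rfl⟩
    · have := placeLabels_diagonalEnd x.2
      rwa [← east_of_not_hasRight h] at this
  · exact ⟨rfl, rfl⟩
  · exact placeLabels_diagonalEnd w.2.1
  · exact ⟨rfl, rfl⟩
  · exact placeLabels_westEnd v.2.1

theorem tripLabel_of_attach {e : L.plabicMinus.E} {b : Bool} {v : L.White ⊕ L.Black} {p : Fin 3}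
    (h : L.plabicMinus.attach e b = Sum.inl (v, p)) :
    L.tripLabel e b = L.outLabel v p ∧ L.tripLabel e (!b) = L.inLabel v p := by
  have := placeLabels_attach e b
  rwa [h] at this

theorem tripLabel_of_attach_boundary {e : L.plabicMinus.E} {b : Bool} {i : Fin (k + m)}
    (h : L.plabicMinus.attach e b = Sum.inr i) :
    L.tripLabel e b = i ∧ L.perm (L.tripLabel e (!b)) = i := by
  have := placeLabels_attach e b
  rwa [h] at this

theorem tripLabel_of_onTrip {i : Fin (k + m)} {e : L.plabicMinus.E} {b : Bool}
    (h : L.plabicMinus.OnTrip i e b) : L.tripLabel e b = i := by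
  induction h with
  | start e b h => exact (tripLabel_of_attach_boundary h).1
  | turn e e' b b' v p _ h h' ih =>
    rw [(tripLabel_of_attach h').1, ← ih]
    have := (tripLabel_of_attach h).2
    rw [Bool.not_not] at this
    rw [this]
    exact outLabel_turn v p

/-- The last piece of the strand that leaves a `+` to the west is part of an edge. -/
theorem exists_edge_westEnd {b : Fin k × Fin m} (hb : b ∈ L.plus) :
    ∃ e : L.plabicMinus.E, L.plabicMinus.attach e true = L.westEnd b hb ∧
      ((e = Sum.inl ⟨b, hb⟩ ∧ ¬ L.HasRight b ∧ ¬ L.HasBelow b) ∨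
        (∃ h : L.HasRight b, e = Sum.inr (Sum.inl ⟨b, hb, h⟩) ∧ ¬ L.HasBelow b) ∨
        (∃ h : L.HasBelow b, e = Sum.inr (Sum.inr ⟨b, hb, h⟩))) := by
  by_cases h : L.HasBelow b
  · exact ⟨Sum.inr (Sum.inr ⟨b, hb, h⟩), rfl, Or.inr (Or.inr ⟨h, rfl⟩)⟩
  · have hd : L.diagonalEnd b hb = L.westEnd b hb := by rw [diagonalEnd, dif_neg h]
    by_cases h' : L.HasRight b
    · exact ⟨Sum.inr (Sum.inl ⟨b, hb, h'⟩), hd, Or.inr (Or.inl ⟨h', rfl, h⟩)⟩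
    · refine ⟨Sum.inl ⟨b, hb⟩, ?_, Or.inl ⟨rfl, h', h⟩⟩
      simp only [plabicMinus]
      rw [dif_neg h', hd]

/-- The diagonal of an elbow is part of an edge. -/
theorem exists_edge_diagonalEnd {b : Fin k × Fin m} (hb : b ∈ L.plus) :
    ∃ e : L.plabicMinus.E, L.plabicMinus.attach e true = L.diagonalEnd b hb ∧
      ((e = Sum.inl ⟨b, hb⟩ ∧ ¬ L.HasRight b) ∨
        ∃ h : L.HasRight b, e = Sum.inr (Sum.inl ⟨b, hb, h⟩)) := by
  by_cases h : L.HasRight b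
  · exact ⟨Sum.inr (Sum.inl ⟨b, hb, h⟩), rfl, Or.inr ⟨h, rfl⟩⟩
  · refine ⟨Sum.inl ⟨b, hb⟩, ?_, Or.inl ⟨rfl, h⟩⟩
    simp only [plabicMinus]
    rw [dif_neg h]

theorem onTrip_white {i : Fin (k + m)} {e e' : L.plabicMinus.E} {b b' : Bool} {w : L.White}
    {p : Fin 3} (hprev : L.plabicMinus.OnTrip i e b)
    (h : L.plabicMinus.attach e (!b) = Sum.inl (Sum.inl w, p))
    (h' : L.plabicMinus.attach e' b' = Sum.inl (Sum.inl w, p - 1)) :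
    L.plabicMinus.OnTrip i e' b' := by
  have hw : ¬ L.plabicMinus.black (Sum.inl w) := by simp [plabicMinus]
  exact PlabicData.OnTrip.turn e e' b b' (Sum.inl w) p hprev h (by rw [if_neg hw]; exact h')

theorem onTrip_black {i : Fin (k + m)} {e e' : L.plabicMinus.E} {b b' : Bool} {v : L.Black}
    {p : Fin 3} (hprev : L.plabicMinus.OnTrip i e b)
    (h : L.plabicMinus.attach e (!b) = Sum.inl (Sum.inr v, p))
    (h' : L.plabicMinus.attach e' b' = Sum.inl (Sum.inr v, p + 1)) :
    L.plabicMinus.OnTrip i e' b' := by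
  have hw : L.plabicMinus.black (Sum.inr v) := by simp [plabicMinus]
  exact PlabicData.OnTrip.turn e e' b b' (Sum.inr v) p hprev h (by rw [if_pos hw]; exact h')

theorem onTrip_start {e : L.plabicMinus.E} {b : Bool} {i : Fin (k + m)}
    (h : L.plabicMinus.attach e b = Sum.inr i) : L.plabicMinus.OnTrip (L.tripLabel e b) e b := by
  rw [(tripLabel_of_attach_boundary h).1]
  exact PlabicData.OnTrip.start e b h

theorem attach_north_white {b : Fin k × Fin m} (hb : b ∈ L.plus) (h : L.HasRight b) :
    L.plabicMinus.attach (Sum.inl ⟨b, hb⟩) true = Sum.inl (Sum.inl ⟨b, hb, h⟩, 1) := by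
  simp only [plabicMinus]
  rw [dif_pos h]

/-- Trips that go south or east. -/
theorem onTrip_south_east (N : ℕ) : ∀ b (hb : b ∈ L.plus), (b.1 : ℕ) + b.2 < N →
    L.plabicMinus.OnTrip (L.east b) (Sum.inl ⟨b, hb⟩) false ∧
    ∀ h : L.HasBelow b, L.plabicMinus.OnTrip (L.south b) (Sum.inr (Sum.inr ⟨b, hb, h⟩)) true := by
  induction N with
  | zero => intro b hb h; omega
  | succ N ih =>
    intro b hb hN
    constructor
    · rcases northEnd_cases hb with ⟨⟨v, hv, hv'⟩, h1, h2, h3, h4⟩ | ⟨h1, h2⟩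
      · have h5 : (v.1 : ℕ) < b.1 := h2
        have h6 : (v.2 : ℕ) = b.2 := by simp only at h1; rw [h1]
        have := (ih v hv (by omega)).2 hv'
        rw [← south_eq_east hb h1 h2 h3]
        exact onTrip_black this (p := 1) rfl h4
      · exact onTrip_start (e := Sum.inl ⟨b, hb⟩) (b := false) h2
    · intro h
      rcases westEnd_cases hb with ⟨⟨v, hv, hv'⟩, h1, h2, h3, h4⟩ | ⟨h1, h2⟩
      · have h5 : (v.2 : ℕ) < b.2 := h2
        have h6 : (v.1 : ℕ) = b.1 := by simp only at h1; rw [h1]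
        have := (ih v hv (by omega)).1
        rw [← east_eq_south hb h1 h2 h3]
        exact onTrip_white this (p := 1) (attach_north_white hv hv') h4
      · exact onTrip_start (e := Sum.inr (Sum.inr ⟨b, hb, h⟩)) (b := true) h2

/-- Trips that go from a white vertex to the southwest. -/
theorem onTrip_southwest (N : ℕ) : ∀ b (hb : b ∈ L.plus) (h : L.HasRight b), m < b.2 + N →
    L.plabicMinus.OnTrip (L.rowLabel b.1) (Sum.inr (Sum.inl ⟨b, hb, h⟩)) false := by
  induction N with
  | zero => intro b hb h hN; omega
  | succ N ih =>
    intro b hb h hN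
    obtain ⟨b₁, hb₁, h1, h2, h3⟩ := exists_westEnd_eq ⟨b, hb, h⟩
    have h2' : (b.2 : ℕ) < b₁.2 := h2
    have h1' : b.1 = b₁.1 := h1
    obtain ⟨e, he, hcases⟩ := exists_edge_westEnd hb₁
    rw [h3] at he
    suffices h : L.plabicMinus.OnTrip (L.rowLabel b.1) e false from onTrip_white h he rfl
    rw [h1']
    rcases hcases with ⟨rfl, h4, h5⟩ | ⟨h4, rfl, h5⟩ | ⟨h4, rfl⟩
    · rw [← east_of_not_hasRight h4]
      exact (onTrip_south_east _ b₁ hb₁ (Nat.lt_succ_self _)).1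
    · exact ih b₁ hb₁ h4 (by omega)
    · obtain ⟨e', he', hcases'⟩ := exists_edge_diagonalEnd hb₁
      have hd : L.diagonalEnd b₁ hb₁ = Sum.inl (Sum.inr ⟨b₁, hb₁, h4⟩, 0) := by
        rw [diagonalEnd, dif_pos h4]
      rw [hd] at he'
      suffices h : L.plabicMinus.OnTrip (L.rowLabel b₁.1) e' false from onTrip_black h he' rfl
      rcases hcases' with ⟨rfl, h5⟩ | ⟨h5, rfl⟩
      · rw [← east_of_not_hasRight h5]
        exact (onTrip_south_east _ b₁ hb₁ (Nat.lt_succ_self _)).1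
      · exact ih b₁ hb₁ h5 (by omega)

/-- Trips that go west from a black vertex. -/
theorem onTrip_west {b : Fin k × Fin m} (hb : b ∈ L.plus) (h : L.HasBelow b) :
    L.plabicMinus.OnTrip (L.rowLabel b.1) (Sum.inr (Sum.inr ⟨b, hb, h⟩)) false := by
  obtain ⟨e', he', hcases'⟩ := exists_edge_diagonalEnd hb
  have hd : L.diagonalEnd b hb = Sum.inl (Sum.inr ⟨b, hb, h⟩, 0) := by
    rw [diagonalEnd, dif_pos h]
  rw [hd] at he'
  suffices h : L.plabicMinus.OnTrip (L.rowLabel b.1) e' false from onTrip_black h he' rfl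
  rcases hcases' with ⟨rfl, h5⟩ | ⟨h5, rfl⟩
  · rw [← east_of_not_hasRight h5]
    exact (onTrip_south_east _ b hb (Nat.lt_succ_self _)).1
  · exact onTrip_southwest (m + 1) b hb h5 (by omega)

/-- Trips that go north. -/
theorem onTrip_north (N : ℕ) : ∀ b (hb : b ∈ L.plus), k < b.1 + N →
    L.plabicMinus.OnTrip (L.colLabel b.2) (Sum.inl ⟨b, hb⟩) true ∧
    ∀ h : L.HasRight b,
      L.plabicMinus.OnTrip (L.colLabel b.2) (Sum.inr (Sum.inl ⟨b, hb, h⟩)) true := by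
  induction N with
  | zero => intro b hb h; omega
  | succ N ih =>
    intro b hb hN
    have key : ∀ e : L.plabicMinus.E, L.plabicMinus.attach e true = L.diagonalEnd b hb →
        L.tripLabel e true = L.colLabel b.2 →
        L.plabicMinus.OnTrip (L.colLabel b.2) e true := by
      intro e he hl
      by_cases h : L.HasBelow b
      · have hd : L.diagonalEnd b hb = Sum.inl (Sum.inr ⟨b, hb, h⟩, 0) := by
          rw [diagonalEnd, dif_pos h]
        obtain ⟨b₁, hb₁, h1, h2, h3⟩ := exists_northEnd_eq ⟨b, hb, h⟩
        have h2' : (b.1 : ℕ) < b₁.1 := h2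
        have h1' : b.2 = b₁.2 := h1
        rw [hd] at he
        have := (ih b₁ hb₁ (by omega)).1
        rw [h1']
        exact onTrip_black this (p := 2) h3 he
      · have hd : L.diagonalEnd b hb = L.westEnd b hb := by rw [diagonalEnd, dif_neg h]
        rw [hd] at he
        rcases westEnd_cases hb with ⟨⟨w, hw, hw'⟩, h1, h2, h3, h4⟩ | ⟨h1, h2⟩
        · have h5 := (onTrip_south_east _ w hw (Nat.lt_succ_self _)).1
          have h6 : L.east w = L.colLabel b.2 := by
            rw [← south_of_not_hasBelow h]
            exact east_eq_south hb h1 h2 h3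
          rw [← h6]
          exact onTrip_white h5 (p := 1) (attach_north_white hw hw') (he.trans h4)
        · have := onTrip_start (he.trans h2)
          rwa [hl] at this
    have hdiag : ∀ h : L.HasRight b,
        L.plabicMinus.OnTrip (L.colLabel b.2) (Sum.inr (Sum.inl ⟨b, hb, h⟩)) true :=
      fun h => key _ rfl rfl
    refine ⟨?_, hdiag⟩
    by_cases h : L.HasRight b
    · exact onTrip_white (hdiag h) (p := 2) rfl (attach_north_white hb h)
    · refine key _ ?_ rfl
      simp only [plabicMinus]
      rw [dif_neg h]

theorem onTrip_tripLabel (e : L.plabicMinus.E) (b : Bool) :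
    L.plabicMinus.OnTrip (L.tripLabel e b) e b := by
  rcases e with x | w | v <;> cases b
  · exact (onTrip_south_east _ x.1 x.2 (Nat.lt_succ_self _)).1
  · exact (onTrip_north (k + 1) x.1 x.2 (by omega)).1
  · exact onTrip_southwest (m + 1) w.1 w.2.1 w.2.2 (by omega)
  · exact (onTrip_north (k + 1) w.1 w.2.1 (by omega)).2 w.2.2
  · exact onTrip_west v.2.1 v.2.2
  · exact (onTrip_south_east _ v.1 v.2.1 (Nat.lt_succ_self _)).2 v.2.2

theorem onTrip_iff {i : Fin (k + m)} {e : L.plabicMinus.E} {b : Bool} :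
    L.plabicMinus.OnTrip i e b ↔ L.tripLabel e b = i :=
  ⟨tripLabel_of_onTrip, fun h => h ▸ onTrip_tripLabel e b⟩

/-! ### The graph is a generalized plabic graph with trip permutation `π` -/

theorem exists_attach_westLabel (hL : L.Irreducible) (r : Fin k) :
    ∃ e : L.plabicMinus.E, L.plabicMinus.attach e true = Sum.inr (L.westLabel r) ∧
      L.tripLabel e false = L.rowLabel r := by
  obtain ⟨c₀, hc₀⟩ := hL.1 r
  have hne : (univ.filter fun c : Fin m => (r, c) ∈ L.plus).Nonempty := ⟨c₀, by simpa using hc₀⟩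
  have hmem := (mem_filter.1 (Finset.min'_mem _ hne)).2
  have hmin := fun d => Finset.min'_le (univ.filter fun c : Fin m => (r, c) ∈ L.plus) d
  set c := Finset.min' _ hne
  obtain ⟨e, he, hcases⟩ := exists_edge_westEnd hmem
  refine ⟨e, ?_, ?_⟩
  · rw [he]
    rcases westEnd_cases hmem with ⟨w, h1, h2, h3, h4⟩ | ⟨h1, h2⟩
    · have : (r, w.1.2) ∈ L.plus := by
        have := w.2.1
        rwa [← Prod.mk.eta (p := w.1), h1] at this
      exact absurd (hmin _ (mem_filter.2 ⟨mem_univ _, this⟩)) h2.not_ge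
    · exact h2
  · rcases hcases with ⟨rfl, h4, h5⟩ | ⟨h4, rfl, h5⟩ | ⟨h4, rfl⟩
    · exact east_of_not_hasRight h4
    · rfl
    · rfl

theorem exists_attach_northLabel (hL : L.Irreducible) (c : Fin m) :
    ∃ e : L.plabicMinus.E, L.plabicMinus.attach e false = Sum.inr (L.northLabel c) ∧
      L.tripLabel e true = L.colLabel c := by
  obtain ⟨c₀, hc₀⟩ := hL.2 c
  have hne : (univ.filter fun r : Fin k => (r, c) ∈ L.plus).Nonempty := ⟨c₀, by simpa using hc₀⟩
  have hmem := (mem_filter.1 (Finset.min'_mem _ hne)).2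
  have hmin := fun d => Finset.min'_le (univ.filter fun r : Fin k => (r, c) ∈ L.plus) d
  set r := Finset.min' _ hne
  refine ⟨Sum.inl ⟨(r, c), hmem⟩, ?_, rfl⟩
  rcases northEnd_cases hmem with ⟨w, h1, h2, h3, h4⟩ | ⟨h1, h2⟩
  · have : (w.1.1, c) ∈ L.plus := by
      have := w.2.1
      rwa [← Prod.mk.eta (p := w.1), h1] at this
    exact absurd (hmin _ (mem_filter.2 ⟨mem_univ _, this⟩)) h2.not_ge
  · exact h2

theorem isTripPermutation (hL : L.Irreducible) (hπ : Function.Bijective L.perm) :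
    L.plabicMinus.IsTripPermutation L.perm := by
  refine ⟨hπ, fun i j => ⟨?_, ?_⟩⟩
  · rintro ⟨e, b, h1, h2⟩
    have h3 := (tripLabel_of_attach_boundary h2).2
    rwa [Bool.not_not, tripLabel_of_onTrip h1] at h3
  · rintro rfl
    rcases L.exists_label i with ⟨r, rfl⟩ | ⟨c, rfl⟩
    · obtain ⟨e, h1, h2⟩ := exists_attach_westLabel hL r
      exact ⟨e, false, onTrip_iff.2 h2, by rw [L.perm_rowLabel]; exact h1⟩
    · obtain ⟨e, h1, h2⟩ := exists_attach_northLabel hL c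
      exact ⟨e, true, onTrip_iff.2 h2, by rw [L.perm_colLabel]; exact h1⟩

theorem westLabel_injective (hπ : Function.Bijective L.perm) : Function.Injective L.westLabel := by
  intro r r' h
  rw [← L.perm_rowLabel, ← L.perm_rowLabel] at h
  exact L.rowLabel_strictMono.injective (hπ.1 h)

theorem northLabel_injective (hπ : Function.Bijective L.perm) : Function.Injective L.northLabel := by
  intro r r' h
  rw [← L.perm_colLabel, ← L.perm_colLabel] at h
  exact L.colLabel_strictAnti.injective (hπ.1 h)

theorem westLabel_ne_northLabel (hπ : Function.Bijective L.perm) (r : Fin k) (c : Fin m) :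
    L.westLabel r ≠ L.northLabel c := by
  intro h
  rw [← L.perm_rowLabel, ← L.perm_colLabel] at h
  exact L.rowLabel_ne_colLabel r c (hπ.1 h)

theorem westEnd_inj (hπ : Function.Bijective L.perm) {b b' : Fin k × Fin m} (hb : b ∈ L.plus)
    (hb' : b' ∈ L.plus) (h : L.westEnd b hb = L.westEnd b' hb') : b = b' := by
  obtain ⟨r, c⟩ := b
  obtain ⟨r', c'⟩ := b'
  rcases westEnd_cases hb with ⟨w, h1, h2, h3, h4⟩ | ⟨h1, h2⟩ <;>
    rcases westEnd_cases hb' with ⟨w', h1', h2', h3', h4'⟩ | ⟨h1', h2'⟩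
  · obtain rfl : w = w' := by simpa [h, h4'] using h4.symm
    simp only at h1 h1' h2 h2' h3 h3'
    subst h1
    subst h1'
    rcases lt_trichotomy c c' with h | rfl | h
    · exact absurd hb (h3' c h2 h)
    · rfl
    · exact absurd hb' (h3 c' h2' h)
  · rw [h4, h2'] at h; simp at h
  · rw [h2, h4'] at h; simp at h
  · rw [h2, h2'] at h
    simp only at h1 h1'
    obtain rfl : r = r' := westLabel_injective hπ (Sum.inr_injective h)
    rcases lt_trichotomy c c' with h | rfl | h
    · exact absurd hb (h1' c h)
    · rfl
    · exact absurd hb' (h1 c' h)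

theorem northEnd_inj (hπ : Function.Bijective L.perm) {b b' : Fin k × Fin m} (hb : b ∈ L.plus)
    (hb' : b' ∈ L.plus) (h : L.northEnd b hb = L.northEnd b' hb') : b = b' := by
  obtain ⟨r, c⟩ := b
  obtain ⟨r', c'⟩ := b'
  rcases northEnd_cases hb with ⟨w, h1, h2, h3, h4⟩ | ⟨h1, h2⟩ <;>
    rcases northEnd_cases hb' with ⟨w', h1', h2', h3', h4'⟩ | ⟨h1', h2'⟩
  · obtain rfl : w = w' := by simpa [h, h4'] using h4.symm
    simp only at h1 h1' h2 h2' h3 h3'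
    subst h1
    subst h1'
    rcases lt_trichotomy r r' with h | rfl | h
    · exact absurd hb (h3' r h2 h)
    · rfl
    · exact absurd hb' (h3 r' h2' h)
  · rw [h4, h2'] at h; simp at h
  · rw [h2, h4'] at h; simp at h
  · rw [h2, h2'] at h
    simp only at h1 h1'
    obtain rfl : c = c' := northLabel_injective hπ (Sum.inr_injective h)
    rcases lt_trichotomy r r' with h | rfl | h
    · exact absurd hb (h1' r h)
    · rfl
    · exact absurd hb' (h1 r' h)

/-- The ends of edges: strands to the north, the fixed half-edges, diagonals, and strands to the west. -/
theorem attach_cases (e : L.plabicMinus.E) (s : Bool) :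
    (∃ b hb, e = Sum.inl ⟨b, hb⟩ ∧ s = false ∧ L.plabicMinus.attach e s = L.northEnd b hb) ∨
    (∃ w : L.White, e = Sum.inl ⟨w.1, w.2.1⟩ ∧ s = true ∧
      L.plabicMinus.attach e s = Sum.inl (Sum.inl w, 1)) ∨
    (∃ w : L.White, e = Sum.inr (Sum.inl w) ∧ s = false ∧
      L.plabicMinus.attach e s = Sum.inl (Sum.inl w, 2)) ∨
    (∃ v : L.Black, e = Sum.inr (Sum.inr v) ∧ s = false ∧
      L.plabicMinus.attach e s = Sum.inl (Sum.inr v, 1)) ∨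
    (∃ v : L.Black, ((e = Sum.inl ⟨v.1, v.2.1⟩ ∧ ¬ L.HasRight v.1) ∨
        ∃ h : L.HasRight v.1, e = Sum.inr (Sum.inl ⟨v.1, v.2.1, h⟩)) ∧ s = true ∧
      L.plabicMinus.attach e s = Sum.inl (Sum.inr v, 0)) ∨
    (∃ b hb, ((e = Sum.inl ⟨b, hb⟩ ∧ ¬ L.HasRight b ∧ ¬ L.HasBelow b) ∨
        (∃ h : L.HasRight b, e = Sum.inr (Sum.inl ⟨b, hb, h⟩) ∧ ¬ L.HasBelow b) ∨
        (∃ h : L.HasBelow b, e = Sum.inr (Sum.inr ⟨b, hb, h⟩))) ∧ s = true ∧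
      L.plabicMinus.attach e s = L.westEnd b hb) := by
  have key : ∀ b (hb : b ∈ L.plus) (e : L.plabicMinus.E),
      L.plabicMinus.attach e true = L.diagonalEnd b hb →
      ((e = Sum.inl ⟨b, hb⟩ ∧ ¬ L.HasRight b) ∨
        ∃ h : L.HasRight b, e = Sum.inr (Sum.inl ⟨b, hb, h⟩)) →
      (∃ v : L.Black, ((e = Sum.inl ⟨v.1, v.2.1⟩ ∧ ¬ L.HasRight v.1) ∨
          ∃ h : L.HasRight v.1, e = Sum.inr (Sum.inl ⟨v.1, v.2.1, h⟩)) ∧ true = true ∧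
        L.plabicMinus.attach e true = Sum.inl (Sum.inr v, 0)) ∨
      (∃ b hb, ((e = Sum.inl ⟨b, hb⟩ ∧ ¬ L.HasRight b ∧ ¬ L.HasBelow b) ∨
          (∃ h : L.HasRight b, e = Sum.inr (Sum.inl ⟨b, hb, h⟩) ∧ ¬ L.HasBelow b) ∨
          (∃ h : L.HasBelow b, e = Sum.inr (Sum.inr ⟨b, hb, h⟩))) ∧ true = true ∧
        L.plabicMinus.attach e true = L.westEnd b hb) := by
    intro b hb e h hc
    by_cases hB : L.HasBelow b
    · exact Or.inl ⟨⟨b, hb, hB⟩, hc, rfl, by rw [h, diagonalEnd, dif_pos hB]⟩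
    · refine Or.inr ⟨b, hb, ?_, rfl, by rw [h, diagonalEnd, dif_neg hB]⟩
      rcases hc with ⟨h1, h2⟩ | ⟨h1, h2⟩
      · exact Or.inl ⟨h1, h2, hB⟩
      · exact Or.inr (Or.inl ⟨h1, h2, hB⟩)
  rcases e with ⟨b, hb⟩ | w | v <;> cases s
  · exact Or.inl ⟨b, hb, rfl, rfl, rfl⟩
  · by_cases h : L.HasRight b
    · exact Or.inr (Or.inl ⟨⟨b, hb, h⟩, rfl, rfl, attach_north_white hb h⟩)
    · refine Or.inr (Or.inr (Or.inr (Or.inr (key b hb _ ?_ (Or.inl ⟨rfl, h⟩)))))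
      simp only [plabicMinus]
      rw [dif_neg h]
  · exact Or.inr (Or.inr (Or.inl ⟨w, rfl, rfl, rfl⟩))
  · exact Or.inr (Or.inr (Or.inr (Or.inr (key w.1 w.2.1 _ rfl (Or.inr ⟨w.2.2, rfl⟩)))))
  · exact Or.inr (Or.inr (Or.inr (Or.inl ⟨v, rfl, rfl, rfl⟩)))
  · exact Or.inr (Or.inr (Or.inr (Or.inr (Or.inr ⟨v.1, v.2.1, Or.inr (Or.inr ⟨v.2.2, rfl⟩), rfl, rfl⟩))))

end LeDiagram

namespace LeDiagram

variable {k m : ℕ} {L : LeDiagram k m}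

open Classical in
/-- A number that tells apart the different kinds of half-edges; places on the west and north border are
counted with the half-edges at which strands to the west and to the north arrive. -/
def placeKind (L : LeDiagram k m) (P : L.EndPlace) : ℕ :=
  match P with
  | Sum.inl (Sum.inl _, p) => p
  | Sum.inl (Sum.inr _, p) => 3 + p
  | Sum.inr i => if ∃ r, L.westLabel r = i then 0 else 5

theorem placeKind_westEnd {b : Fin k × Fin m} (hb : b ∈ L.plus) :
    L.placeKind (L.westEnd b hb) = 0 := by
  rcases westEnd_cases hb with ⟨w, h1, h2, h3, h4⟩ | ⟨h1, h2⟩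
  · rw [h4]; rfl
  · rw [h2]; exact if_pos ⟨_, rfl⟩

theorem placeKind_northEnd (hπ : Function.Bijective L.perm) {b : Fin k × Fin m} (hb : b ∈ L.plus) :
    L.placeKind (L.northEnd b hb) = 5 := by
  rcases northEnd_cases hb with ⟨w, h1, h2, h3, h4⟩ | ⟨h1, h2⟩
  · rw [h4]; rfl
  · rw [h2]; exact if_neg fun ⟨r, hr⟩ => westLabel_ne_northLabel hπ r _ hr

theorem place_inj {v v' : L.White ⊕ L.Black} {p p' : Fin 3}
    (h : (Sum.inl (v, p) : L.EndPlace) = Sum.inl (v', p')) : v = v' ∧ p = p' :=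
  Prod.ext_iff.1 (Sum.inl.inj h)

theorem attach_injective (hπ : Function.Bijective L.perm) :
    Function.Injective fun x : L.plabicMinus.E × Bool => L.plabicMinus.attach x.1 x.2 := by
  rintro ⟨e, s⟩ ⟨e', s'⟩ h
  simp only at h
  have hk := congrArg L.placeKind h
  rcases attach_cases e s with ⟨b, hb, h1, h2, h3⟩ | ⟨w, h1, h2, h3⟩ | ⟨w, h1, h2, h3⟩ |
    ⟨v, h1, h2, h3⟩ | ⟨v, h1, h2, h3⟩ | ⟨b, hb, h1, h2, h3⟩ <;>
  rcases attach_cases e' s' with ⟨b', hb', h1', h2', h3'⟩ | ⟨w', h1', h2', h3'⟩ |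
    ⟨w', h1', h2', h3'⟩ | ⟨v', h1', h2', h3'⟩ | ⟨v', h1', h2', h3'⟩ | ⟨b', hb', h1', h2', h3'⟩ <;>
  rw [h3, h3'] at h hk <;>
  (try rw [placeKind_westEnd] at hk) <;> (try rw [placeKind_northEnd hπ] at hk) <;>
  first
  | (exfalso; revert hk; simp [placeKind]; done)
  | skip
  · obtain rfl := northEnd_inj hπ hb hb' h
    rw [h1, h2, h1', h2']
  · obtain rfl : w = w' := Sum.inl.inj (place_inj h).1
    rw [h1, h2, h1', h2']
  · obtain rfl : w = w' := Sum.inl.inj (place_inj h).1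
    rw [h1, h2, h1', h2']
  · obtain rfl : v = v' := Sum.inr.inj (place_inj h).1
    rw [h1, h2, h1', h2']
  · obtain rfl : v = v' := Sum.inr.inj (place_inj h).1
    rw [h2, h2']
    rcases h1 with ⟨h1, h4⟩ | ⟨h4, h1⟩ <;> rcases h1' with ⟨h1', h4'⟩ | ⟨h4', h1'⟩
    · rw [h1, h1']
    · exact absurd h4' h4
    · exact absurd h4 h4'
    · rw [h1, h1']
  · obtain rfl := westEnd_inj hπ hb hb' h
    rw [h2, h2']
    rcases h1 with ⟨h1, h4, h5⟩ | ⟨h4, h1, h5⟩ | ⟨h4, h1⟩ <;>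
      rcases h1' with ⟨h1', h4', h5'⟩ | ⟨h4', h1', h5'⟩ | ⟨h4', h1'⟩
    · rw [h1, h1']
    · exact absurd h4' h4
    · exact absurd h4' h5
    · exact absurd h4 h4'
    · rw [h1, h1']
    · exact absurd h4' h5
    · exact absurd h4 h5'
    · exact absurd h4 h5'
    · rw [h1, h1']

theorem exists_attach (hL : L.Irreducible) (hπ : Function.Bijective L.perm) (P : L.EndPlace) :
    ∃ e b, L.plabicMinus.attach e b = P := by
  rcases P with ⟨w | v, p⟩ | i
  · fin_cases p
    · obtain ⟨b, hb, -, -, h⟩ := exists_westEnd_eq w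
      obtain ⟨e, he, -⟩ := exists_edge_westEnd hb
      exact ⟨e, true, he.trans h⟩
    · exact ⟨_, _, attach_north_white w.2.1 w.2.2⟩
    · exact ⟨Sum.inr (Sum.inl w), false, rfl⟩
  · fin_cases p
    · obtain ⟨e, he, -⟩ := exists_edge_diagonalEnd v.2.1
      exact ⟨e, true, by rw [he, diagonalEnd, dif_pos v.2.2]; rfl⟩
    · exact ⟨Sum.inr (Sum.inr v), false, rfl⟩
    · obtain ⟨b, hb, -, -, h⟩ := exists_northEnd_eq v
      exact ⟨Sum.inl ⟨b, hb⟩, false, h⟩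
  · obtain ⟨j, rfl⟩ := hπ.2 i
    rcases L.exists_label j with ⟨r, rfl⟩ | ⟨c, rfl⟩
    · obtain ⟨e, h1, -⟩ := exists_attach_westLabel hL r
      exact ⟨e, true, by rw [L.perm_rowLabel]; exact h1⟩
    · obtain ⟨e, h1, -⟩ := exists_attach_northLabel hL c
      exact ⟨e, false, by rw [L.perm_colLabel]; exact h1⟩

theorem isGeneralizedPlabic (hL : L.Irreducible) (hπ : Function.Bijective L.perm) :
    L.plabicMinus.IsGeneralizedPlabic := by
  refine ⟨?_, ?_, attach_injective hπ, fun P => ?_⟩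
  · change Finite (L.White ⊕ L.Black)
    infer_instance
  · change Finite ({b : Fin k × Fin m // b ∈ L.plus} ⊕ (L.White ⊕ L.Black))
    infer_instance
  · obtain ⟨e, b, h⟩ := exists_attach hL hπ P
    exact ⟨(e, b), h⟩

/-! ### Types of edges and vertices -/

theorem tripLabel_lt (e : L.plabicMinus.E) : L.tripLabel e false < L.tripLabel e true := by
  rcases e with x | w | v
  · exact east_lt_colLabel x.2
  · exact L.rowLabel_lt_colLabel (L.plus_subset _ w.2.1)
  · exact rowLabel_lt_south v.2.1

theorem hasLabel_iff {e : L.plabicMinus.E} {i : Fin (k + m)} :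
    L.plabicMinus.HasLabel e i ↔ i = L.tripLabel e false ∨ i = L.tripLabel e true := by
  simp [PlabicData.HasLabel, onTrip_iff, eq_comm]

theorem hasType_tripLabel (e : L.plabicMinus.E) :
    L.plabicMinus.HasType e (L.tripLabel e false) (L.tripLabel e true) :=
  ⟨tripLabel_lt e, fun _ => hasLabel_iff⟩

theorem hasType_iff {e : L.plabicMinus.E} {i j : Fin (k + m)} :
    L.plabicMinus.HasType e i j ↔ i = L.tripLabel e false ∧ j = L.tripLabel e true := by
  constructor
  · rintro ⟨h1, h2⟩
    have h3 := tripLabel_lt e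
    have h4 := hasLabel_iff.1 ((h2 i).2 (Or.inl rfl))
    have h5 := hasLabel_iff.1 ((h2 j).2 (Or.inr rfl))
    rcases h4 with h4 | h4 <;> rcases h5 with h5 | h5
    · rw [h4, h5] at h1; exact absurd h1 (lt_irrefl _)
    · exact ⟨h4, h5⟩
    · rw [h4, h5] at h1; exact absurd h1 h3.not_gt
    · rw [h4, h5] at h1; exact absurd h1 (lt_irrefl _)
  · rintro ⟨rfl, rfl⟩
    exact hasType_tripLabel e

/-- The middle one of the three labels at a vertex. -/
def midLabel (L : LeDiagram k m) (v : L.White ⊕ L.Black) : Fin (k + m) :=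
  match v with
  | Sum.inl w => L.east w.1
  | Sum.inr v => L.south v.1

/-- The box of a vertex. -/
def vertexBox (L : LeDiagram k m) (v : L.White ⊕ L.Black) : Fin k × Fin m :=
  match v with
  | Sum.inl w => w.1
  | Sum.inr v => v.1

theorem rowLabel_lt_midLabel (v : L.White ⊕ L.Black) :
    L.rowLabel (L.vertexBox v).1 < L.midLabel v := by
  rcases v with w | v
  · exact rowLabel_lt_east w
  · exact rowLabel_lt_south v.2.1

theorem midLabel_lt_colLabel (v : L.White ⊕ L.Black) :
    L.midLabel v < L.colLabel (L.vertexBox v).2 := by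
  rcases v with w | v
  · exact east_lt_colLabel w.2.1
  · exact south_lt_colLabel v

theorem halfEdgeHasType (hL : L.Irreducible) (hπ : Function.Bijective L.perm)
    {v : L.White ⊕ L.Black} {p : Fin 3} {i j : Fin (k + m)} (hij : i < j)
    (h : (L.outLabel v p = i ∧ L.inLabel v p = j) ∨ (L.outLabel v p = j ∧ L.inLabel v p = i)) :
    L.plabicMinus.HalfEdgeHasType v p i j := by
  obtain ⟨e, b, he⟩ := exists_attach hL hπ (Sum.inl (v, p))
  refine ⟨e, b, he, hij, fun x => ?_⟩
  obtain ⟨h1, h2⟩ := tripLabel_of_attach he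
  rw [hasLabel_iff]
  rw [← h1, ← h2] at h
  cases b
  · rcases h with ⟨h3, h4⟩ | ⟨h3, h4⟩
    · rw [← h3, ← h4]; rfl
    · rw [← h3, ← h4]; exact or_comm
  · rcases h with ⟨h3, h4⟩ | ⟨h3, h4⟩
    · rw [← h3, ← h4]; exact or_comm
    · rw [← h3, ← h4]; rfl

theorem vertexHasType (hL : L.Irreducible) (hπ : Function.Bijective L.perm)
    (v : L.White ⊕ L.Black) : L.plabicMinus.VertexHasType v (L.rowLabel (L.vertexBox v).1)
      (L.midLabel v) (L.colLabel (L.vertexBox v).2) := by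
  have h1 := rowLabel_lt_midLabel v
  have h2 := midLabel_lt_colLabel v
  rcases v with w | v
  · exact ⟨0, halfEdgeHasType hL hπ h1 (Or.inr ⟨rfl, rfl⟩), halfEdgeHasType hL hπ h2 (Or.inr ⟨rfl, rfl⟩),
      halfEdgeHasType hL hπ (h1.trans h2) (Or.inl ⟨rfl, rfl⟩)⟩
  · exact ⟨1, halfEdgeHasType hL hπ h1 (Or.inl ⟨rfl, rfl⟩), halfEdgeHasType hL hπ h2 (Or.inl ⟨rfl, rfl⟩),
      halfEdgeHasType hL hπ (h1.trans h2) (Or.inr ⟨rfl, rfl⟩)⟩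

/-- The one of the three labels at a vertex that is not a label of the half-edge `p`. -/
def thirdLabel (L : LeDiagram k m) (v : L.White ⊕ L.Black) (p : Fin 3) : Fin (k + m) :=
  match v, p with
  | Sum.inl w, 0 => L.colLabel w.1.2
  | Sum.inl w, 1 => L.rowLabel w.1.1
  | Sum.inl w, 2 => L.east w.1
  | Sum.inr v, 0 => L.south v.1
  | Sum.inr v, 1 => L.colLabel v.1.2
  | Sum.inr v, 2 => L.rowLabel v.1.1

/-- The half-edges at which edges arrive with their end `true`. -/
theorem attach_true_iff (e : L.plabicMinus.E) (s : Bool) {v : L.White ⊕ L.Black} {p : Fin 3}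
    (h : L.plabicMinus.attach e s = Sum.inl (v, p)) :
    s = true ↔ ((L.plabicMinus.black v) ↔ p = if v.isRight then 0 else 2) := by
  rcases attach_cases e s with ⟨b, hb, h1, h2, h3⟩ | ⟨w, h1, h2, h3⟩ | ⟨w, h1, h2, h3⟩ |
    ⟨v, h1, h2, h3⟩ | ⟨v, h1, h2, h3⟩ | ⟨b, hb, h1, h2, h3⟩
  · rcases northEnd_cases hb with ⟨w, -, -, -, h4⟩ | ⟨-, h4⟩
    · rw [h, h4] at h3
      obtain ⟨rfl, rfl⟩ : v = Sum.inr w ∧ p = 2 := place_inj h3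
      simp [h2, plabicMinus]
    · rw [h, h4] at h3; simp at h3
  · rw [h] at h3
    obtain ⟨rfl, rfl⟩ : v = Sum.inl w ∧ p = 1 := place_inj h3
    simp [h2, plabicMinus]
  · rw [h] at h3
    obtain ⟨rfl, rfl⟩ : v = Sum.inl w ∧ p = 2 := place_inj h3
    simp [h2, plabicMinus]
  · rename_i v'
    rw [h] at h3
    obtain ⟨rfl, rfl⟩ : v' = Sum.inr v ∧ p = 1 := place_inj h3
    simp [h2, plabicMinus]
  · rename_i v'
    rw [h] at h3
    obtain ⟨rfl, rfl⟩ : v' = Sum.inr v ∧ p = 0 := place_inj h3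
    simp [h2, plabicMinus]
  · rcases westEnd_cases hb with ⟨w, -, -, -, h4⟩ | ⟨-, h4⟩
    · rw [h, h4] at h3
      obtain ⟨rfl, rfl⟩ : v = Sum.inl w ∧ p = 0 := place_inj h3
      simp [h2, plabicMinus]
    · rw [h, h4] at h3; simp at h3

theorem top_iff_of_attach (hπ : Function.Bijective L.perm) {e : L.plabicMinus.E} {s : Bool}
    {i : Fin (k + m)} (h : L.plabicMinus.attach e s = Sum.inr i) :
    L.plabicMinus.top i ↔ s = true := by
  rcases attach_cases e s with ⟨b, hb, h1, h2, h3⟩ | ⟨w, h1, h2, h3⟩ | ⟨w, h1, h2, h3⟩ |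
    ⟨v, h1, h2, h3⟩ | ⟨v, h1, h2, h3⟩ | ⟨b, hb, h1, h2, h3⟩
  · rcases northEnd_cases hb with ⟨w, -, -, -, h4⟩ | ⟨-, h4⟩
    · rw [h, h4] at h3; simp at h3
    · rw [h, h4] at h3
      obtain rfl := Sum.inr.inj h3
      simp only [h2, Bool.false_eq_true, iff_false]
      rintro ⟨r, hr⟩
      exact westLabel_ne_northLabel hπ r _ hr
  · rw [h] at h3; simp at h3
  · rw [h] at h3; simp at h3
  · rw [h] at h3; simp at h3
  · rw [h] at h3; simp at h3
  · rcases westEnd_cases hb with ⟨w, -, -, -, h4⟩ | ⟨-, h4⟩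
    · rw [h, h4] at h3; simp at h3
    · rw [h, h4] at h3
      obtain rfl := Sum.inr.inj h3
      simp only [h2, iff_true]
      exact ⟨_, rfl⟩

end LeDiagram

/-! ### Generic parameters and the lines `φᵢ = φⱼ` -/

section Lines

variable {n : ℕ} {κ : Fin n → ℝ}

theorem GenericParameters.eq_of_sum_eq (hκ : GenericParameters κ) {I J : Finset (Fin n)}
    (hc : I.card = J.card) (hs : ∑ i ∈ I, κ i = ∑ i ∈ J, κ i) : I = J := by
  rcases Nat.lt_or_ge 1 I.card with h1 | h1
  · rcases Nat.lt_or_ge I.card n with h2 | h2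
    · exact hκ.2 I J h1 h2 hc hs
    · have hI : I = univ := (Finset.card_eq_iff_eq_univ I).1
        (le_antisymm (Finset.card_le_univ I) (by simpa using h2))
      have hJ : J = univ := (Finset.card_eq_iff_eq_univ J).1
        (le_antisymm (Finset.card_le_univ J) (by rw [← hc]; simpa using h2))
      rw [hI, hJ]
  · rcases Nat.lt_or_ge 0 I.card with h2 | h2
    · obtain ⟨a, rfl⟩ := Finset.card_eq_one.1 (le_antisymm h1 h2)
      obtain ⟨b, rfl⟩ := Finset.card_eq_one.1 (hc.symm.trans (Finset.card_singleton a))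
      rw [Finset.sum_singleton, Finset.sum_singleton] at hs
      rw [hκ.1.injective hs]
    · have hI := Finset.card_eq_zero.1 (le_antisymm h2 (Nat.zero_le _))
      have hJ := Finset.card_eq_zero.1 (le_antisymm (hc ▸ h2) (Nat.zero_le _))
      rw [hI, hJ]

theorem GenericParameters.pair_eq (hκ : GenericParameters κ) {i j s t : Fin n} (hij : i ≠ j)
    (hst : s ≠ t) (h : κ s + κ t = κ i + κ j) : (s = i ∧ t = j) ∨ (s = j ∧ t = i) := by
  have h1 : ({s, t} : Finset (Fin n)) = {i, j} :=
    hκ.eq_of_sum_eq (by rw [Finset.card_pair hij, Finset.card_pair hst])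
      (by rw [Finset.sum_pair hij, Finset.sum_pair hst, h])
  have hs : s ∈ ({i, j} : Finset (Fin n)) := h1 ▸ by simp
  have ht : t ∈ ({i, j} : Finset (Fin n)) := h1 ▸ by simp
  rw [Finset.mem_insert, Finset.mem_singleton] at hs ht
  rcases hs with rfl | rfl <;> rcases ht with rfl | rfl
  · exact absurd rfl hst
  · exact Or.inl ⟨rfl, rfl⟩
  · exact Or.inr ⟨rfl, rfl⟩
  · exact absurd rfl hst

theorem GenericParameters.triple_eq (hκ : GenericParameters κ) {i l m i' l' m' : Fin n}
    (h1 : i < l) (h2 : l < m) (h1' : i' < l') (h2' : l' < m')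
    (h : κ i + κ l + κ m = κ i' + κ l' + κ m') : i = i' ∧ l = l' ∧ m = m' := by
  have hsum : ∀ {i l m : Fin n}, i < l → l < m → ∑ s ∈ ({i, l, m} : Finset (Fin n)), κ s = κ i + κ l + κ m := by
    intro i l m h1 h2
    rw [Finset.sum_insert (by simp [h1.ne, (h1.trans h2).ne]), Finset.sum_pair h2.ne, add_assoc]
  have hcard : ∀ {i l m : Fin n}, i < l → l < m → ({i, l, m} : Finset (Fin n)).card = 3 := by
    intro i l m h1 h2
    rw [Finset.card_insert_of_notMem (by simp [h1.ne, (h1.trans h2).ne]), Finset.card_pair h2.ne]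
  have he : ({i, l, m} : Finset (Fin n)) = {i', l', m'} :=
    hκ.eq_of_sum_eq (by rw [hcard h1 h2, hcard h1' h2']) (by rw [hsum h1 h2, hsum h1' h2', h])
  have hm : ∀ x, x ∈ ({i, l, m} : Finset (Fin n)) ↔ x ∈ ({i', l', m'} : Finset (Fin n)) := by
    rw [he]; exact fun _ => Iff.rfl
  simp only [Finset.mem_insert, Finset.mem_singleton] at hm
  have a1 := (hm i).1 (by simp)
  have a2 := (hm l).1 (by simp)
  have a3 := (hm m).1 (by simp)
  have b1 := (hm i').2 (by simp)
  have b2 := (hm l').2 (by simp)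
  have b3 := (hm m').2 (by simp)
  simp only [Fin.ext_iff, Fin.lt_def] at *
  omega

/-- The point of the line `φᵢ = φⱼ` at which the cubic `s ↦ s³ + ȳ s² + x̄ s - φᵢ`, which vanishes at `κᵢ`
and `κⱼ`, has the third root `τ`. -/
def linePoint (κ : Fin n → ℝ) (i j : Fin n) (τ : ℝ) : ℝ × ℝ :=
  (κ i * κ j + (κ i + κ j) * τ, -(κ i + κ j + τ))

theorem phase_linePoint (κ : Fin n → ℝ) (i j s : Fin n) (τ : ℝ) :
    phase κ s (linePoint κ i j τ) =
      phase κ i (linePoint κ i j τ) + (κ s - κ i) * (κ s - κ j) * (κ s - τ) := by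
  simp only [phase, linePoint]
  ring

theorem phase_linePoint_eq (κ : Fin n → ℝ) (i j : Fin n) (τ : ℝ) :
    phase κ j (linePoint κ i j τ) = phase κ i (linePoint κ i j τ) := by
  rw [phase_linePoint]; ring

theorem linePoint_injective (κ : Fin n → ℝ) (i j : Fin n) : Function.Injective (linePoint κ i j) := by
  intro τ τ' h
  have := congrArg Prod.snd h
  simp only [linePoint] at this
  linarith

theorem exists_linePoint (hκ : StrictMono κ) {i j : Fin n} (hij : i < j) {p : ℝ × ℝ}
    (h : phase κ i p = phase κ j p) : ∃ τ, linePoint κ i j τ = p := by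
  refine ⟨-(κ i + κ j + p.2), ?_⟩
  have h1 := hκ hij
  have h2 : (κ j - κ i) * (p.1 + (κ i + κ j) * p.2 + (κ i ^ 2 + κ i * κ j + κ j ^ 2)) = 0 := by
    simp only [phase] at h
    linear_combination -h
  have h3 := (mul_eq_zero.1 h2).resolve_left (sub_ne_zero.2 h1.ne')
  ext
  · simp only [linePoint]
    linear_combination -h3
  · simp only [linePoint]
    ring

/-- Two lines `φᵢ = φⱼ` with different labels meet in at most one point. -/
theorem linePoint_eq_of_sum_ne {i j s t : Fin n} (h : κ i + κ j ≠ κ s + κ t) {p q : ℝ × ℝ}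
    (hp : p ∈ Set.range (linePoint κ i j)) (hp' : p ∈ Set.range (linePoint κ s t))
    (hq : q ∈ Set.range (linePoint κ i j)) (hq' : q ∈ Set.range (linePoint κ s t)) : p = q := by
  have key : ∀ {i j : Fin n} {p : ℝ × ℝ}, p ∈ Set.range (linePoint κ i j) →
      p.1 + (κ i + κ j) * p.2 = -(κ i ^ 2 + κ i * κ j + κ j ^ 2) := by
    rintro i j p ⟨τ, rfl⟩
    simp only [linePoint]
    ring
  have h1 := key hp
  have h2 := key hp'
  have h3 := key hq
  have h4 := key hq'
  have h5 : (κ i + κ j - (κ s + κ t)) * (p.2 - q.2) = 0 := by linear_combination h1 - h2 - h3 + h4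
  have h6 : p.2 = q.2 := sub_eq_zero.1 ((mul_eq_zero.1 h5).resolve_left (sub_ne_zero.2 h))
  have h7 : p.1 = q.1 := by rw [h6] at h1; linarith
  exact Prod.ext h7 h6

/-- On the line `φᵢ = φⱼ`, there are only finitely many points where another pair of phases agrees or where
the third root is one of the parameters. -/
theorem finite_nongeneric (hκ : GenericParameters κ) {i j : Fin n} (hij : i < j) :
    {τ : ℝ | (∃ s, κ s = τ) ∨ ∃ s t, s ≠ t ∧ ¬ ((s = i ∧ t = j) ∨ (s = j ∧ t = i)) ∧
      phase κ s (linePoint κ i j τ) = phase κ t (linePoint κ i j τ)}.Finite := by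
  have h1 : (Set.range κ).Finite := Set.finite_range κ
  have h2 : (⋃ st : Fin n × Fin n, {τ : ℝ | st.1 ≠ st.2 ∧
      ¬ ((st.1 = i ∧ st.2 = j) ∨ (st.1 = j ∧ st.2 = i)) ∧
      phase κ st.1 (linePoint κ i j τ) = phase κ st.2 (linePoint κ i j τ)}).Finite := by
    refine Set.finite_iUnion fun ⟨s, t⟩ => Set.Subsingleton.finite ?_
    rintro τ ⟨hst, hne, h3⟩ τ' ⟨-, -, h4⟩
    simp only at hst hne h3 h4
    have h5 : κ s + κ t - (κ i + κ j) ≠ 0 := fun h =>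
      hne (hκ.pair_eq hij.ne hst (sub_eq_zero.1 h))
    have h6 : κ s - κ t ≠ 0 := sub_ne_zero.2 fun h => hst (hκ.1.injective h)
    rw [phase_linePoint, phase_linePoint κ i j t] at h3 h4
    have h7 : (κ s - κ t) * (κ s + κ t - (κ i + κ j)) * (τ - τ') = 0 := by
      linear_combination h4 - h3
    exact sub_eq_zero.1 ((mul_eq_zero.1 h7).resolve_left (mul_ne_zero h6 h5))
  refine (h1.union h2).subset ?_
  rintro τ (⟨s, hs⟩ | ⟨s, t, h⟩)
  · exact Or.inl ⟨s, hs⟩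
  · exact Or.inr (Set.mem_iUnion.2 ⟨(s, t), h⟩)

/-- The sets between the strict and the weak sublevel set of the phases on the line `φᵢ = φⱼ` are unions of an
initial interval and one more interval; the shape depends on the position of the third root. -/
theorem sublevel_eq_initialUnion (hκ : StrictMono κ) {i j : Fin n} (hij : i < j) {τ : ℝ}
    {S : Set (Fin n)}
    (h1 : ∀ s, phase κ s (linePoint κ i j τ) < phase κ i (linePoint κ i j τ) → s ∈ S)
    (h2 : ∀ s ∈ S, phase κ s (linePoint κ i j τ) ≤ phase κ i (linePoint κ i j τ))
    (hi : i ∉ S) (hj : j ∉ S) :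
    ∃ x : ℕ, x ≤ n ∧ (∀ s : Fin n, (s : ℕ) < x → κ s ≤ τ) ∧ (∀ s : Fin n, x ≤ s → τ ≤ κ s) ∧
      ((κ j ≤ τ ∧ (j : ℕ) < x ∧ S = initialUnion n i (j + 1) x) ∨
        (κ i ≤ τ ∧ τ ≤ κ j ∧ (i : ℕ) < x ∧ x ≤ j ∧ S = initialUnion n i x j) ∨
        (τ ≤ κ i ∧ x ≤ i ∧ S = initialUnion n x (i + 1) j)) := by
  have hκij := hκ hij
  have hin : ∀ s, (κ s - κ i) * (κ s - κ j) * (κ s - τ) < 0 → s ∈ S := fun s hs =>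
    h1 s (by rw [phase_linePoint]; linarith)
  have hout : ∀ s, 0 < (κ s - κ i) * (κ s - κ j) * (κ s - τ) → s ∉ S := fun s hs hS => by
    have := h2 s hS
    rw [phase_linePoint] at this
    linarith
  rcases le_total (κ j) τ with hjτ | hjτ
  · obtain ⟨x, hx, hxs⟩ := exists_initial_segment (p := fun s => s ≤ j ∨ s ∈ S) (by
      rintro c c' hcc' (h | h)
      · exact Or.inl (hcc'.trans h)
      · rcases le_or_gt c j with hcj | hcj
        · exact Or.inl hcj
        rcases hcc'.eq_or_lt with rfl | hlt
        · exact Or.inr h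
        right
        have e1 := hκ hcj
        have e2 := hκ hlt
        have e3 : κ c' ≤ τ := by
          by_contra hcon
          exact hout c' (mul_pos (mul_pos (by linarith) (by linarith)) (by linarith)) h
        exact hin c (mul_neg_of_pos_of_neg (mul_pos (by linarith) (by linarith)) (by linarith)))
    have hxj : (j : ℕ) < x := (hxs j).2 (Or.inl le_rfl)
    refine ⟨x, hx, fun s hs => ?_, fun s hs => ?_, Or.inl ⟨hjτ, hxj, ?_⟩⟩
    · rcases le_or_gt s j with h | h
      · exact (hκ.monotone h).trans hjτ
      · have e1 := hκ h
        rcases (hxs s).1 hs with h3 | h3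
        · exact absurd h3 h.not_ge
        by_contra hcon
        exact hout s (mul_pos (mul_pos (by linarith) (by linarith)) (by linarith)) h3
    · have h3 : ¬ (s ≤ j ∨ s ∈ S) := fun h => absurd ((hxs s).2 h) (by omega)
      push Not at h3
      have e1 := hκ h3.1
      by_contra hcon
      exact h3.2 (hin s (mul_neg_of_pos_of_neg (mul_pos (by linarith) (by linarith)) (by linarith)))
    · ext s
      rw [mem_initialUnion]
      rcases lt_trichotomy s i with h | rfl | h
      · have e1 := hκ h
        have : s ∈ S := hin s (mul_neg_of_pos_of_neg (mul_pos_of_neg_of_neg (by linarith)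
          (by linarith)) (by linarith))
        exact ⟨fun _ => Or.inl h, fun _ => this⟩
      · exact ⟨fun h => absurd h hi, by omega⟩
      rcases lt_trichotomy s j with h' | rfl | h'
      · have e1 := hκ h
        have e2 := hκ h'
        have : s ∉ S := hout s (mul_pos_of_neg_of_neg (mul_neg_of_pos_of_neg (by linarith)
          (by linarith)) (by linarith))
        exact ⟨fun h => absurd h this, by omega⟩
      · exact ⟨fun h => absurd h hj, by omega⟩
      · have h3 := hxs s
        constructor
        · intro h4
          have := h3.2 (Or.inr h4)
          omega
        · intro h4
          exact (h3.1 (by omega)).resolve_left h'.not_ge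
  rcases le_total (κ i) τ with hiτ | hiτ
  · obtain ⟨x, hx, hxs⟩ := exists_initial_segment (p := fun s => s ≤ i ∨ (s < j ∧ s ∉ S)) (by
      rintro c c' hcc' (h | ⟨h, h'⟩)
      · exact Or.inl (hcc'.trans h)
      · rcases le_or_gt c i with hcj | hcj
        · exact Or.inl hcj
        rcases hcc'.eq_or_lt with rfl | hlt
        · exact Or.inr ⟨h, h'⟩
        right
        have e1 := hκ hcj
        have e2 := hκ hlt
        have e4 := hκ h
        have e3 : κ c' ≤ τ := by
          by_contra hcon
          exact h' (hin c' (mul_neg_of_neg_of_pos (mul_neg_of_pos_of_neg (by linarith)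
            (by linarith)) (by linarith)))
        exact ⟨hlt.trans h, hout c (mul_pos_of_neg_of_neg (mul_neg_of_pos_of_neg (by linarith)
          (by linarith)) (by linarith))⟩)
    have hxi : (i : ℕ) < x := (hxs i).2 (Or.inl le_rfl)
    have hxj : x ≤ j := by
      by_contra hcon
      rcases (hxs j).1 (not_le.1 hcon) with h | h
      · exact absurd h hij.not_ge
      · exact absurd h.1 (lt_irrefl _)
    refine ⟨x, hx, fun s hs => ?_, fun s hs => ?_, Or.inr (Or.inl ⟨hiτ, hjτ, hxi, hxj, ?_⟩)⟩
    · rcases le_or_gt s i with h | h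
      · exact (hκ.monotone h).trans hiτ
      · have e1 := hκ h
        obtain ⟨h3, h4⟩ := ((hxs s).1 hs).resolve_left h.not_ge
        have e2 := hκ h3
        by_contra hcon
        exact h4 (hin s (mul_neg_of_neg_of_pos (mul_neg_of_pos_of_neg (by linarith)
            (by linarith)) (by linarith)))
    · have h3 : ¬ (s ≤ i ∨ (s < j ∧ s ∉ S)) := fun h => absurd ((hxs s).2 h) (by omega)
      push Not at h3
      have e1 := hκ h3.1
      rcases le_or_gt j s with h4 | h4
      · exact hjτ.trans (hκ.monotone h4)
      have e2 := hκ h4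
      by_contra hcon
      exact hout s (mul_pos_of_neg_of_neg (mul_neg_of_pos_of_neg (by linarith)
          (by linarith)) (by linarith)) (h3.2 h4)
    · ext s
      rw [mem_initialUnion]
      rcases lt_trichotomy s i with h | rfl | h
      · have e1 := hκ h
        have : s ∈ S := hin s (mul_neg_of_pos_of_neg (mul_pos_of_neg_of_neg (by linarith)
          (by linarith)) (by linarith))
        exact ⟨fun _ => Or.inl h, fun _ => this⟩
      · exact ⟨fun h => absurd h hi, by omega⟩
      rcases lt_trichotomy s j with h' | rfl | h'
      · have h3 := hxs s
        constructor
        · intro h4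
          right
          refine ⟨?_, h'⟩
          by_contra hcon
          rcases h3.1 (not_le.1 hcon) with h5 | h5
          · exact absurd h5 h.not_ge
          · exact h5.2 h4
        · intro h4
          by_contra hcon
          have := h3.2 (Or.inr ⟨h', hcon⟩)
          omega
      · exact ⟨fun h => absurd h hj, by omega⟩
      · have e1 := hκ h
        have e2 := hκ h'
        have : s ∉ S := hout s (mul_pos (mul_pos (by linarith)
          (by linarith)) (by linarith))
        exact ⟨fun h => absurd h this, by omega⟩
  · obtain ⟨x, hx, hxs⟩ := exists_initial_segment (p := fun s => s < i ∧ s ∈ S) (by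
      rintro c c' hcc' ⟨h, h'⟩
      rcases hcc'.eq_or_lt with rfl | hlt
      · exact ⟨h, h'⟩
      have e2 := hκ hlt
      have e4 := hκ h
      have e3 : κ c' ≤ τ := by
        by_contra hcon
        exact hout c' (mul_pos (mul_pos_of_neg_of_neg (by linarith) (by linarith)) (by linarith)) h'
      exact ⟨hlt.trans h, hin c (mul_neg_of_pos_of_neg (mul_pos_of_neg_of_neg (by linarith)
          (by linarith)) (by linarith))⟩)
    have hxi : x ≤ i := by
      by_contra hcon
      exact absurd ((hxs i).1 (not_le.1 hcon)).1 (lt_irrefl _)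
    refine ⟨x, hx, fun s hs => ?_, fun s hs => ?_, Or.inr (Or.inr ⟨hiτ, hxi, ?_⟩)⟩
    · obtain ⟨h3, h4⟩ := (hxs s).1 hs
      have e1 := hκ h3
      by_contra hcon
      exact hout s (mul_pos (mul_pos_of_neg_of_neg (by linarith) (by linarith)) (by linarith)) h4
    · rcases le_or_gt i s with h4 | h4
      · exact hiτ.trans (hκ.monotone h4)
      have h3 : ¬ (s < i ∧ s ∈ S) := fun h => absurd ((hxs s).2 h) (by omega)
      have e1 := hκ h4
      by_contra hcon
      exact h3 ⟨h4, hin s (mul_neg_of_pos_of_neg (mul_pos_of_neg_of_neg (by linarith)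
          (by linarith)) (by linarith))⟩
    · ext s
      rw [mem_initialUnion]
      rcases lt_trichotomy s i with h | rfl | h
      · have h3 := hxs s
        constructor
        · intro h4
          exact Or.inl (h3.2 ⟨h, h4⟩)
        · intro h4
          exact (h3.1 (by omega)).2
      · exact ⟨fun h => absurd h hi, by omega⟩
      rcases lt_trichotomy s j with h' | rfl | h'
      · have e1 := hκ h
        have e2 := hκ h'
        have : s ∈ S := hin s (mul_neg_of_neg_of_pos (mul_neg_of_pos_of_neg (by linarith)
          (by linarith)) (by linarith))
        exact ⟨fun _ => Or.inr ⟨h, h'⟩, fun _ => this⟩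
      · exact ⟨fun h => absurd h hj, by omega⟩
      · have e1 := hκ h
        have e2 := hκ h'
        have : s ∉ S := hout s (mul_pos (mul_pos (by linarith)
          (by linarith)) (by linarith))
        exact ⟨fun h => absurd h this, by omega⟩

end Lines

namespace LeDiagram

variable {k m : ℕ} {L : LeDiagram k m} {κ : Fin (k + m) → ℝ}

/-! ### The placed edges as intervals on lines -/

/-- The prescribed position of a vertex. -/
def vertexPos (L : LeDiagram k m) (κ : Fin (k + m) → ℝ) (v : L.White ⊕ L.Black) : ℝ × ℝ :=
  vertexPoint κ (L.rowLabel (L.vertexBox v).1) (L.midLabel v) (L.colLabel (L.vertexBox v).2)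

/-- The parameters `τ` of the points `linePoint κ i j τ` of the placed edge `e`: the end `false` has the
smaller parameter, and ends on the boundary impose no condition. -/
def edgeParams (L : LeDiagram k m) (κ : Fin (k + m) → ℝ) (e : L.plabicMinus.E) : Set ℝ :=
  {τ | (∀ v p, L.plabicMinus.attach e false = Sum.inl (v, p) → κ (L.thirdLabel v p) ≤ τ) ∧
    ∀ v p, L.plabicMinus.attach e true = Sum.inl (v, p) → τ ≤ κ (L.thirdLabel v p)}

theorem vertexPos_eq_linePoint {e : L.plabicMinus.E} {s : Bool} {v : L.White ⊕ L.Black} {p : Fin 3}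
    (h : L.plabicMinus.attach e s = Sum.inl (v, p)) :
    L.vertexPos κ v = linePoint κ (L.tripLabel e false) (L.tripLabel e true)
      (κ (L.thirdLabel v p)) := by
  have key : ∀ i j, (L.outLabel v p = i ∧ L.inLabel v p = j) ∨
      (L.outLabel v p = j ∧ L.inLabel v p = i) →
      L.vertexPos κ v = linePoint κ i j (κ (L.thirdLabel v p)) := by
    intro i j h
    have h1 : L.vertexPos κ v = linePoint κ (L.outLabel v p) (L.inLabel v p)
        (κ (L.thirdLabel v p)) := by
      refine Prod.ext ?_ ?_ <;> simp only [vertexPos, linePoint, vertexPoint] <;>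
        match v, p with
        | Sum.inl _, 0 | Sum.inl _, 1 | Sum.inl _, 2 | Sum.inr _, 0 | Sum.inr _, 1 | Sum.inr _, 2 =>
          simp only [outLabel, inLabel, thirdLabel, vertexBox, midLabel]
          try ring
    rcases h with ⟨rfl, rfl⟩ | ⟨rfl, rfl⟩
    · exact h1
    · rw [h1]
      simp only [linePoint, Prod.mk.injEq]
      constructor <;> ring
  obtain ⟨h1, h2⟩ := tripLabel_of_attach h
  refine key _ _ ?_
  rw [← h1, ← h2]
  cases s
  · exact Or.inl ⟨rfl, rfl⟩
  · exact Or.inr ⟨rfl, rfl⟩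

theorem northEnd_le_iff (hκ : StrictMono κ) {b : Fin k × Fin m} (hb : b ∈ L.plus) {τ : ℝ} :
    (∀ v p, L.northEnd b hb = Sum.inl (v, p) → κ (L.thirdLabel v p) ≤ τ) ↔
      ∀ r < b.1, (r, b.2) ∈ L.plus → κ (L.rowLabel r) ≤ τ := by
  rcases northEnd_cases hb with ⟨v, h1, h2, h3, h4⟩ | ⟨h1, h2⟩
  · rw [h4]
    constructor
    · intro h r hr hp
      refine le_trans (hκ.monotone (L.rowLabel_strictMono.monotone ?_)) (h _ _ rfl)
      by_contra hcon
      exact h3 r (not_le.1 hcon) hr hp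
    · rintro h v' p hv
      obtain ⟨rfl, rfl⟩ := place_inj hv
      exact h v.1.1 h2 (by rw [← h1]; exact v.2.1)
  · rw [h2]
    exact ⟨fun _ r hr hp => absurd hp (h1 r hr), by simp⟩

theorem le_westEnd_iff (hκ : StrictMono κ) {b : Fin k × Fin m} (hb : b ∈ L.plus) {τ : ℝ} :
    (∀ v p, L.westEnd b hb = Sum.inl (v, p) → τ ≤ κ (L.thirdLabel v p)) ↔
      ∀ c < b.2, (b.1, c) ∈ L.plus → τ ≤ κ (L.colLabel c) := by
  rcases westEnd_cases hb with ⟨v, h1, h2, h3, h4⟩ | ⟨h1, h2⟩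
  · rw [h4]
    constructor
    · intro h r hr hp
      refine le_trans (h _ _ rfl) (hκ.monotone (L.colLabel_strictAnti.antitone ?_))
      by_contra hcon
      exact h3 r (not_le.1 hcon) hr hp
    · rintro h v' p hv
      obtain ⟨rfl, rfl⟩ := place_inj hv
      exact h v.1.2 h2 (by rw [← h1]; exact v.2.1)
  · rw [h2]
    exact ⟨fun _ r hr hp => absurd hp (h1 r hr), by simp⟩

/-- The parameter `τ` belongs to the strand that leaves the `+` box `b` to the north. -/
def NorthPiece (L : LeDiagram k m) (κ : Fin (k + m) → ℝ) (b : Fin k × Fin m) (τ : ℝ) : Prop :=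
  τ ≤ κ (L.rowLabel b.1) ∧ ∀ r < b.1, (r, b.2) ∈ L.plus → κ (L.rowLabel r) ≤ τ

/-- The parameter `τ` belongs to the diagonal of the elbow in the box `b`. -/
def DiagPiece (L : LeDiagram k m) (κ : Fin (k + m) → ℝ) (b : Fin k × Fin m) (τ : ℝ) : Prop :=
  κ (L.east b) ≤ τ ∧ τ ≤ κ (L.south b)

/-- The parameter `τ` belongs to the strand that leaves the `+` box `b` to the west. -/
def WestPiece (L : LeDiagram k m) (κ : Fin (k + m) → ℝ) (b : Fin k × Fin m) (τ : ℝ) : Prop :=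
  κ (L.colLabel b.2) ≤ τ ∧ ∀ c < b.2, (b.1, c) ∈ L.plus → τ ≤ κ (L.colLabel c)

theorem le_diagonalEnd_iff (hκ : StrictMono κ) {b : Fin k × Fin m} (hb : b ∈ L.plus) {τ : ℝ} :
    (∀ v p, L.diagonalEnd b hb = Sum.inl (v, p) → τ ≤ κ (L.thirdLabel v p)) ↔
      (L.HasBelow b → τ ≤ κ (L.south b)) ∧
      (¬ L.HasBelow b → ∀ c < b.2, (b.1, c) ∈ L.plus → τ ≤ κ (L.colLabel c)) := by
  by_cases h : L.HasBelow b
  · rw [diagonalEnd, dif_pos h]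
    constructor
    · intro h1
      exact ⟨fun _ => h1 _ _ rfl, fun h' => absurd h h'⟩
    · rintro ⟨h1, -⟩ v p hv
      obtain ⟨rfl, rfl⟩ := place_inj hv
      exact h1 h
  · rw [diagonalEnd, dif_neg h, le_westEnd_iff hκ]
    exact ⟨fun h1 => ⟨fun h' => absurd h' h, fun _ => h1⟩, fun h1 => h1.2 h⟩

theorem mem_edgeParams_north (hκ : StrictMono κ) {b : Fin k × Fin m} (hb : b ∈ L.plus) {τ : ℝ} :
    τ ∈ L.edgeParams κ (Sum.inl ⟨b, hb⟩) ↔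
      (∀ r < b.1, (r, b.2) ∈ L.plus → κ (L.rowLabel r) ≤ τ) ∧
      (L.HasRight b → τ ≤ κ (L.rowLabel b.1)) ∧
      (¬ L.HasRight b → (L.HasBelow b → τ ≤ κ (L.south b)) ∧
        (¬ L.HasBelow b → ∀ c < b.2, (b.1, c) ∈ L.plus → τ ≤ κ (L.colLabel c))) := by
  rw [← northEnd_le_iff hκ hb, ← le_diagonalEnd_iff hκ hb]
  by_cases h : L.HasRight b
  · have h1 := attach_north_white hb h
    simp only [edgeParams, Set.mem_ofPred, h1]
    refine and_congr Iff.rfl ⟨fun h2 => ⟨fun _ => h2 _ _ rfl, fun h' => absurd h h'⟩, ?_⟩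
    rintro ⟨h2, -⟩ v p hv
    obtain ⟨rfl, rfl⟩ := place_inj hv
    exact h2 h
  · have h1 : L.plabicMinus.attach (Sum.inl ⟨b, hb⟩) true = L.diagonalEnd b hb := by
      simp only [plabicMinus]
      rw [dif_neg h]
    simp only [edgeParams, Set.mem_ofPred, h1]
    exact and_congr Iff.rfl ⟨fun h2 => ⟨fun h' => absurd h' h, fun _ => h2⟩, fun h2 => h2.2 h⟩

theorem mem_edgeParams_diagonal (hκ : StrictMono κ) {b : Fin k × Fin m} (hb : b ∈ L.plus)
    (hr : L.HasRight b) {τ : ℝ} :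
    τ ∈ L.edgeParams κ (Sum.inr (Sum.inl ⟨b, hb, hr⟩)) ↔ κ (L.east b) ≤ τ ∧
      (L.HasBelow b → τ ≤ κ (L.south b)) ∧
        (¬ L.HasBelow b → ∀ c < b.2, (b.1, c) ∈ L.plus → τ ≤ κ (L.colLabel c)) := by
  rw [← le_diagonalEnd_iff hκ hb]
  refine and_congr ⟨fun h => h _ _ rfl, fun h v p hv => ?_⟩ Iff.rfl
  obtain ⟨rfl, rfl⟩ := place_inj hv
  exact h

theorem mem_edgeParams_west (hκ : StrictMono κ) {b : Fin k × Fin m} (hb : b ∈ L.plus)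
    (hr : L.HasBelow b) {τ : ℝ} :
    τ ∈ L.edgeParams κ (Sum.inr (Sum.inr ⟨b, hb, hr⟩)) ↔ L.WestPiece κ b τ := by
  rw [WestPiece, ← le_westEnd_iff hκ hb]
  refine and_congr ⟨fun h => h _ _ rfl, fun h v p hv => ?_⟩ Iff.rfl
  obtain ⟨rfl, rfl⟩ := place_inj hv
  exact h

theorem NorthPiece.mem_edgeParams (hκ : StrictMono κ) {b : Fin k × Fin m} (hb : b ∈ L.plus) {τ : ℝ}
    (h : L.NorthPiece κ b τ) : τ ∈ L.edgeParams κ (Sum.inl ⟨b, hb⟩) := by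
  rw [mem_edgeParams_north hκ]
  refine ⟨h.2, fun _ => h.1, fun _ => ⟨fun _ => ?_, fun _ c hc _ => ?_⟩⟩
  · exact h.1.trans (hκ.monotone (rowLabel_lt_south hb).le)
  · refine h.1.trans (hκ.monotone ((L.rowLabel_lt_colLabel (L.plus_subset _ hb)).trans ?_).le)
    exact L.colLabel_strictAnti hc

theorem DiagPiece.exists_mem_edgeParams (hκ : StrictMono κ) {b : Fin k × Fin m} (hb : b ∈ L.plus)
    {τ : ℝ} (h : L.DiagPiece κ b τ) : ∃ e : L.plabicMinus.E, τ ∈ L.edgeParams κ e ∧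
      L.tripLabel e false = L.rowLabel b.1 ∧ L.tripLabel e true = L.colLabel b.2 := by
  have hU : (L.HasBelow b → τ ≤ κ (L.south b)) ∧
      (¬ L.HasBelow b → ∀ c < b.2, (b.1, c) ∈ L.plus → τ ≤ κ (L.colLabel c)) :=
    ⟨fun _ => h.2, fun h' c hc _ => h.2.trans (hκ.monotone
      ((south_le_colLabel hb).trans (L.colLabel_strictAnti hc).le))⟩
  by_cases hr : L.HasRight b
  · exact ⟨Sum.inr (Sum.inl ⟨b, hb, hr⟩), (mem_edgeParams_diagonal hκ hb hr).2 ⟨h.1, hU⟩, rfl, rfl⟩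
  · refine ⟨Sum.inl ⟨b, hb⟩, (mem_edgeParams_north hκ hb).2 ⟨fun r hr' _ => ?_,
      fun h => absurd h hr, fun _ => hU⟩, east_of_not_hasRight hr, rfl⟩
    refine le_trans (hκ.monotone ?_) h.1
    rw [east_of_not_hasRight hr]
    exact (L.rowLabel_strictMono hr').le

theorem WestPiece.exists_mem_edgeParams (hκ : StrictMono κ) {b : Fin k × Fin m} (hb : b ∈ L.plus)
    {τ : ℝ} (h : L.WestPiece κ b τ) : ∃ e : L.plabicMinus.E, τ ∈ L.edgeParams κ e ∧
      L.tripLabel e false = L.rowLabel b.1 ∧ L.tripLabel e true = L.south b := by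
  by_cases hB : L.HasBelow b
  · exact ⟨Sum.inr (Sum.inr ⟨b, hb, hB⟩), (mem_edgeParams_west hκ hb hB).2 h, rfl, rfl⟩
  have hU : (L.HasBelow b → τ ≤ κ (L.south b)) ∧
      (¬ L.HasBelow b → ∀ c < b.2, (b.1, c) ∈ L.plus → τ ≤ κ (L.colLabel c)) :=
    ⟨fun h' => absurd h' hB, fun h' => h.2⟩
  by_cases hr : L.HasRight b
  · refine ⟨Sum.inr (Sum.inl ⟨b, hb, hr⟩), (mem_edgeParams_diagonal hκ hb hr).2 ⟨?_, hU⟩, rfl,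
      (south_of_not_hasBelow hB).symm⟩
    exact le_trans (hκ.monotone (east_lt_colLabel hb).le) h.1
  · refine ⟨Sum.inl ⟨b, hb⟩, (mem_edgeParams_north hκ hb).2 ⟨fun r hr' _ => ?_,
      fun h => absurd h hr, fun _ => hU⟩, east_of_not_hasRight hr, (south_of_not_hasBelow hB).symm⟩
    refine le_trans (hκ.monotone ?_) h.1
    exact ((L.rowLabel_strictMono hr').trans (L.rowLabel_lt_colLabel (L.plus_subset _ hb))).le

/-- Each point of a placed edge, except those where the third root is one of the two labels, belongs to a
strand that determines the edge; the position of the third root tells which kind of strand it is. -/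
theorem piece_of_mem_edgeParams (hκ : StrictMono κ) {e : L.plabicMinus.E} {τ : ℝ}
    (h : τ ∈ L.edgeParams κ e) :
    (τ < κ (L.tripLabel e false) → ∃ b, ∃ hb : b ∈ L.plus, e = Sum.inl ⟨b, hb⟩ ∧
      L.NorthPiece κ b τ) ∧
    (κ (L.tripLabel e false) < τ → τ < κ (L.tripLabel e true) → ∃ b, ∃ hb : b ∈ L.plus,
      L.tripLabel e false = L.rowLabel b.1 ∧ L.tripLabel e true = L.colLabel b.2 ∧
      L.DiagPiece κ b τ ∧ ((e = Sum.inl ⟨b, hb⟩ ∧ ¬ L.HasRight b) ∨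
        ∃ h : L.HasRight b, e = Sum.inr (Sum.inl ⟨b, hb, h⟩))) ∧
    (κ (L.tripLabel e true) < τ → ∃ b, ∃ hb : b ∈ L.plus,
      L.tripLabel e false = L.rowLabel b.1 ∧ L.tripLabel e true = L.south b ∧
      L.WestPiece κ b τ ∧ ((e = Sum.inl ⟨b, hb⟩ ∧ ¬ L.HasRight b ∧ ¬ L.HasBelow b) ∨
        (∃ h : L.HasRight b, e = Sum.inr (Sum.inl ⟨b, hb, h⟩) ∧ ¬ L.HasBelow b) ∨
        (∃ h : L.HasBelow b, e = Sum.inr (Sum.inr ⟨b, hb, h⟩)))) := by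
  rcases e with ⟨b, hb⟩ | ⟨b, hb, hr⟩ | ⟨b, hb, hB⟩
  · rw [mem_edgeParams_north hκ] at h
    obtain ⟨h1, h2, h3⟩ := h
    have e1 := hκ.monotone (rowLabel_le_east hb)
    have e2 := hκ.monotone (south_le_colLabel hb)
    have e3 := hκ (east_lt_colLabel hb)
    simp only [tripLabel]
    refine ⟨fun h4 => ⟨b, hb, rfl, ?_, h1⟩, fun h4 h5 => ⟨b, hb, ?_⟩, fun h4 => ⟨b, hb, ?_⟩⟩
    · by_cases hr : L.HasRight b
      · exact h2 hr
      · rw [← east_of_not_hasRight hr]; exact h4.le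
    · have hr : ¬ L.HasRight b := fun hr => by linarith [h2 hr]
      refine ⟨east_of_not_hasRight hr, rfl, ⟨h4.le, ?_⟩, Or.inl ⟨rfl, hr⟩⟩
      by_cases hB : L.HasBelow b
      · exact (h3 hr).1 hB
      · rw [south_of_not_hasBelow hB]; exact h5.le
    · have hr : ¬ L.HasRight b := fun hr => by linarith [h2 hr]
      have hB : ¬ L.HasBelow b := fun hB => by linarith [(h3 hr).1 hB]
      exact ⟨east_of_not_hasRight hr, (south_of_not_hasBelow hB).symm, ⟨h4.le, (h3 hr).2 hB⟩,
        Or.inl ⟨rfl, hr, hB⟩⟩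
  · rw [mem_edgeParams_diagonal hκ hb hr] at h
    obtain ⟨h1, h3⟩ := h
    have e1 := hκ.monotone (rowLabel_le_east hb)
    have e2 := hκ.monotone (south_le_colLabel hb)
    simp only [tripLabel]
    refine ⟨fun h4 => absurd h4 (by linarith), fun h4 h5 => ⟨b, hb, ?_⟩, fun h4 => ⟨b, hb, ?_⟩⟩
    · refine ⟨rfl, rfl, ⟨h1, ?_⟩, Or.inr ⟨hr, rfl⟩⟩
      by_cases hB : L.HasBelow b
      · exact h3.1 hB
      · rw [south_of_not_hasBelow hB]; exact h5.le
    · have hB : ¬ L.HasBelow b := fun hB => by linarith [h3.1 hB]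
      exact ⟨rfl, (south_of_not_hasBelow hB).symm, ⟨h4.le, h3.2 hB⟩, Or.inr (Or.inl ⟨hr, rfl, hB⟩)⟩
  · rw [mem_edgeParams_west hκ hb hB] at h
    have e1 := hκ (rowLabel_lt_south hb)
    have e2 := hκ.monotone (south_le_colLabel hb)
    have e3 := h.1
    simp only [tripLabel]
    exact ⟨fun h4 => absurd h4 (by linarith), fun h4 h5 => absurd h5 (by linarith),
      fun h4 => ⟨b, hb, rfl, rfl, h, Or.inr (Or.inr ⟨hB, rfl⟩)⟩⟩

theorem exists_Icc_subset_edgeParams (hκ : StrictMono κ) (e : L.plabicMinus.E) :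
    ∃ a b, a < b ∧ Set.Icc a b ⊆ L.edgeParams κ e := by
  rcases e with ⟨b, hb⟩ | ⟨b, hb, hr⟩ | ⟨b, hb, hB⟩
  · suffices h : ∃ a < κ (L.rowLabel b.1), ∀ r < b.1, (r, b.2) ∈ L.plus → κ (L.rowLabel r) ≤ a by
      obtain ⟨a, h1, h2⟩ := h
      exact ⟨a, _, h1, fun τ hτ => NorthPiece.mem_edgeParams hκ hb
        ⟨hτ.2, fun r hr hp => (h2 r hr hp).trans hτ.1⟩⟩
    rcases northEnd_cases hb with ⟨v, h1, h2, h3, h4⟩ | ⟨h1, h2⟩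
    · refine ⟨_, hκ (L.rowLabel_strictMono h2), fun r hr hp => hκ.monotone
        (L.rowLabel_strictMono.monotone ?_)⟩
      by_contra hcon
      exact h3 r (not_le.1 hcon) hr hp
    · exact ⟨κ (L.rowLabel b.1) - 1, by linarith, fun r hr hp => absurd hp (h1 r hr)⟩
  · refine ⟨_, _, hκ (east_lt_south hb), fun τ hτ => ?_⟩
    refine (mem_edgeParams_diagonal hκ hb hr).2 ⟨hτ.1, fun _ => hτ.2, fun _ c hc _ => ?_⟩
    exact hτ.2.trans (hκ.monotone ((south_le_colLabel hb).trans (L.colLabel_strictAnti hc).le))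
  · suffices h : ∃ a, κ (L.colLabel b.2) < a ∧
        ∀ c < b.2, (b.1, c) ∈ L.plus → a ≤ κ (L.colLabel c) by
      obtain ⟨a, h1, h2⟩ := h
      exact ⟨_, a, h1, fun τ hτ => (mem_edgeParams_west hκ hb hB).2
        ⟨hτ.1, fun r hr hp => hτ.2.trans (h2 r hr hp)⟩⟩
    rcases westEnd_cases hb with ⟨v, h1, h2, h3, h4⟩ | ⟨h1, h2⟩
    · refine ⟨_, hκ (L.colLabel_strictAnti h2), fun r hr hp => hκ.monotone
        (L.colLabel_strictAnti.antitone ?_)⟩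
      by_contra hcon
      exact h3 r (not_le.1 hcon) hr hp
    · exact ⟨κ (L.colLabel b.2) + 1, by linarith, fun r hr hp => absurd hp (h1 r hr)⟩

theorem edgeParams_ordConnected (e : L.plabicMinus.E) : (L.edgeParams κ e).OrdConnected :=
  ⟨fun _ hx _ hy _ hz => ⟨fun v p h => (hx.1 v p h).trans hz.1, fun v p h => hz.2.trans (hy.2 v p h)⟩⟩

theorem thirdLabel_lt (hκ : StrictMono κ) {e : L.plabicMinus.E} {v w : L.White ⊕ L.Black}
    {p q : Fin 3} (hv : L.plabicMinus.attach e false = Sum.inl (v, p))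
    (hw : L.plabicMinus.attach e true = Sum.inl (w, q)) :
    κ (L.thirdLabel v p) < κ (L.thirdLabel w q) := by
  obtain ⟨a, b, hab, h⟩ := exists_Icc_subset_edgeParams hκ e
  have h1 := (h (Set.left_mem_Icc.2 hab.le)).1 v p hv
  have h2 := (h (Set.right_mem_Icc.2 hab.le)).2 w q hw
  linarith

end LeDiagram

namespace LeDiagram

variable {k m : ℕ} {L : LeDiagram k m} {κ : Fin (k + m) → ℝ}
  {A : Matrix (Fin k) (Fin (k + m)) ℝ} {M : Finset (Finset (Fin (k + m)))}

/-! ### Placed edges and dominant exponentials -/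

/-- A pipe in a column has just turned north at an elbow, unless it begins in that column. -/
theorem vPipe_eq_or (y : ℕ) (c : Fin m) : L.vPipe y c = L.colLabel c ∨
    ∃ r : Fin k, y ≤ r ∧ (r, c) ∈ L.plus ∧ (∀ r' : Fin k, y ≤ (r' : ℕ) → r' < r → (r', c) ∉ L.plus) ∧
      L.vPipe y c = L.hPipe r (c + 1) := by
  classical
  by_cases h : ∃ r : Fin k, y ≤ (r : ℕ) ∧ (r, c) ∈ L.plus
  · right
    have hne : (univ.filter fun r : Fin k => y ≤ (r : ℕ) ∧ (r, c) ∈ L.plus).Nonempty := by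
      obtain ⟨r, hr⟩ := h
      exact ⟨r, by simpa using hr⟩
    have hmem := Finset.min'_mem _ hne
    have hmin := fun r => Finset.min'_le (univ.filter fun r : Fin k => y ≤ (r : ℕ) ∧ (r, c) ∈ L.plus) r
    set r := Finset.min' _ hne
    simp only [mem_filter, mem_univ, true_and] at hmem hmin
    have hno : ∀ r' : Fin k, y ≤ (r' : ℕ) → r' < r → (r', c) ∉ L.plus := fun r' h1 h2 h3 =>
      absurd (hmin r' ⟨h1, h3⟩) h2.not_ge
    refine ⟨r, hmem.1, hmem.2, hno, ?_⟩
    rw [vPipe_eq_of_forall_notMem hmem.1 (fun r' h1 h2 => hno r' h1 h2), vPipe_of_mem hmem.2]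
  · left
    push Not at h
    exact vPipe_eq_colLabel h

theorem exists_rowLabel (h : L.Matches A) {i : Fin (k + m)} (hi : IsPivot A i) :
    ∃ r, L.rowLabel r = i := by
  rcases L.exists_label i with hr | ⟨c, rfl⟩
  · exact hr
  · exact absurd hi (h.not_isPivot_colLabel c)

theorem exists_colLabel (h : L.Matches A) {i : Fin (k + m)} (hi : ¬ IsPivot A i) :
    ∃ c, L.colLabel c = i := by
  rcases L.exists_label i with ⟨r, rfl⟩ | hc
  · exact absurd (h.isPivot_rowLabel r) hi
  · exact hc

theorem exists_row_cut (L : LeDiagram k m) (x : ℕ) :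
    ∃ q : ℕ, ∀ r : Fin k, (r : ℕ) < q ↔ (L.rowLabel r : ℕ) < x := by
  obtain ⟨q, -, hq⟩ := exists_initial_segment (p := fun r : Fin k => (L.rowLabel r : ℕ) < x)
    fun r r' h h' => lt_of_le_of_lt (L.rowLabel_strictMono.monotone h) h'
  exact ⟨q, hq⟩

theorem exists_col_cut (L : LeDiagram k m) (x : ℕ) :
    ∃ q : ℕ, ∀ c : Fin m, (c : ℕ) < q ↔ x ≤ L.colLabel c := by
  obtain ⟨q, -, hq⟩ := exists_initial_segment (p := fun c : Fin m => x ≤ (L.colLabel c : ℕ))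
    fun r r' h h' => le_trans h' (L.colLabel_strictAnti.antitone h)
  exact ⟨q, hq⟩

/-- If two elements with equal phases are parallel modulo a set between the strict and the weak sublevel set
of the phases, then a placed edge passes through the point: this set is one of the sets that define the
pipes of the matrix. -/
theorem exists_mem_edgeParams_of_parallel (hκ : StrictMono κ) (hL : L.Matches A)
    {i j : Fin (k + m)} (hij : i < j) {τ : ℝ} {S : Set (Fin (k + m))}
    (h1 : ∀ s, phase κ s (linePoint κ i j τ) < phase κ i (linePoint κ i j τ) → s ∈ S)
    (h2 : ∀ s ∈ S, phase κ s (linePoint κ i j τ) ≤ phase κ i (linePoint κ i j τ))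
    (hi : i ∉ S) (hj : j ∉ S) (h3 : A.col i ∈ colSpan A (insert j S)) (h4 : A.col i ∉ colSpan A S)
    (h5 : A.col j ∉ colSpan A S) :
    ∃ e : L.plabicMinus.E, τ ∈ L.edgeParams κ e ∧
      L.tripLabel e false = i ∧ L.tripLabel e true = j := by
  have h6 := colSpan_exchange h3 h4
  obtain ⟨x, hxn, hxτ, hτx, ⟨hjτ, hjx, rfl⟩ | ⟨hiτ, hτj, hix, hxj, rfl⟩ | ⟨hτi, hxi, rfl⟩⟩ :=
    sublevel_eq_initialUnion hκ hij h1 h2 hi hj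
  · -- `j` runs through the row of `i` and has turned west at an elbow there
    rw [insert_initialUnion_mid hjx] at h3
    have hp := rowPipe_of_spanned hij hjx h3 h4
    obtain ⟨r, rfl⟩ := exists_rowLabel hL hp.isPivot
    obtain ⟨q, hq⟩ := L.exists_col_cut x
    have hp' := hp.unique (hL.rowPipe (by omega) hxn hq)
    rcases hPipe_eq_or (L := L) r q with h7 | ⟨c, hc, hb, hno, h7⟩
    · exact absurd (hp'.trans h7) hij.ne'
    obtain ⟨e, he1, he2, he3⟩ := WestPiece.exists_mem_edgeParams hκ hb (τ := τ) ⟨hxτ _ (by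
      by_contra hcon
      have := (hq c).2 (not_lt.1 hcon)
      omega), fun c' hc' hb' => hτx _ ((hq c').1 (by
      by_contra hcon
      exact hno c' (not_lt.1 hcon) hc' hb'))⟩
    exact ⟨e, he1, he2, by rw [he3, hp', h7]; rfl⟩
  · -- at the box in the row of `i` and the column of `j`, the pipe to the west is not the one from the east
    have hpi : IsPivot A i := fun h => h4 (h.mono (by omega))
    have hpj : ¬ IsPivot A j := not_not.2 (colSpan_mono (fun s hs => by
      rw [Set.mem_insert_iff] at hs
      rw [mem_initialUnion] at hs ⊢
      rcases hs with rfl | hs <;> omega) h6)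
    obtain ⟨r, rfl⟩ := exists_rowLabel hL hpi
    obtain ⟨c, rfl⟩ := exists_colLabel hL hpj
    have hbox := L.rowLabel_lt_colLabel_iff.1 hij
    obtain ⟨⟨hw, -⟩, he, -⟩ := hL.rowPipe_and_colPipe (r + c + 1) r c (by omega) hbox
    rw [insert_initialUnion_right hxj] at h3
    have hxe : ¬ x ≤ L.hPipe r (c + 1) := fun h => h4 ((he.2.2 x hix hxj).2 h)
    have hxw : x ≤ L.hPipe r c := (hw.2.2 x hix (by omega)).1 h3
    have hb : (r, c) ∈ L.plus := by
      by_contra hb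
      rw [hPipe_of_notMem hb] at hxw
      exact hxe hxw
    rw [hPipe_of_mem hb] at hxw
    exact DiagPiece.exists_mem_edgeParams hκ hb ⟨hxτ _ (not_le.1 hxe), hτx _ hxw⟩
  · -- `i` runs through the column of `j` and has turned north at an elbow there
    have h7 : Spanned A j x i j := by
      rwa [insert_initialUnion_mid (show (i : ℕ) < j from hij)] at h6
    have hp := colPipe_of_spanned hxi hij h7 h5
    obtain ⟨c, rfl⟩ := exists_colLabel hL hp.not_isPivot
    obtain ⟨q, hq⟩ := L.exists_row_cut x
    have hp' := hp.unique (hL.colPipe (by omega) hq)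
    rcases vPipe_eq_or (L := L) q c with h8 | ⟨r, hr, hb, hno, h8⟩
    · exact absurd (hp'.trans h8) hij.ne
    refine ⟨Sum.inl ⟨(r, c), hb⟩, NorthPiece.mem_edgeParams hκ hb ⟨hτx _ ?_, fun r' hr' hb' =>
      hxτ _ ((hq r').1 ?_)⟩, (hp'.trans h8).symm, rfl⟩
    · by_contra hcon
      have := (hq r).2 (not_le.1 hcon)
      omega
    · by_contra hcon
      exact hno r' (not_lt.1 hcon) hr' hb'

theorem exists_mem_edgeParams_of_ne (hκ : StrictMono κ) (hA : A ∈ positroidCell k M)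
    (hL : L.Matches A) {p : ℝ × ℝ} {J J' : Finset (Fin (k + m))} (hJ : IsDominant κ M p J)
    (hJ' : IsDominant κ M p J') (hne : J ≠ J') :
    ∃ e : L.plabicMinus.E, ∃ τ ∈ L.edgeParams κ e,
      linePoint κ (L.tripLabel e false) (L.tripLabel e true) τ = p := by
  have key : ∀ {i j : Fin (k + m)} {S : Set (Fin (k + m))}, i < j →
      phase κ i p = phase κ j p → (∀ s, phase κ s p < phase κ i p → s ∈ S) →
      (∀ s ∈ S, phase κ s p ≤ phase κ i p) → i ∉ S → j ∉ S → A.col i ∈ colSpan A (insert j S) →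
      A.col i ∉ colSpan A S → A.col j ∉ colSpan A S → ∃ e : L.plabicMinus.E, ∃ τ ∈ L.edgeParams κ e,
      linePoint κ (L.tripLabel e false) (L.tripLabel e true) τ = p := by
    intro i j S hij hw h1 h2 h3 h4 h5 h6 h7
    obtain ⟨τ, rfl⟩ := exists_linePoint hκ hij hw
    obtain ⟨e, he, rfl, rfl⟩ := exists_mem_edgeParams_of_parallel hκ hL hij h1 h2 h3 h4 h5 h6 h7
    exact ⟨e, τ, he, rfl⟩
  have main : ∀ {J : Finset (Fin (k + m))} {i j : Fin (k + m)},
      IsMinWeight M (fun s => phase κ s p) J → phase κ i p = phase κ j p → i ∈ J → j ∉ J →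
      insert j (J.erase i) ∈ M → ∃ e : L.plabicMinus.E, ∃ τ ∈ L.edgeParams κ e,
      linePoint κ (L.tripLabel e false) (L.tripLabel e true) τ = p := by
    intro J i j hJ hw hi hj hM
    obtain ⟨S, h1, h2, h3, h4, h5, h6, h7⟩ := hJ.exists_parallel hA hi hj hw hM
    have hne : i ≠ j := fun h => hj (h ▸ hi)
    rcases lt_or_gt_of_ne hne with hlt | hlt
    · exact key hlt hw h1 h2 h3 h4 h5 h6 h7
    · exact key hlt hw.symm (by rw [← hw]; exact h1) (by rw [← hw]; exact h2) h4 h3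
        (colSpan_exchange h5 h6) h7 h6
  obtain ⟨i, j, hw, ⟨h1, -, -, h2, h3⟩ | ⟨h1, -, -, h2, h3⟩⟩ := IsMinWeight.exists_swap hA hJ hJ' hne
  · exact main hJ hw h1 h2 h3.1
  · exact main hJ' hw h1 h2 h3.1

/-- At a generic point of a placed edge, the labels of the edge are parallel modulo the elements with smaller
phase. -/
theorem isSolitonPoint_linePoint (hκ : StrictMono κ) (hA : A ∈ positroidCell k M) (hM : M.Nonempty)
    (hL : L.Matches A) {e : L.plabicMinus.E} {τ : ℝ} (hτ : τ ∈ L.edgeParams κ e)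
    (hg : ¬ ((∃ s, κ s = τ) ∨ ∃ s t, s ≠ t ∧ ¬ ((s = L.tripLabel e false ∧ t = L.tripLabel e true) ∨
      (s = L.tripLabel e true ∧ t = L.tripLabel e false)) ∧
      phase κ s (linePoint κ (L.tripLabel e false) (L.tripLabel e true) τ) =
        phase κ t (linePoint κ (L.tripLabel e false) (L.tripLabel e true) τ))) :
    IsSolitonPoint κ M (L.tripLabel e false) (L.tripLabel e true)
      (linePoint κ (L.tripLabel e false) (L.tripLabel e true) τ) := by
  push Not at hg
  obtain ⟨hg1, hg2⟩ := hg
  have hij := tripLabel_lt e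
  have hpiece := piece_of_mem_edgeParams hκ hτ
  set i := L.tripLabel e false with hi
  set j := L.tripLabel e true with hj
  set p := linePoint κ i j τ with hp
  have heq : phase κ j p = phase κ i p := phase_linePoint_eq κ i j τ
  suffices h : A.col i ∈ colSpan A (insert j {s | phase κ s p < phase κ i p}) ∧
      A.col i ∉ colSpan A {s | phase κ s p < phase κ i p} by
    refine exists_isMinWeight_iff hA hM hij.ne heq.symm (fun s t hst hw => ?_) h.1 h.2
    by_contra hcon
    exact hg2 s t hst ⟨fun h1 h2 => hcon (Or.inl ⟨h1, h2⟩), fun h1 h2 => hcon (Or.inr ⟨h1, h2⟩)⟩ hw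
  obtain ⟨x, hxn, hxτ, hτx, hS⟩ := sublevel_eq_initialUnion hκ hij (τ := τ)
    (S := {s | phase κ s p < phase κ i p}) (fun s hs => hs) (fun s hs => le_of_lt hs)
    (fun h => lt_irrefl (phase κ i p) h) (fun h => (ne_of_lt h) heq)
  have hlt : ∀ s : Fin (k + m), κ s ≤ τ → (s : ℕ) < x := fun s hs => by
    by_contra hcon
    exact hg1 s (le_antisymm hs (hτx s (not_lt.1 hcon)))
  have hle : ∀ s : Fin (k + m), τ ≤ κ s → x ≤ s := fun s hs => by
    by_contra hcon
    exact hg1 s (le_antisymm (hxτ s (not_le.1 hcon)) hs)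
  rcases hS with ⟨hjτ, hjx, hS⟩ | ⟨hiτ, hτj, hix, hxj, hS⟩ | ⟨hτi, hxi, hS⟩ <;> rw [hS]
  · obtain ⟨⟨r, c⟩, hb, hbi, hbj, hW, -⟩ := hpiece.2.2 (lt_of_le_of_ne hjτ (hg1 _))
    obtain ⟨q, hq⟩ := L.exists_col_cut x
    have hqc : q ≤ c := by
      by_contra hcon
      have h1 := (hq c).1 (not_le.1 hcon)
      have h2 := hlt _ hW.1
      simp only at h2
      omega
    have hpipe := hL.rowPipe (r := r) (x := x) (q := q) (by
      have := hlt i ((hκ hij).le.trans hjτ); rw [hbi] at this; exact this) hxn hq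
    rw [hPipe_eq_of_forall_notMem hqc (fun c' h1 h2 h3 => by
      have := (hq c').2 (hle _ (hW.2 c' h2 h3))
      omega), hPipe_of_mem hb] at hpipe
    have hpipe' : RowPipe A i x j := by rw [hbi, hbj]; exact hpipe
    have hi' := hpipe'.2.2 j hij hjx.le
    have hi'' := hpipe'.2.2 (j + 1) (by omega) hjx
    rw [insert_initialUnion_mid hjx]
    exact ⟨hi'.2 le_rfl, fun h => by have := hi''.1 h; omega⟩
  · obtain ⟨⟨r, c⟩, hb, hbi, hbj, hD, -⟩ := hpiece.2.1 (lt_of_le_of_ne hiτ (hg1 _))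
      (lt_of_le_of_ne hτj (hg1 _).symm)
    obtain ⟨⟨hw, -⟩, he, -⟩ := hL.rowPipe_and_colPipe (r + c + 1) r c (by omega)
      (L.plus_subset _ hb)
    rw [hPipe_of_mem hb] at hw
    simp only at hbi hbj
    rw [← hbi, ← hbj] at hw he
    have h1 := hlt _ hD.1
    have h2 := hle _ hD.2
    simp only [east, south] at h1 h2
    rw [insert_initialUnion_right hxj]
    exact ⟨(hw.2.2 x hix (by omega)).2 h2, fun h => by have := (he.2.2 x hix hxj).1 h; omega⟩
  · obtain ⟨⟨r, c⟩, hb, he, hN⟩ := hpiece.1 (lt_of_le_of_ne hτi (hg1 _).symm)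
    have hbi : i = L.hPipe r (c + 1) := by rw [hi, he]; rfl
    have hbj : j = L.colLabel c := by rw [hj, he]; rfl
    obtain ⟨q, hq⟩ := L.exists_row_cut x
    have hqr : q ≤ r := by
      by_contra hcon
      have h1 := (hq r).1 (not_le.1 hcon)
      have h2 := hle _ hN.1
      simp only at h2
      omega
    have hpipe := hL.colPipe (c := c) (x := x) (q := q) (by
      have := hle j (hτi.trans (hκ hij).le); rw [hbj] at this; exact this) hq
    rw [vPipe_eq_of_forall_notMem hqr (fun r' h1 h2 h3 => by
      have := (hq r').2 (hlt _ (hN.2 r' h2 h3))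
      omega), vPipe_of_mem hb, ← hbi, ← hbj] at hpipe
    have hsp : A.col j ∈ colSpan A (insert i (initialUnion (k + m) x (i + 1) j)) := by
      rw [insert_initialUnion_mid (show (i : ℕ) < j from hij)]
      exact (hpipe.2.2 i hxi hij.le).2 le_rfl
    have hns : A.col j ∉ colSpan A (initialUnion (k + m) x (i + 1) j) := fun h => by
      have := (hpipe.2.2 (i + 1) (by omega) hij).1 h
      omega
    exact ⟨colSpan_exchange hsp hns, fun h => hns (by rwa [colSpan_insert_eq h] at hsp)⟩

end LeDiagram

/-! ### The drawing -/

section Lines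

variable {n : ℕ} {κ : Fin n → ℝ}

theorem linePoint_fst_add (κ : Fin n → ℝ) (i j : Fin n) (τ : ℝ) :
    (linePoint κ i j τ).1 + (κ i + κ j) * (linePoint κ i j τ).2 =
      -(κ i ^ 2 + κ i * κ j + κ j ^ 2) := by
  simp only [linePoint]
  ring

theorem linePoint_add (κ : Fin n → ℝ) (i j : Fin n) (τ a : ℝ) :
    linePoint κ i j (τ + a) = linePoint κ i j τ + a • ((κ i + κ j, -1) : ℝ × ℝ) := by
  ext <;> simp only [linePoint, Prod.fst_add, Prod.snd_add, Prod.smul_fst, Prod.smul_snd,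
    smul_eq_mul] <;> ring

theorem continuous_linePoint (κ : Fin n → ℝ) (i j : Fin n) : Continuous (linePoint κ i j) := by
  unfold linePoint
  fun_prop

theorem segment_linePoint (κ : Fin n → ℝ) (i j : Fin n) {a b : ℝ} (hab : a ≤ b) :
    segment ℝ (linePoint κ i j a) (linePoint κ i j b) = linePoint κ i j '' Set.Icc a b := by
  have h : ∀ τ, linePoint κ i j τ =
      AffineMap.lineMap (linePoint κ i j 0) (linePoint κ i j 1) τ := by
    intro τ
    ext <;> simp only [linePoint, AffineMap.lineMap_apply, vsub_eq_sub, vadd_eq_add, Prod.fst_add,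
      Prod.snd_add, Prod.smul_fst, Prod.smul_snd, Prod.fst_sub, Prod.snd_sub, smul_eq_mul] <;> ring
  rw [← segment_eq_Icc hab, h a, h b, ← image_segment]
  exact Set.image_congr fun τ _ => (h τ).symm

theorem slopeRay_linePoint_true (κ : Fin n → ℝ) (i j : Fin n) (a : ℝ) {d : Prop} (hd : d) :
    slopeRay (linePoint κ i j a) (κ i + κ j) d = linePoint κ i j '' Set.Ici a := by
  ext q
  simp only [slopeRay, if_pos hd, Set.mem_ofPred, Set.mem_image, Set.mem_Ici]
  constructor
  · rintro ⟨t, ht, rfl⟩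
    exact ⟨a + t, by linarith, linePoint_add κ i j a t⟩
  · rintro ⟨τ, hτ, rfl⟩
    exact ⟨τ - a, by linarith, by rw [← linePoint_add, add_sub_cancel]⟩

theorem slopeRay_linePoint_false (κ : Fin n → ℝ) (i j : Fin n) (a : ℝ) {d : Prop} (hd : ¬ d) :
    slopeRay (linePoint κ i j a) (κ i + κ j) d = linePoint κ i j '' Set.Iic a := by
  have hneg : ((-(κ i + κ j), 1) : ℝ × ℝ) = -(κ i + κ j, -1) := by simp
  ext q
  simp only [slopeRay, if_neg hd, Set.mem_ofPred, Set.mem_image, Set.mem_Iic, hneg, smul_neg,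
    ← neg_smul]
  constructor
  · rintro ⟨t, ht, rfl⟩
    exact ⟨a + -t, by linarith, linePoint_add κ i j a (-t)⟩
  · rintro ⟨τ, hτ, rfl⟩
    refine ⟨a - τ, by linarith, ?_⟩
    rw [← linePoint_add]
    congr 1
    ring

theorem range_linePoint (hκ : StrictMono κ) {i j : Fin n} (hij : i < j) :
    {p | phase κ i p = phase κ j p} = Set.range (linePoint κ i j) := by
  ext p
  constructor
  · intro h
    exact exists_linePoint hκ hij h
  · rintro ⟨τ, rfl⟩
    exact (phase_linePoint_eq κ i j τ).symm

end Lines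

theorem isClosed_setOf_two_isDominant {n : ℕ} (κ : Fin n → ℝ) (M : Finset (Finset (Fin n))) :
    IsClosed {p | ∃ J J', J ≠ J' ∧ IsDominant κ M p J ∧ IsDominant κ M p J'} := by
  have hc : ∀ J : Finset (Fin n), Continuous fun p : ℝ × ℝ => ∑ i ∈ J, phase κ i p := by
    intro J
    unfold phase
    fun_prop
  have hJ : ∀ J, IsClosed {p | IsDominant κ M p J} := by
    intro J
    have : {p | IsDominant κ M p J} = {p | J ∈ M} ∩
        ⋂ I ∈ M, {p : ℝ × ℝ | ∑ i ∈ J, phase κ i p ≤ ∑ i ∈ I, phase κ i p} := by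
      ext p
      simp [IsDominant]
    rw [this]
    exact isClosed_const.inter (isClosed_biInter fun I _ => isClosed_le (hc J) (hc I))
  have : {p | ∃ J J', J ≠ J' ∧ IsDominant κ M p J ∧ IsDominant κ M p J'} =
      ⋃ q : {q : Finset (Fin n) × Finset (Fin n) // q.1 ≠ q.2},
        {p | IsDominant κ M p q.1.1} ∩ {p | IsDominant κ M p q.1.2} := by
    ext p
    simp only [Set.mem_ofPred, Set.mem_iUnion, Set.mem_inter_iff]
    exact ⟨fun ⟨J, J', h, h'⟩ => ⟨⟨(J, J'), h⟩, h'⟩, fun ⟨q, h⟩ => ⟨q.1.1, q.1.2, q.2, h⟩⟩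
  rw [this]
  exact isClosed_iUnion_of_finite fun q => (hJ _).inter (hJ _)

namespace LeDiagram

variable {k m : ℕ} {L : LeDiagram k m} {κ : Fin (k + m) → ℝ}
  {A : Matrix (Fin k) (Fin (k + m)) ℝ} {M : Finset (Finset (Fin (k + m)))}

theorem placedEdge_eq (hκ : StrictMono κ) (hπ : Function.Bijective L.perm) (e : L.plabicMinus.E) :
    L.plabicMinus.placedEdge κ (L.vertexPos κ) e =
      linePoint κ (L.tripLabel e false) (L.tripLabel e true) '' L.edgeParams κ e := by
  have hij := tripLabel_lt e
  ext x
  have hx : ∀ T : Fin (k + m) → Fin (k + m) → Set (ℝ × ℝ),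
      (∃ i j, L.plabicMinus.HasType e i j ∧ x ∈ T i j) ↔
        x ∈ T (L.tripLabel e false) (L.tripLabel e true) := by
    intro T
    constructor
    · rintro ⟨i, j, h, hx⟩
      obtain ⟨rfl, rfl⟩ := hasType_iff.1 h
      exact hx
    · exact fun h => ⟨_, _, hasType_tripLabel e, h⟩
  unfold PlabicData.placedEdge
  rw [Set.mem_ofPred]
  refine (hx _).trans ?_
  clear hx
  have hpos : ∀ (v : L.White ⊕ L.Black) (p : Fin 3) (s : Bool),
      L.plabicMinus.attach e s = Sum.inl (v, p) → L.vertexPos κ v =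
        linePoint κ (L.tripLabel e false) (L.tripLabel e true) (κ (L.thirdLabel v p)) :=
    fun v p s h => vertexPos_eq_linePoint h
  rcases hf : L.plabicMinus.attach e false with ⟨v, p⟩ | b <;>
    rcases ht : L.plabicMinus.attach e true with ⟨w, q⟩ | b' <;>
    simp only
  · have hE : L.edgeParams κ e = Set.Icc (κ (L.thirdLabel v p)) (κ (L.thirdLabel w q)) := by
      ext τ
      simp only [edgeParams, hf, ht]
      exact and_congr ⟨fun h => h v p rfl, fun h v' p' h' => by
        obtain ⟨rfl, rfl⟩ := place_inj h'; exact h⟩ ⟨fun h => h w q rfl, fun h v' p' h' => by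
        obtain ⟨rfl, rfl⟩ := place_inj h'; exact h⟩
    rw [hE, hpos v p _ hf, hpos w q _ ht, segment_linePoint _ _ _ (thirdLabel_lt hκ hf ht).le]
  · have hE : L.edgeParams κ e = Set.Ici (κ (L.thirdLabel v p)) := by
      ext τ
      simp only [edgeParams, hf, ht]
      exact (and_iff_left fun v' p' h' => by simp at h').trans ⟨fun h => h v p rfl, fun h v' p' h' => by
        obtain ⟨rfl, rfl⟩ := place_inj h'; exact h⟩
    rw [hE, hpos v p _ hf, slopeRay_linePoint_true _ _ _ _ ((top_iff_of_attach hπ ht).2 rfl)]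
  · have hE : L.edgeParams κ e = Set.Iic (κ (L.thirdLabel w q)) := by
      ext τ
      simp only [edgeParams, hf, ht]
      exact (and_iff_right fun v' p' h' => by simp at h').trans ⟨fun h => h w q rfl, fun h v' p' h' => by
        obtain ⟨rfl, rfl⟩ := place_inj h'; exact h⟩
    rw [hE, hpos w q _ ht, slopeRay_linePoint_false _ _ _ _
      (fun h => Bool.false_ne_true ((top_iff_of_attach hπ hf).1 h))]
  · have hE : L.edgeParams κ e = Set.univ := by
      ext τ
      simp only [edgeParams, hf, ht]
      exact iff_of_true ⟨fun v' p' h' => by simp at h', fun v' p' h' => by simp at h'⟩ trivial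
    rw [hE, range_linePoint hκ hij, Set.image_univ]

theorem vertexPos_injective (hκ : GenericParameters κ) : Function.Injective (L.vertexPos κ) := by
  intro v v' h
  have h1 := congrArg Prod.snd h
  simp only [vertexPos, vertexPoint, neg_inj] at h1
  obtain ⟨h2, h3, h4⟩ := hκ.triple_eq (rowLabel_lt_midLabel v) (midLabel_lt_colLabel v)
    (rowLabel_lt_midLabel v') (midLabel_lt_colLabel v') h1
  have h5 : L.vertexBox v = L.vertexBox v' :=
    Prod.ext (L.rowLabel_strictMono.injective h2) (L.colLabel_strictAnti.injective h4)
  rcases v with w | v <;> rcases v' with w' | v'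
  · exact congrArg Sum.inl (Subtype.ext h5)
  · have h6 : L.east w.1 = L.south v'.1 := h3
    rw [show w.1 = v'.1 from h5] at h6
    exact absurd h6 (east_lt_south v'.2.1).ne
  · have h6 : L.south v.1 = L.east w'.1 := h3
    rw [show v.1 = w'.1 from h5] at h6
    exact absurd h6 (east_lt_south w'.2.1).ne'
  · exact congrArg Sum.inr (Subtype.ext h5)

/-- Two edges with the same labels do not overlap. -/
theorem eq_of_mem_edgeParams (hκ : StrictMono κ) {e e' : L.plabicMinus.E} {τ : ℝ}
    (h : τ ∈ L.edgeParams κ e) (h' : τ ∈ L.edgeParams κ e')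
    (hf : L.tripLabel e false = L.tripLabel e' false) (ht : L.tripLabel e true = L.tripLabel e' true)
    (hg : ∀ s, κ s ≠ τ) : e = e' := by
  have hp := piece_of_mem_edgeParams hκ h
  have hp' := piece_of_mem_edgeParams hκ h'
  rcases lt_or_gt_of_ne (hg (L.tripLabel e false)) with h1 | h1
  · rcases lt_or_gt_of_ne (hg (L.tripLabel e true)) with h2 | h2
    · obtain ⟨⟨r, c⟩, hb, h3, -, hW, h4⟩ := hp.2.2 h2
      obtain ⟨⟨r', c'⟩, hb', h5, -, hW', h6⟩ := hp'.2.2 (by rw [← ht]; exact h2)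
      obtain rfl : r = r' := L.rowLabel_strictMono.injective (by rw [h3, h5] at hf; exact hf)
      obtain rfl : c = c' := by
        rcases lt_trichotomy c c' with h7 | h7 | h7
        · exact absurd (le_antisymm hW.1 (hW'.2 c h7 hb)) (hg _)
        · exact h7
        · exact absurd (le_antisymm hW'.1 (hW.2 c' h7 hb')) (hg _)
      rcases h4 with ⟨h4, h7, h8⟩ | ⟨h7, h4, h8⟩ | ⟨h7, h4⟩ <;>
        rcases h6 with ⟨h6, h9, h10⟩ | ⟨h9, h6, h10⟩ | ⟨h9, h6⟩ <;>
        first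
        | exact h4.trans h6.symm
        | exact absurd ‹L.HasRight _› ‹¬ L.HasRight _›
        | exact absurd ‹L.HasBelow _› ‹¬ L.HasBelow _›
    · obtain ⟨⟨r, c⟩, hb, h3, h3', -, h4⟩ := hp.2.1 h1 h2
      obtain ⟨⟨r', c'⟩, hb', h5, h5', -, h6⟩ :=
        hp'.2.1 (by rw [← hf]; exact h1) (by rw [← ht]; exact h2)
      obtain rfl : r = r' := L.rowLabel_strictMono.injective (by rw [h3, h5] at hf; exact hf)
      obtain rfl : c = c' := L.colLabel_strictAnti.injective (by rw [h3', h5'] at ht; exact ht)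
      rcases h4 with ⟨h4, h7⟩ | ⟨h7, h4⟩ <;> rcases h6 with ⟨h6, h8⟩ | ⟨h8, h6⟩ <;>
        first
        | exact h4.trans h6.symm
        | exact absurd ‹L.HasRight _› ‹¬ L.HasRight _›
  · obtain ⟨⟨r, c⟩, hb, h3, hN⟩ := hp.1 h1
    obtain ⟨⟨r', c'⟩, hb', h5, hN'⟩ := hp'.1 (by rw [← hf]; exact h1)
    obtain rfl : c = c' := L.colLabel_strictAnti.injective (by rw [h3, h5] at ht; exact ht)
    obtain rfl : r = r' := by
      rcases lt_trichotomy r r' with h7 | h7 | h7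
      · exact absurd (le_antisymm (hN'.2 r h7 hb) hN.1) (hg _)
      · exact h7
      · exact absurd (le_antisymm (hN.2 r' h7 hb') hN'.1) (hg _)
    rw [h3, h5]

theorem mem_closure_generic (hκ : StrictMono κ) {e : L.plabicMinus.E} {τ : ℝ}
    (hτ : τ ∈ L.edgeParams κ e) {F : Set ℝ} (hF : F.Finite) :
    τ ∈ closure (L.edgeParams κ e ∩ Fᶜ) := by
  obtain ⟨a, b, hab, hE⟩ := exists_Icc_subset_edgeParams hκ e
  have hconv : Convex ℝ (L.edgeParams κ e) := (edgeParams_ordConnected e).convex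
  have hint : (interior (L.edgeParams κ e)).Nonempty :=
    ⟨(a + b) / 2, interior_mono (Set.Ioo_subset_Icc_self.trans hE)
      (by rw [isOpen_Ioo.interior_eq]; constructor <;> linarith)⟩
  have h1 : τ ∈ closure (interior (L.edgeParams κ e)) := by
    rw [hconv.closure_interior_eq_closure_of_nonempty_interior hint]
    exact subset_closure hτ
  have h2 := (hF.countable.dense_compl ℝ).open_subset_closure_inter
    (isOpen_interior (s := L.edgeParams κ e))
  exact closure_minimal (h2.trans (closure_mono (Set.inter_subset_inter_left _ interior_subset)))
    isClosed_closure h1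

theorem iUnion_placedEdge (hκ : GenericParameters κ) (hA : A ∈ positroidCell k M) (hM : M.Nonempty)
    (hL : L.Matches A) (hπ : Function.Bijective L.perm) :
    ⋃ e, L.plabicMinus.placedEdge κ (L.vertexPos κ) e =
      {p | ∃ J J', J ≠ J' ∧ IsDominant κ M p J ∧ IsDominant κ M p J'} := by
  ext p
  simp only [Set.mem_iUnion, placedEdge_eq hκ.1 hπ]
  constructor
  · rintro ⟨e, τ, hτ, rfl⟩
    have h1 := mem_closure_generic hκ.1 hτ (finite_nongeneric hκ (tripLabel_lt e))
    have h2 := image_closure_subset_closure_image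
      (continuous_linePoint κ (L.tripLabel e false) (L.tripLabel e true)) (Set.mem_image_of_mem _ h1)
    refine closure_minimal ?_ (isClosed_setOf_two_isDominant κ M) h2
    rintro - ⟨τ', ⟨h3, h4⟩, rfl⟩
    obtain ⟨S, h5, h6, h7⟩ := isSolitonPoint_linePoint hκ.1 hA hM hL h3 h4
    refine ⟨_, _, fun h8 => ?_, (h7 _).2 (Or.inl rfl), (h7 _).2 (Or.inr rfl)⟩
    have h9 := h8 ▸ Finset.mem_insert_self (L.tripLabel e false) S
    rcases Finset.mem_insert.1 h9 with h9 | h9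
    · exact (tripLabel_lt e).ne h9
    · exact h5 h9
  · rintro ⟨J, J', hne, hJ, hJ'⟩
    obtain ⟨e, τ, hτ, h⟩ := exists_mem_edgeParams_of_ne hκ.1 hA hL hJ hJ' hne
    exact ⟨e, τ, hτ, h⟩

theorem finite_not_isSolitonPoint (hκ : GenericParameters κ) (hA : A ∈ positroidCell k M)
    (hM : M.Nonempty) (hL : L.Matches A) (hπ : Function.Bijective L.perm) {e : L.plabicMinus.E}
    {i j : Fin (k + m)} (h : L.plabicMinus.HasType e i j) :
    {p ∈ L.plabicMinus.placedEdge κ (L.vertexPos κ) e | ¬ IsSolitonPoint κ M i j p}.Finite := by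
  obtain ⟨rfl, rfl⟩ := hasType_iff.1 h
  refine ((finite_nongeneric hκ (tripLabel_lt e)).image
    (linePoint κ (L.tripLabel e false) (L.tripLabel e true))).subset ?_
  rintro p ⟨hp, hns⟩
  rw [placedEdge_eq hκ.1 hπ] at hp
  obtain ⟨τ, hτ, rfl⟩ := hp
  refine ⟨τ, ?_, rfl⟩
  by_contra hg
  exact hns (isSolitonPoint_linePoint hκ.1 hA hM hL hτ hg)

theorem placedEdge_inter_subsingleton (hκ : GenericParameters κ) (hπ : Function.Bijective L.perm)
    {e e' : L.plabicMinus.E} (hne : e ≠ e') :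
    (L.plabicMinus.placedEdge κ (L.vertexPos κ) e ∩
      L.plabicMinus.placedEdge κ (L.vertexPos κ) e').Subsingleton := by
  rw [placedEdge_eq hκ.1 hπ, placedEdge_eq hκ.1 hπ]
  by_cases hs : κ (L.tripLabel e false) + κ (L.tripLabel e true) =
      κ (L.tripLabel e' false) + κ (L.tripLabel e' true)
  · obtain ⟨hf, ht⟩ : L.tripLabel e false = L.tripLabel e' false ∧
        L.tripLabel e true = L.tripLabel e' true := by
      have h1 := tripLabel_lt e
      have h2 := tripLabel_lt e'
      rcases hκ.pair_eq h2.ne h1.ne hs with h | ⟨h3, h4⟩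
      · exact h
      · rw [h3, h4] at h1
        exact absurd h1 h2.not_gt
    rw [hf, ht, ← Set.image_inter (linePoint_injective κ _ _)]
    refine Set.Subsingleton.image (fun τ₁ h₁ τ₂ h₂ => ?_) _
    have hlt : ∀ {τ₁ τ₂ : ℝ}, τ₁ ∈ L.edgeParams κ e ∩ L.edgeParams κ e' →
        τ₂ ∈ L.edgeParams κ e ∩ L.edgeParams κ e' → ¬ τ₁ < τ₂ := by
      intro τ₁ τ₂ h₁ h₂ hlt
      obtain ⟨τ, hτ, hg⟩ := ((Set.Ioo_infinite hlt).sdiff (Set.finite_range κ)).nonempty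
      exact hne (eq_of_mem_edgeParams hκ.1
        ((edgeParams_ordConnected e).out h₁.1 h₂.1 (Set.Ioo_subset_Icc_self hτ))
        ((edgeParams_ordConnected e').out h₁.2 h₂.2 (Set.Ioo_subset_Icc_self hτ)) hf ht
        fun s hs => hg ⟨s, hs⟩)
    exact le_antisymm (not_lt.1 (hlt h₂ h₁)) (not_lt.1 (hlt h₁ h₂))
  · rintro p ⟨h1, h2⟩ q ⟨h3, h4⟩
    exact linePoint_eq_of_sum_ne hs (Set.image_subset_range _ _ h1) (Set.image_subset_range _ _ h2)
      (Set.image_subset_range _ _ h3) (Set.image_subset_range _ _ h4)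

theorem slope_of_attach (hκ : StrictMono κ) {e : L.plabicMinus.E} {v w : L.White ⊕ L.Black}
    {p q : Fin 3} {i j : Fin (k + m)} (hv : L.plabicMinus.attach e false = Sum.inl (v, p))
    (hw : L.plabicMinus.attach e true = Sum.inl (w, q)) (h : L.plabicMinus.HasType e i j) :
    L.vertexPos κ v ≠ L.vertexPos κ w ∧
      (L.vertexPos κ v).1 + (κ i + κ j) * (L.vertexPos κ v).2 =
        (L.vertexPos κ w).1 + (κ i + κ j) * (L.vertexPos κ w).2 := by
  obtain ⟨rfl, rfl⟩ := hasType_iff.1 h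
  rw [vertexPos_eq_linePoint hv, vertexPos_eq_linePoint hw]
  exact ⟨fun h => (thirdLabel_lt hκ hv hw).ne (linePoint_injective κ _ _ h), by
    rw [linePoint_fst_add, linePoint_fst_add]⟩

/-- Along an edge, the coordinate `ȳ` decreases from the end `false` to the end `true`. -/
theorem direction_of_attach (hκ : StrictMono κ) (hπ : Function.Bijective L.perm)
    {e : L.plabicMinus.E} {s : Bool} {v : L.White ⊕ L.Black} {p : Fin 3}
    (hv : L.plabicMinus.attach e s = Sum.inl (v, p)) {x : ℝ × ℝ}
    (hx : x ∈ L.plabicMinus.placedEdge κ (L.vertexPos κ) e) :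
    (s = true → (L.vertexPos κ v).2 ≤ x.2) ∧ (¬ s = true → x.2 ≤ (L.vertexPos κ v).2) := by
  rw [placedEdge_eq hκ hπ] at hx
  obtain ⟨τ, hτ, rfl⟩ := hx
  rw [vertexPos_eq_linePoint hv]
  simp only [linePoint]
  constructor
  · rintro rfl
    linarith [hτ.2 v p hv]
  · intro hs
    obtain rfl : s = false := by simpa using hs
    linarith [hτ.1 v p hv]

end LeDiagram

/-! ### Tropical curves and their perturbations -/

section Tropical

variable {ι : Type*} {a b c c' : ι → ℝ}

/-- The affine function with the coefficients `a J`, `b J`, `c J`. -/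
def affineForm (a b c : ι → ℝ) (J : ι) (p : ℝ × ℝ) : ℝ := a J * p.1 + b J * p.2 + c J

/-- The set of points at which at least two of the affine functions attain the minimum. -/
def tropicalCurve (a b c : ι → ℝ) : Set (ℝ × ℝ) :=
  {p | ∃ J J', J ≠ J' ∧ (∀ I, affineForm a b c J p ≤ affineForm a b c I p) ∧
    ∀ I, affineForm a b c J' p ≤ affineForm a b c I p}

theorem continuous_affineForm (J : ι) : Continuous (affineForm a b c J) := by
  unfold affineForm
  fun_prop

theorem nonlinearLocus_neg (f : ℝ × ℝ → ℝ) : nonlinearLocus (fun p => -f p) = nonlinearLocus f := by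
  have key : ∀ (f : ℝ × ℝ → ℝ) (p : ℝ × ℝ),
      (∃ a b c : ℝ, ∀ᶠ q in 𝓝 p, f q = a * q.1 + b * q.2 + c) →
      ∃ a b c : ℝ, ∀ᶠ q in 𝓝 p, -f q = a * q.1 + b * q.2 + c := by
    rintro f p ⟨a, b, c, h⟩
    refine ⟨-a, -b, -c, h.mono fun q hq => ?_⟩
    rw [hq]
    ring
  ext p
  refine not_congr ⟨fun h => ?_, key f p⟩
  simpa using key _ p h

/-- An affine function that agrees with a minimum of affine functions near a point has the same coefficients
as each function that attains the minimum there. -/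
theorem eq_of_eventually_le {α β γ α' β' γ' : ℝ} {p : ℝ × ℝ}
    (h : ∀ᶠ q : ℝ × ℝ in 𝓝 p, α' * q.1 + β' * q.2 + γ' ≤ α * q.1 + β * q.2 + γ)
    (hp : α * p.1 + β * p.2 + γ = α' * p.1 + β' * p.2 + γ') : α = α' := by
  have hmin : IsLocalMin (fun x : ℝ => (α - α') * x) p.1 := by
    have ht : Tendsto (fun x : ℝ => (x, p.2)) (𝓝 p.1) (𝓝 p) := by
      have : Continuous fun x : ℝ => (x, p.2) := by fun_prop
      exact this.tendsto p.1
    filter_upwards [ht.eventually h] with x hx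
    linarith
  have hd : HasDerivAt (fun x : ℝ => (α - α') * x) (α - α') p.1 := by
    simpa using (hasDerivAt_id p.1).const_mul (α - α')
  exact sub_eq_zero.1 (hmin.hasDerivAt_eq_zero hd)

theorem nonlinearLocus_eq_tropicalCurve [Finite ι] (ha : Function.Injective a) {f : ℝ × ℝ → ℝ}
    (hle : ∀ p J, f p ≤ affineForm a b c J p) (hex : ∀ p, ∃ J, f p = affineForm a b c J p) :
    nonlinearLocus f = tropicalCurve a b c := by
  ext p
  constructor
  · intro hp
    by_contra hcon
    obtain ⟨J, hJ⟩ := hex p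
    refine hp ⟨a J, b J, c J, ?_⟩
    have h1 : ∀ I, ∀ᶠ q in 𝓝 p, I ≠ J → affineForm a b c J q < affineForm a b c I q := by
      intro I
      by_cases hIJ : I = J
      · exact Eventually.of_forall fun q h => absurd hIJ h
      have h2 : affineForm a b c J p < affineForm a b c I p := by
        refine lt_of_le_of_ne (hJ ▸ hle p I) fun h => hcon ⟨J, I, Ne.symm hIJ, ?_, ?_⟩
        · exact fun K => hJ ▸ hle p K
        · exact fun K => h ▸ hJ ▸ hle p K
      exact ((continuous_affineForm J).continuousAt.eventually_lt
        (continuous_affineForm I).continuousAt h2).mono fun q h _ => h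
    filter_upwards [eventually_all.2 h1] with q hq
    obtain ⟨I, hI⟩ := hex q
    by_cases hIJ : I = J
    · rw [hI, hIJ]; rfl
    · exact absurd (hI ▸ hle q J) (hq I hIJ).not_ge
  · rintro ⟨J, J', hne, hJ, hJ'⟩ ⟨α, β, γ, h⟩
    have key : ∀ J, (∀ I, affineForm a b c J p ≤ affineForm a b c I p) → a J = α := by
      intro J hJ
      refine eq_of_eventually_le (h.mono fun q hq => hq ▸ hle q J) ?_
      obtain ⟨I, hI⟩ := hex p
      have h1 := h.self_of_nhds
      rw [← h1]
      exact le_antisymm (hI ▸ hJ I) (hle p J)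
    exact hne (ha ((key J hJ).trans (key J' hJ').symm))

/-- If the constant terms are changed by at most `δ`, then each point of the tropical curve has a point of
the new curve at distance at most `R`, when the `x`-slopes differ by at least `μ` and `2 δ < μ R`. -/
theorem exists_mem_tropicalCurve_dist_le [Finite ι] {δ μ R : ℝ} (hR : 0 ≤ R)
    (hc : ∀ J, |c J - c' J| ≤ δ) (hμ : ∀ J J', J ≠ J' → μ ≤ |a J - a J'|) (hδ : 2 * δ < μ * R)
    {p : ℝ × ℝ} (hp : p ∈ tropicalCurve a b c) : ∃ q ∈ tropicalCurve a b c', dist p q ≤ R := by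
  obtain ⟨J₁, J₂, hne, h₁, h₂⟩ := hp
  have : Nonempty ι := ⟨J₁⟩
  obtain ⟨J, hJ⟩ := Finite.exists_min fun J => affineForm a b c' J p
  obtain ⟨K, hKJ, hK⟩ : ∃ K, K ≠ J ∧ affineForm a b c K p ≤ affineForm a b c J p := by
    by_cases h : J₁ = J
    · exact ⟨J₂, fun h' => hne (h.trans h'.symm), h₂ J⟩
    · exact ⟨J₁, h, h₁ J⟩
  -- moving horizontally by `R` in the direction that favours `K` makes `K` smaller than `J`
  obtain ⟨s, hs, hsR⟩ : ∃ s : ℝ, |s| ≤ R ∧ (a K - a J) * s ≤ -(μ * R) := by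
    have h3 := mul_le_mul_of_nonneg_right (hμ K J hKJ) hR
    rcases le_total 0 (a K - a J) with h | h
    · refine ⟨-R, by rw [abs_neg, abs_of_nonneg hR], ?_⟩
      rw [abs_of_nonneg h] at h3
      linarith
    · refine ⟨R, (abs_of_nonneg hR).le, ?_⟩
      rw [abs_of_nonpos h] at h3
      linarith
  have hlt : affineForm a b c' K (p.1 + s, p.2) < affineForm a b c' J (p.1 + s, p.2) := by
    have h4 := abs_le.1 (hc K)
    have h5 := abs_le.1 (hc J)
    simp only [affineForm] at hK ⊢
    linarith
  have hclosed : ∀ I, IsClosed {q | ∀ I', affineForm a b c' I q ≤ affineForm a b c' I' q} := by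
    intro I
    simp only [Set.ofPred_forall]
    exact isClosed_iInter fun I' => isClosed_le (continuous_affineForm I) (continuous_affineForm I')
  have hconn : IsPreconnected (segment ℝ p (p.1 + s, p.2)) := (convex_segment _ _).isPreconnected
  obtain ⟨q, hq, hqJ, hqI⟩ := isPreconnected_closed_iff.1 hconn
    {q | ∀ I', affineForm a b c' J q ≤ affineForm a b c' I' q}
    (⋃ I : {I // I ≠ J}, {q | ∀ I', affineForm a b c' I q ≤ affineForm a b c' I' q}) (hclosed J)
    (isClosed_iUnion_of_finite fun I => hclosed I)
    (fun q _ => by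
      obtain ⟨I, hI⟩ := Finite.exists_min fun J => affineForm a b c' J q
      by_cases h : I = J
      · exact Or.inl (h ▸ hI)
      · exact Or.inr (Set.mem_iUnion.2 ⟨⟨I, h⟩, hI⟩))
    ⟨p, left_mem_segment ℝ _ _, hJ⟩
    (by
      refine ⟨_, right_mem_segment ℝ _ _, ?_⟩
      obtain ⟨I, hI⟩ := Finite.exists_min fun J => affineForm a b c' J (p.1 + s, p.2)
      refine Set.mem_iUnion.2 ⟨⟨I, ?_⟩, hI⟩
      rintro rfl
      exact absurd (hI K) hlt.not_ge)
  obtain ⟨⟨I, hIJ⟩, hI⟩ := Set.mem_iUnion.1 hqI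
  refine ⟨q, ⟨J, I, hIJ.symm, hqJ, hI⟩, ?_⟩
  obtain ⟨u, v, hu, hv, huv, rfl⟩ := hq
  obtain rfl : u = 1 - v := by linarith
  rw [Prod.dist_eq, Real.dist_eq, Real.dist_eq]
  simp only [Prod.fst_add, Prod.snd_add, Prod.smul_fst, Prod.smul_snd, smul_eq_mul]
  rw [show p.1 - ((1 - v) * p.1 + v * (p.1 + s)) = -(v * s) by ring,
    show p.2 - ((1 - v) * p.2 + v * p.2) = 0 by ring, abs_zero, abs_neg, abs_mul, abs_of_nonneg hv]
  exact max_le ((mul_le_of_le_one_left (abs_nonneg s) (by linarith)).trans hs) hR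

theorem exists_pos_le_abs_sub [Finite ι] (ha : Function.Injective a) :
    ∃ μ > 0, ∀ J J', J ≠ J' → μ ≤ |a J - a J'| := by
  rcases isEmpty_or_nonempty {q : ι × ι // q.1 ≠ q.2} with h | h
  · exact ⟨1, one_pos, fun J J' hJ => (h.false ⟨(J, J'), hJ⟩).elim⟩
  · obtain ⟨q, hq⟩ := Finite.exists_min fun q : {q : ι × ι // q.1 ≠ q.2} => |a q.1.1 - a q.1.2|
    exact ⟨_, abs_pos.2 (sub_ne_zero.2 fun h => q.2 (ha h)), fun J J' hJ => hq ⟨(J, J'), hJ⟩⟩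

theorem tendsto_hausdorffEDist_tropicalCurve [Finite ι] (ha : Function.Injective a) (d : ι → ℝ) :
    Tendsto (fun t : ℝ => Metric.hausdorffEDist (tropicalCurve a b fun J => c J + d J / t)
      (tropicalCurve a b c)) atBot (𝓝 0) := by
  obtain ⟨μ, hμ0, hμ⟩ := exists_pos_le_abs_sub ha
  rw [ENNReal.tendsto_nhds_zero]
  intro ε hε
  obtain ⟨R, hR0, hRε⟩ := ENNReal.lt_iff_exists_nnreal_btwn.1 hε
  have hR : (0 : ℝ) < R := by exact_mod_cast hR0
  have hd : ∀ J, ∀ᶠ t : ℝ in atBot, |d J / t| ≤ μ * R / 4 := by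
    intro J
    have h1 : Tendsto (fun t : ℝ => d J / t) atBot (𝓝 0) :=
      tendsto_const_nhds.div_atBot tendsto_id
    have h2 := h1.abs
    rw [abs_zero] at h2
    exact h2.eventually_le_const (by positivity)
  filter_upwards [eventually_all.2 hd] with t ht
  have h2 : 2 * (μ * R / 4) < μ * R := by
    have : 0 < μ * R := by positivity
    linarith
  refine (Metric.hausdorffEDist_le_of_mem_edist (r := (R : ENNReal)) ?_ ?_).trans hRε.le
  · intro p hp
    obtain ⟨q, hq, hpq⟩ := exists_mem_tropicalCurve_dist_le (c' := c) hR.le (fun J => by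
      rw [add_sub_cancel_left]; exact ht J) hμ h2 hp
    exact ⟨q, hq, by rw [edist_nndist]; exact_mod_cast hpq⟩
  · intro p hp
    obtain ⟨q, hq, hpq⟩ := exists_mem_tropicalCurve_dist_le (c' := fun J => c J + d J / t) hR.le
      (fun J => by rw [sub_add_cancel_left, abs_neg]; exact ht J) hμ h2 hp
    exact ⟨q, hq, by rw [edist_nndist]; exact_mod_cast hpq⟩

end Tropical

/-! ### Contour plots as tropical curves -/

section ContourPlots

variable {k n : ℕ} {κ : Fin n → ℝ} {M : Finset (Finset (Fin n))} {A : Matrix (Fin k) (Fin n) ℝ}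

theorem sum_injective_of_mem_positroidCell (hκ : GenericParameters κ) (hA : A ∈ positroidCell k M) :
    Function.Injective fun J : {J : Finset (Fin n) // J ∈ M} => ∑ i ∈ J.1, κ i := by
  intro J J' h
  refine Subtype.ext (hκ.eq_of_sum_eq ?_ h)
  rw [((mem_iff_of_mem_positroidCell hA).1 J.2).1, ((mem_iff_of_mem_positroidCell hA).1 J'.2).1]

theorem sum_phase_eq (J : {J : Finset (Fin n) // J ∈ M}) (p : ℝ × ℝ) :
    ∑ i ∈ J.1, phase κ i p = affineForm (fun J : {J : Finset (Fin n) // J ∈ M} => ∑ i ∈ J.1, κ i)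
      (fun J => ∑ i ∈ J.1, κ i ^ 2) (fun J => ∑ i ∈ J.1, κ i ^ 3) J p := by
  simp only [phase, affineForm, Finset.sum_add_distrib, Finset.sum_mul]

theorem contourPlotMinusInfty_eq_tropicalCurve (hκ : GenericParameters κ)
    (hA : A ∈ positroidCell k M) (hM : M.Nonempty) : contourPlotMinusInfty κ M =
      tropicalCurve (fun J : {J : Finset (Fin n) // J ∈ M} => ∑ i ∈ J.1, κ i)
        (fun J => ∑ i ∈ J.1, κ i ^ 2) (fun J => ∑ i ∈ J.1, κ i ^ 3) := by
  have : Nonempty {J : Finset (Fin n) // J ∈ M} := hM.to_subtype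
  refine nonlinearLocus_eq_tropicalCurve (sum_injective_of_mem_positroidCell hκ hA) ?_ ?_
  · intro p J
    rw [← sum_phase_eq]
    exact ciInf_le (Set.finite_range _).bddBelow J
  · intro p
    obtain ⟨J, hJ⟩ := exists_eq_ciInf_of_finite
      (f := fun J : {J : Finset (Fin n) // J ∈ M} => ∑ i ∈ J.1, phase κ i p)
    exact ⟨J, by rw [← sum_phase_eq]; exact hJ.symm⟩

theorem contourPlotMinusInfty_eq (hκ : GenericParameters κ) (hA : A ∈ positroidCell k M)
    (hM : M.Nonempty) : contourPlotMinusInfty κ M =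
      {p | ∃ J J', J ≠ J' ∧ IsDominant κ M p J ∧ IsDominant κ M p J'} := by
  rw [contourPlotMinusInfty_eq_tropicalCurve hκ hA hM]
  ext p
  simp only [tropicalCurve, Set.mem_ofPred, ← sum_phase_eq]
  constructor
  · rintro ⟨J, J', hne, hJ, hJ'⟩
    exact ⟨J, J', fun h => hne (Subtype.ext h), ⟨J.2, fun I hI => hJ ⟨I, hI⟩⟩,
      ⟨J'.2, fun I hI => hJ' ⟨I, hI⟩⟩⟩
  · rintro ⟨J, J', hne, hJ, hJ'⟩
    exact ⟨⟨J, hJ.1⟩, ⟨J', hJ'.1⟩, fun h => hne (congrArg Subtype.val h),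
      fun I => hJ.2 I I.2, fun I => hJ'.2 I I.2⟩

/-- The constant `ln (Δ_J(A) K_J)` in the exponent of the term of `J`. -/
def logWeight (κ : Fin n → ℝ) (A : Matrix (Fin k) (Fin n) ℝ) (J : Finset (Fin n)) : ℝ :=
  Real.log (pluckerCoord A J * ∏ q ∈ (J ×ˢ J).filter (fun q => q.1 < q.2), (κ q.2 - κ q.1))

/-- The rescaled contour plot at a negative time is a tropical curve whose constant terms differ from those
of the limit by multiples of `1 / t`. -/
theorem rescaled_contourPlot_eq (hκ : GenericParameters κ) (hA : A ∈ positroidCell k M)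
    (hM : M.Nonempty) {t : ℝ} (ht : t < 0) :
    {p : ℝ × ℝ | (t * p.1, t * p.2) ∈ contourPlot κ M A t} =
      tropicalCurve (fun J : {J : Finset (Fin n) // J ∈ M} => ∑ i ∈ J.1, κ i)
        (fun J => ∑ i ∈ J.1, κ i ^ 2) (fun J => ∑ i ∈ J.1, κ i ^ 3 + logWeight κ A J.1 / t) := by
  have : Nonempty {J : Finset (Fin n) // J ∈ M} := hM.to_subtype
  have hform : ∀ (J : {J : Finset (Fin n) // J ∈ M}) (p : ℝ × ℝ),
      -(logWeight κ A J.1 + ∑ i ∈ J.1, (κ i * p.1 + κ i ^ 2 * p.2 + κ i ^ 3 * t)) =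
        affineForm (fun J : {J : Finset (Fin n) // J ∈ M} => -∑ i ∈ J.1, κ i)
          (fun J => -∑ i ∈ J.1, κ i ^ 2) (fun J => -(logWeight κ A J.1 + (∑ i ∈ J.1, κ i ^ 3) * t)) J p := by
    intro J p
    simp only [affineForm, Finset.sum_add_distrib, ← Finset.sum_mul]
    ring
  have hplot : contourPlot κ M A t = tropicalCurve
      (fun J : {J : Finset (Fin n) // J ∈ M} => -∑ i ∈ J.1, κ i)
      (fun J => -∑ i ∈ J.1, κ i ^ 2) (fun J => -(logWeight κ A J.1 + (∑ i ∈ J.1, κ i ^ 3) * t)) := by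
    have hinj : Function.Injective fun J : {J : Finset (Fin n) // J ∈ M} => -∑ i ∈ J.1, κ i :=
      neg_injective.comp (sum_injective_of_mem_positroidCell hκ hA)
    rw [contourPlot, ← nonlinearLocus_neg]
    refine nonlinearLocus_eq_tropicalCurve hinj ?_ ?_
    · intro p J
      rw [← hform, neg_le_neg_iff]
      exact le_ciSup (f := fun J : {J : Finset (Fin n) // J ∈ M} =>
        logWeight κ A J.1 + ∑ i ∈ J.1, (κ i * p.1 + κ i ^ 2 * p.2 + κ i ^ 3 * t)) (Set.finite_range _).bddAbove J
    · intro p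
      obtain ⟨J, hJ⟩ := exists_eq_ciSup_of_finite (f := fun J : {J : Finset (Fin n) // J ∈ M} =>
        logWeight κ A J.1 + ∑ i ∈ J.1, (κ i * p.1 + κ i ^ 2 * p.2 + κ i ^ 3 * t))
      exact ⟨J, by rw [← hform, hJ]; rfl⟩
  rw [hplot]
  have hscale : ∀ (J : {J : Finset (Fin n) // J ∈ M}) (p : ℝ × ℝ),
      affineForm (fun J : {J : Finset (Fin n) // J ∈ M} => -∑ i ∈ J.1, κ i)
        (fun J => -∑ i ∈ J.1, κ i ^ 2) (fun J => -(logWeight κ A J.1 + (∑ i ∈ J.1, κ i ^ 3) * t)) J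
        (t * p.1, t * p.2) =
      -t * affineForm (fun J : {J : Finset (Fin n) // J ∈ M} => ∑ i ∈ J.1, κ i)
        (fun J => ∑ i ∈ J.1, κ i ^ 2) (fun J => ∑ i ∈ J.1, κ i ^ 3 + logWeight κ A J.1 / t) J p := by
    intro J p
    have h := div_mul_cancel₀ (logWeight κ A J.1) ht.ne
    simp only [affineForm]
    linear_combination h
  ext p
  simp only [tropicalCurve, Set.mem_ofPred, hscale, mul_le_mul_iff_right₀ (neg_pos.2 ht)]

theorem tendsto_hausdorffEDist_contourPlot (hκ : GenericParameters κ) (hA : A ∈ positroidCell k M)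
    (hM : M.Nonempty) : Tendsto (fun t : ℝ => Metric.hausdorffEDist
      {p : ℝ × ℝ | (t * p.1, t * p.2) ∈ contourPlot κ M A t} (contourPlotMinusInfty κ M))
      atBot (𝓝 0) := by
  rw [contourPlotMinusInfty_eq_tropicalCurve hκ hA hM]
  refine Tendsto.congr' ?_ (tendsto_hausdorffEDist_tropicalCurve
    (b := fun J => ∑ i ∈ J.1, κ i ^ 2) (c := fun J => ∑ i ∈ J.1, κ i ^ 3)
    (sum_injective_of_mem_positroidCell hκ hA) fun J => logWeight κ A J.1)
  filter_upwards [eventually_lt_atBot 0] with t ht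
  rw [rescaled_contourPlot_eq hκ hA hM ht]

end ContourPlots

theorem IsNecklacePermutation.nonempty {k m : ℕ} {M : Finset (Finset (Fin (k + m)))}
    {A : Matrix (Fin k) (Fin (k + m)) ℝ} (hA : A ∈ positroidCell k M)
    {π : Fin (k + m) → Fin (k + m)} (hπ : IsNecklacePermutation M π) : M.Nonempty := by
  obtain ⟨I, hI, -⟩ := hπ
  rcases Nat.eq_zero_or_pos (k + m) with h | h
  · obtain rfl : k = 0 := by omega
    -- the empty minor is `1`
    refine ⟨∅, ?_⟩
    by_contra hcon
    have := hA.2.2 ∅ hcon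
    simp [pluckerCoord] at this
  · exact ⟨_, (hI ⟨0, h⟩).1⟩

end

theorem mainTheorem1 {k m : ℕ} (κ : Fin (k + m) → ℝ) (hκ : GenericParameters κ)
    (L : LeDiagram k m) (hL : L.Irreducible)
    (M : Finset (Finset (Fin (k + m)))) (hM : (positroidCell k M).Nonempty)
    (hML : IsNecklacePermutation M L.perm) :
    -- the graph and its trip permutation
    L.plabicMinus.IsGeneralizedPlabic ∧
    L.plabicMinus.IsTripPermutation L.perm ∧
    -- every edge carries exactly two labels
    (∀ e, ∃ i j, L.plabicMinus.HasType e i j) ∧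
    -- the drawing with the prescribed vertices is the limit contour plot
    (∃ pos : L.plabicMinus.V → ℝ × ℝ,
      (∀ v, ∃ i l m, i < l ∧ l < m ∧ L.plabicMinus.VertexHasType v i l m ∧
        pos v = vertexPoint κ i l m) ∧
      contourPlotMinusInfty κ M = ⋃ e, L.plabicMinus.placedEdge κ pos e ∧
      -- distinct vertices are placed at distinct points, distinct edges at most cross
      Function.Injective pos ∧
      (∀ e e', e ≠ e' →
        (L.plabicMinus.placedEdge κ pos e ∩ L.plabicMinus.placedEdge κ pos e').Subsingleton) ∧
      -- bounded edges automatically have the right slope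
      (∀ e v w p q i j, L.plabicMinus.attach e false = Sum.inl (v, p) →
        L.plabicMinus.attach e true = Sum.inl (w, q) → L.plabicMinus.HasType e i j →
        pos v ≠ pos w ∧
        (pos v).1 + (κ i + κ j) * (pos v).2 = (pos w).1 + (κ i + κ j) * (pos w).2) ∧
      -- a placed edge of type `[i, j]` is a line-soliton of type `[i, j]`
      (∀ e i j, L.plabicMinus.HasType e i j →
        {p ∈ L.plabicMinus.placedEdge κ pos e | ¬ IsSolitonPoint κ M i j p}.Finite) ∧
      -- a black (white) vertex has a unique edge that goes to larger (smaller) `ȳ`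
      (∀ v, ∃ p₀ : Fin 3, ∀ p e b, L.plabicMinus.attach e b = Sum.inl (v, p) →
        ((L.plabicMinus.black v ↔ p = p₀) →
          ∀ q ∈ L.plabicMinus.placedEdge κ pos e, (pos v).2 ≤ q.2) ∧
        (¬ (L.plabicMinus.black v ↔ p = p₀) →
          ∀ q ∈ L.plabicMinus.placedEdge κ pos e, q.2 ≤ (pos v).2))) ∧
    -- the rescaled contour plots converge to the limit contour plot as `t → -∞`
    (∀ A ∈ positroidCell k M,
      Tendsto (fun t : ℝ => Metric.hausdorffEDist
          {p : ℝ × ℝ | (t * p.1, t * p.2) ∈ contourPlot κ M A t} (contourPlotMinusInfty κ M))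
        atBot (𝓝 0)) := by
  obtain ⟨A, hA⟩ := hM
  have hne := hML.nonempty hA
  have hπ := hML.bijective
  have hLA := LeDiagram.matches_of_isNecklacePermutation hA hne hML
  refine ⟨LeDiagram.isGeneralizedPlabic hL hπ, LeDiagram.isTripPermutation hL hπ,
    fun e => ⟨_, _, LeDiagram.hasType_tripLabel e⟩, ⟨L.vertexPos κ, fun v => ?_, ?_,
      LeDiagram.vertexPos_injective hκ, fun e e' h => LeDiagram.placedEdge_inter_subsingleton hκ hπ h,
      fun e v w p q i j hv hw h => LeDiagram.slope_of_attach hκ.1 hv hw h,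
      fun e i j h => LeDiagram.finite_not_isSolitonPoint hκ hA hne hLA hπ h, fun v => ?_⟩,
    fun A hA => tendsto_hausdorffEDist_contourPlot hκ hA hne⟩
  · exact ⟨_, _, _, LeDiagram.rowLabel_lt_midLabel v, LeDiagram.midLabel_lt_colLabel v,
      LeDiagram.vertexHasType hL hπ v, rfl⟩
  · rw [contourPlotMinusInfty_eq hκ hA hne, LeDiagram.iUnion_placedEdge hκ hA hne hLA hπ]
  · -- the diagonal half-edge: at a black vertex only this one goes up, at a white one only this one down
    refine ⟨if v.isRight then 0 else 2, fun p e b h => ?_⟩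
    rw [← LeDiagram.attach_true_iff e b h]
    exact ⟨fun hb x hx => (LeDiagram.direction_of_attach hκ.1 hπ h hx).1 hb,
      fun hb x hx => (LeDiagram.direction_of_attach hκ.1 hπ h hx).2 hb⟩
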